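/- All functions, vector fields and maps are complex-analytic. Let $m,d,p,q\ge 0$ be integers and consider an evolution system $$u^i_t=F^i(x,t,u^j_k)_{1\le j\le m,\ 0\le k\le d},\qquad i=1,\dots,m .$$ Its infinite prolongation $\mathcal E$ has the coordinates $x$, $t$, $u^i_k$ ($1\le i\le m$, $k\ge 0$); functions on (open subsets of) $\mathcal E$, or of $\mathcal E\times\mathbb C^q$, depend on finitely many coordinates $u^i_k$ only. Put $D_x=\partial_x+\sum_{i,k}u^i_{k+1}\partial_{u^i_k}$ and $D_t=\partial_t+\sum_{i,k}D_x^k(F^i)\,\partial_{u^i_k}$. Let $a=(x_0,t_0,a^i_k)\in\mathcal E$ be a point near which the $F^i$ are defined. *Coverings.* Let $w^1,\dots,w^q$ be coordinates on $\mathbb C^q$ and $b\in\mathbb C^q$. A covering near $(a,b)$ is a pair $A=\sum_j\alpha^j\partial_{w^j}$, $B=\sum_j\beta^j\partial_{w^j}$, with $\alpha^j,\beta^j$ functions on a neighborhood of $(a,b)$ in $\mathcal E\times\mathbb C^q$, such that $D_x(B)-D_t(A)+[A,B]=0$. It is of order $\le p$ if $\partial A/\partial u^i_s=0$ for all $s>p$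 and all $i$. A covering $(A',B')$ near $(a,b')$ is locally gauge equivalent to $(A,B)$ near $(a,b)$ if there is a locally invertible change of variables $w=g(w',x,t,u^i_k,\dots)$ over $\mathcal E$, with inverse of the same form, carrying $(a,b')$ to $(a,b)$, such that near $(a,b')$ $$\frac{\partial g}{\partial w'}A'+D_x(g)=A\circ g,\qquad \frac{\partial g}{\partial w'}B'+D_t(g)=B\circ g .$$ *The algebra $\mathbb F^p(\mathcal E,a)$.* Let $\mathcal M_n$ be the set of $m\times(n+1)$ matrices $\gamma=(\gamma_{ik})_{1\le i\le m,\,0\le k\le n}$ with nonnegative integer entries (with $\mathcal M_{-1}=\{0\}$), and $U^\gamma=\prod_{i,k}(u^i_k-a^i_k)^{\gamma_{ik}}$. Let $\mathfrak F$ be the free complex Lie algebra on symbols $\mathbf A^{l_1,l_2}_\alpha$, $\mathbf B^{l_1,l_2}_\beta$ with $l_1,l_2\ge 0$, $\alpha\in\mathcal M_p$, $\beta\in\mathcal M_{p+d-1}$, and put $$\mathbf A=\sum (x-x_0)^{l_1}(t-t_0)^{l_2}U^\alpha\,\mathbf A^{l_1,l_2}_\alpha,\qquad \mathbf B=\sum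 (x-x_0)^{l_1}(t-t_0)^{l_2}U^\beta\,\mathbf B^{l_1,l_2}_\beta .$$ Expanding in Taylor series at $a$, write $D_x(\mathbf B)-D_t(\mathbf A)+[\mathbf A,\mathbf B]=\sum_{\gamma\in\mathcal M_{p+d},\,l_1,l_2}(x-x_0)^{l_1}(t-t_0)^{l_2}U^\gamma\,\mathbf Z^{l_1,l_2}_\gamma$ with $\mathbf Z^{l_1,l_2}_\gamma\in\mathfrak F$. Then $\mathbb F^p(\mathcal E,a)$ is the quotient of $\mathfrak F$ by the ideal generated by all $\mathbf Z^{l_1,l_2}_\gamma$, all $\mathbf A^{l_1,l_2}_0$, all $\mathbf B^{0,l_2}_0$, and all $\mathbf A^{l_1,l_2}_\alpha$ for which there are $i_0\in\{1,\dots,m\}$ and $k_0\in\{1,\dots,p\}$ with $\alpha_{i_0k_0}=1$, $\alpha_{ik}=0$ for all $k>k_0$ and all $i$, $\alpha_{ik_0}=0$ for all $i\ne i_0$, and $\alpha_{i,k_0-1}=0$ for all $i>i_0$. The images of $\mathbf A^{l_1,l_2}_\alpha,\mathbf B^{l_1,l_2}_\beta$ are denoted $\mathbb A^{l_1,l_2}_\alpha,\mathbb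 B^{l_1,l_2}_\beta$. *Actions.* An action of a Lie algebra on an open set $W\subset\mathbb C^q$ is a homomorphism to the Lie algebra of vector fields on $W$. An action $\rho$ of $\mathbb F^p(\mathcal E,a)$ on a neighborhood $W$ of $b'$ gives rise to $(A',B')$ near $(a,b')$ if near $(a,b')$ the series $$A'=\sum (x-x_0)^{l_1}(t-t_0)^{l_2}U^\alpha\,\rho(\mathbb A^{l_1,l_2}_\alpha),\qquad B'=\sum (x-x_0)^{l_1}(t-t_0)^{l_2}U^\beta\,\rho(\mathbb B^{l_1,l_2}_\beta)$$ converge absolutely, with analytic sums. Actions $\rho_1$ near $b_1$ and $\rho_2$ near $b_2$ are locally isomorphic if there is a biholomorphic map $\varphi$ from a neighborhood of $b_1$ onto a neighborhood of $b_2$ with $\varphi(b_1)=b_2$ and $\varphi_*(\rho_1(Y))=\rho_2(Y)$ for all $Y\in\mathbb F^p(\mathcal E,a)$. **Theorem.** Let $(A,B)$ be a covering of order $\le p$ near $(a,b)$. (1) There is an action of $\mathbb F^p(\mathcal E,a)$ on an open neighborhood of $b$ in $\mathbb C^q$ that gives rise to a covering $(A',B')$ of order $\le p$ near $(a,b)$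 which is locally gauge equivalent to $(A,B)$. (2) If $\rho_1$, $\rho_2$ are actions of $\mathbb F^p(\mathcal E,a)$ on neighborhoods of $b_1,b_2\in\mathbb C^q$ that give rise to $(A_1,B_1)$ near $(a,b_1)$ and $(A_2,B_2)$ near $(a,b_2)$, both locally gauge equivalent to $(A,B)$ near $(a,b)$, then $\rho_1$ near $b_1$ and $\rho_2$ near $b_2$ are locally isomorphic. -/

import Mathlib

namespace EvCov

noncomputable section

open Filter Topology TopologicalSpace

/-! ### Jets and total derivatives -/

/-- Points `(x, t, u)` with coordinates `u i k`, `i` in `Fin m` and `k` in `K`.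
`Jet m ℕ` is the infinite prolongation of an evolution system with `m` unknown functions, with the
coordinates `x`, `t`, `u^i_k` (and the product topology), and `Jet m (Fin n)` is the space of the
coordinates `x`, `t`, `u^i_k` with `k < n`. -/
abbrev Jet (m : ℕ) (K : Type) : Type := ℂ × ℂ × (Fin m → K → ℂ)

/-- The projection that keeps `x`, `t` and the `u^i_k` with `k < n`. -/
def trunc {m : ℕ} (n : ℕ) (z : Jet m ℕ) : Jet m (Fin n) :=
  (z.1, z.2.1, fun i k => z.2.2 i k)

/-- The coordinate space `ℂ^q` of `w^1, …, w^q`. -/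
abbrev Fib (q : ℕ) : Type := Fin q → ℂ

/-- Complex-analytic functions near the point `c = (a, b)` of `ℰ × W`: near `c`, the function
depends on finitely many of the coordinates only, and is analytic in these. -/
def JetAnalyticAt {m q : ℕ} (f : Jet m ℕ × Fib q → Fib q) (c : Jet m ℕ × Fib q) : Prop :=
  ∃ (n : ℕ) (f₀ : Jet m (Fin n) × Fib q → Fib q),
    AnalyticAt ℂ f₀ (trunc n c.1, c.2) ∧ ∀ᶠ y in 𝓝 c, f y = f₀ (trunc n y.1, y.2)

section TotalDerivatives

variable {m : ℕ} {E : Type} [NormedAddCommGroup E] [NormedSpace ℂ E]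

/-- The total derivative `D_x = ∂/∂x + ∑ u^i_{k+1} ∂/∂u^i_k`: the derivative along the vector field
with the components `1`, `0`, `u^i_{k+1}`. -/
def Dx (f : Jet m ℕ → E) (z : Jet m ℕ) : E :=
  lineDeriv ℂ f z (1, 0, fun i k => z.2.2 i (k + 1))

/-- The total derivative `D_t = ∂/∂t + ∑ D_x^k(F^i) ∂/∂u^i_k` of the system `u^i_t = F^i`, where
`F^i` depends on `x`, `t`, `u^j_k` with `k ≤ d`: the derivative along the vector field with the
components `0`, `1`, `D_x^k(F^i)`. -/
def Dt {d : ℕ} (F : Jet m (Fin (d + 1)) → Fin m → ℂ) (f : Jet m ℕ → E) (z : Jet m ℕ) : E :=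
  lineDeriv ℂ f z (0, 1, fun i k => (Dx^[k] fun y => F (trunc (d + 1) y) i) z)

end TotalDerivatives

/-- The coordinate vector `∂/∂x`. -/
def ex (m : ℕ) : Jet m ℕ := (1, 0, 0)

/-- The coordinate vector `∂/∂t`. -/
def et (m : ℕ) : Jet m ℕ := (0, 1, 0)

/-- The coordinate vector `∂/∂u^i_k`. -/
def eu {m : ℕ} (i : Fin m) (k : ℕ) : Jet m ℕ := (0, 0, Pi.single i (Pi.single k 1))

/-! ### Coverings and gauge equivalence -/

/-- The vector fields `A = ∑ α^j ∂/∂w^j`, `B = ∑ β^j ∂/∂w^j`, given by the columns of their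
components, define a covering near `c = (a, b)`: they are analytic and
`D_x(B) - D_t(A) + [A, B] = 0`. -/
def IsCoveringAt {m d q : ℕ} (F : Jet m (Fin (d + 1)) → Fin m → ℂ)
    (A B : Jet m ℕ × Fib q → Fib q) (c : Jet m ℕ × Fib q) : Prop :=
  JetAnalyticAt A c ∧ JetAnalyticAt B c ∧
    ∀ᶠ y in 𝓝 c,
      Dx (fun z => B (z, y.2)) y.1 - Dt F (fun z => A (z, y.2)) y.1
        + VectorField.lieBracket ℂ (fun w => A (y.1, w)) (fun w => B (y.1, w)) y.2 = 0

/-- The covering is of order at most `p` near `c`: `∂A/∂u^i_s = 0` for all `s > p` and all `i`. -/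
def OrderLEAt {m q : ℕ} (p : ℕ) (A : Jet m ℕ × Fib q → Fib q) (c : Jet m ℕ × Fib q) : Prop :=
  ∀ᶠ y in 𝓝 c, ∀ (i : Fin m) (s : ℕ), p < s →
    lineDeriv ℂ (fun z => A (z, y.2)) y.1 (eu i s) = 0

/-- The system `(A', B')` near `(a, b')` is obtained from the system `(A, B)` near `(a, b)` by a
local gauge transformation `w ↦ g(w', x, t, u^i_k, …)`, which carries `(a, b')` to `(a, b)`; `h` is
the inverse transformation. -/
def GaugeEquivAt {m d q : ℕ} (F : Jet m (Fin (d + 1)) → Fin m → ℂ) (a : Jet m ℕ)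
    (b : Fib q) (A B : Jet m ℕ × Fib q → Fib q)
    (b' : Fib q) (A' B' : Jet m ℕ × Fib q → Fib q) : Prop :=
  ∃ g h : Jet m ℕ × Fib q → Fib q,
    JetAnalyticAt g (a, b') ∧ JetAnalyticAt h (a, b) ∧ g (a, b') = b ∧
    (∀ᶠ y in 𝓝 (a, b'), h (y.1, g y) = y.2) ∧
    (∀ᶠ y in 𝓝 (a, b), g (y.1, h y) = y.2) ∧
    ∀ᶠ y in 𝓝 (a, b'),
      fderiv ℂ (fun w => g (y.1, w)) y.2 (A' y) + Dx (fun z => g (z, y.2)) y.1 = A (y.1, g y) ∧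
      fderiv ℂ (fun w => g (y.1, w)) y.2 (B' y) + Dt F (fun z => g (z, y.2)) y.1 = B (y.1, g y)

/-! ### The Lie algebra `𝔽^p(ℰ, a)` -/

/-- Exponents `(l₁, l₂, γ)`, where `γ` is a matrix of size `m × n` with entries `γ i k`, `k < n`. -/
abbrev Expo (m n : ℕ) : Type := ℕ × ℕ × (Fin m → Fin n → ℕ)

/-- The monomial `(x - x₀)^{l₁} (t - t₀)^{l₂} ∏ (u^i_k - a^i_k)^{γ i k}`. -/
def mono {m n : ℕ} (a : Jet m ℕ) (e : Expo m n) (z : Jet m ℕ) : ℂ :=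
  (z.1 - a.1) ^ e.1 * (z.2.1 - a.2.1) ^ e.2.1 *
    ∏ i : Fin m, ∏ k : Fin n, (z.2.2 i k - a.2.2 i k) ^ e.2.2 i k

/-- The derivative of a function in the direction of a fixed vector. -/
def pd {m : ℕ} (v : Jet m ℕ) (f : Jet m ℕ → ℂ) (z : Jet m ℕ) : ℂ := lineDeriv ℂ f z v

/-- The Taylor coefficient of `f` at `a` that belongs to the monomial with exponent `e`: the
iterated partial derivative, divided by the factorials. -/
def taylorCoeff {m n : ℕ} (a : Jet m ℕ) (e : Expo m n) (f : Jet m ℕ → ℂ) : ℂ :=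
  ((pd (ex m))^[e.1] ((pd (et m))^[e.2.1]
      ((List.finRange m ×ˢ List.finRange n).foldr
        (fun ik g => (pd (eu ik.1 ik.2))^[e.2.2 ik.1 ik.2] g) f))) a
    / (e.1.factorial * e.2.1.factorial * ∏ i : Fin m, ∏ k : Fin n, (e.2.2 i k).factorial : ℕ)

/-- The symbols `𝐀^{l₁,l₂}_α`, where `α` has the columns `0, …, p`, and `𝐁^{l₁,l₂}_β`, where `β` has
the columns `0, …, p + d - 1`. -/
inductive Gen (m d p : ℕ) : Type
  | A (e : Expo m (p + 1)) : Gen m d p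
  | B (e : Expo m (p + d)) : Gen m d p

/-- The free Lie algebra `𝔉` on these symbols. -/
abbrev Free (m d p : ℕ) : Type := FreeLieAlgebra ℂ (Gen m d p)

section Algebra

variable {m d : ℕ} (p : ℕ)

/-- The element `𝐀^{l₁,l₂}_α` of `𝔉`. -/
def symA (e : Expo m (p + 1)) : Free m d p := FreeLieAlgebra.of ℂ (Gen.A e)

/-- The element `𝐁^{l₁,l₂}_β` of `𝔉`. -/
def symB (e : Expo m (p + d)) : Free m d p := FreeLieAlgebra.of ℂ (Gen.B e)

/-- The element `𝐙^{l₁,l₂}_γ` of `𝔉`: the coefficient with exponent `e = (l₁, l₂, γ)` of the formal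
power series `D_x(𝐁) - D_t(𝐀) + [𝐀, 𝐁]`, where `γ` has the columns `0, …, p + d`. In each of the
three sums only finitely many terms are nonzero. -/
def elemZ (F : Jet m (Fin (d + 1)) → Fin m → ℂ) (a : Jet m ℕ) (e : Expo m (p + d + 1)) :
    Free m d p :=
  (∑ᶠ β : Expo m (p + d), taylorCoeff a e (Dx (mono a β)) • symB p β)
    - (∑ᶠ α : Expo m (p + 1), taylorCoeff a e (Dt F (mono a α)) • symA p α)
    + ∑ᶠ s : Expo m (p + 1) × Expo m (p + d),
        taylorCoeff a e (fun z => mono a s.1 z * mono a s.2 z) • ⁅symA (d := d) p s.1, symB p s.2⁆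

/-- The set `M^p_{i₀,k₀}` of matrices with the columns `0, …, p`, for `k₀` in `{1, …, p}`. -/
def specialM (i₀ : Fin m) (k₀ : Fin (p + 1)) : Set (Fin m → Fin (p + 1) → ℕ) :=
  {α | α i₀ k₀ = 1 ∧ (∀ k, k₀ < k → ∀ i, α i k = 0) ∧ (∀ i, i ≠ i₀ → α i k₀ = 0) ∧
    ∀ i, i₀ < i → ∀ k : Fin (p + 1), (k : ℕ) + 1 = k₀ → α i k = 0}

/-- The generators of the ideal `𝔍`. -/
def relators (F : Jet m (Fin (d + 1)) → Fin m → ℂ) (a : Jet m ℕ) : Set (Free m d p) :=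
  {r | (∃ e : Expo m (p + d + 1), r = elemZ p F a e) ∨
    (∃ l₁ l₂ : ℕ, r = symA p (l₁, l₂, 0)) ∨
    (∃ l₂ : ℕ, r = symB p (0, l₂, 0)) ∨
    ∃ (l₁ l₂ : ℕ) (i₀ : Fin m) (k₀ : Fin (p + 1)), 1 ≤ (k₀ : ℕ) ∧
      ∃ α ∈ specialM p i₀ k₀, r = symA p (l₁, l₂, α)}

/-- The ideal `𝔍` of `𝔉`. -/
def relIdeal (F : Jet m (Fin (d + 1)) → Fin m → ℂ) (a : Jet m ℕ) : LieIdeal ℂ (Free m d p) :=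
  LieSubmodule.lieSpan ℂ (Free m d p) (relators p F a)

/-- The Lie algebra `𝔽^p(ℰ, a) = 𝔉 / 𝔍`. -/
abbrev FAlg (F : Jet m (Fin (d + 1)) → Fin m → ℂ) (a : Jet m ℕ) : Type :=
  Free m d p ⧸ relIdeal p F a

/-- The generator `𝔸^{l₁,l₂}_α` of `𝔽^p(ℰ, a)`. -/
def genA (F : Jet m (Fin (d + 1)) → Fin m → ℂ) (a : Jet m ℕ) (e : Expo m (p + 1)) :
    FAlg p F a := LieSubmodule.Quotient.mk (symA p e)

/-- The generator `𝔹^{l₁,l₂}_β` of `𝔽^p(ℰ, a)`. -/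
def genB (F : Jet m (Fin (d + 1)) → Fin m → ℂ) (a : Jet m ℕ) (e : Expo m (p + d)) :
    FAlg p F a := LieSubmodule.Quotient.mk (symB p e)

end Algebra

/-! ### Analytic vector fields, actions -/

/-- The Lie algebra `𝒟(W)` of analytic vector fields on an open subset `W` of `ℂ^q`. A vector field
on `W` is represented by its extension by zero. -/
def VF {q : ℕ} (W : Opens (Fib q)) : Submodule ℂ (Fib q → Fib q) where
  carrier := {V | AnalyticOnNhd ℂ V W ∧ ∀ w ∉ W, V w = 0}
  add_mem' := fun {V V'} h h' => ⟨h.1.add h'.1, fun w hw => by simp [h.2 w hw, h'.2 w hw]⟩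
  zero_mem' := ⟨analyticOnNhd_const, fun _ _ => rfl⟩
  smul_mem' := fun c V h =>
    ⟨fun w hw => analyticAt_const.smul (h.1 w hw), fun w hw => by simp [h.2 w hw]⟩

namespace VF

variable {q : ℕ} {W : Opens (Fib q)}

theorem analyticAt (V : VF W) {w : Fib q} (hw : w ∈ W) : AnalyticAt ℂ (V : Fib q → Fib q) w :=
  V.2.1 w hw

theorem differentiableAt (V : VF W) {w : Fib q} (hw : w ∈ W) :
    DifferentiableAt ℂ (V : Fib q → Fib q) w :=
  (VF.analyticAt V hw).differentiableAt

theorem apply_of_notMem (V : VF W) {w : Fib q} (hw : w ∉ W) : (V : Fib q → Fib q) w = 0 :=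
  V.2.2 w hw

open Classical in
/-- The Lie bracket of vector fields on `W`. -/
def bracket (V V' : VF W) : VF W :=
  ⟨fun w => if w ∈ W then VectorField.lieBracket ℂ (V : Fib q → Fib q) V' w else 0, by
    refine ⟨fun w hw => ?_, fun w hw => if_neg hw⟩
    have h : AnalyticAt ℂ (VectorField.lieBracket ℂ (V : Fib q → Fib q) V') w := by
      have h1 := VF.analyticAt V hw
      have h2 := VF.analyticAt V' hw
      have h3 : AnalyticAt ℂ (fun y => fderiv ℂ (V' : Fib q → Fib q) y ((V : Fib q → Fib q) y)
          - fderiv ℂ (V : Fib q → Fib q) y ((V' : Fib q → Fib q) y)) w :=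
        ((ContinuousLinearMap.analyticAt_bilinear
            (ContinuousLinearMap.apply ℂ (Fib q)).flip _).comp₂ h2.fderiv h1).sub
          ((ContinuousLinearMap.analyticAt_bilinear
            (ContinuousLinearMap.apply ℂ (Fib q)).flip _).comp₂ h1.fderiv h2)
      exact h3
    refine h.congr ?_
    filter_upwards [W.isOpen.mem_nhds hw] with y hy
    exact (if_pos hy).symm⟩

instance : Bracket (VF W) (VF W) := ⟨bracket⟩

theorem bracket_apply (V V' : VF W) {w : Fib q} (hw : w ∈ W) :
    (⁅V, V'⁆ : VF W).1 w = VectorField.lieBracket ℂ (V : Fib q → Fib q) V' w :=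
  if_pos hw

theorem ext_on {V V' : VF W} (h : ∀ w ∈ W, V.1 w = V'.1 w) : V = V' := by
  apply Subtype.ext
  funext w
  by_cases hw : w ∈ W
  · exact h w hw
  · exact (VF.apply_of_notMem V hw).trans (VF.apply_of_notMem V' hw).symm

theorem bracket_eventuallyEq (V V' : VF W) {w : Fib q} (hw : w ∈ W) :
    (⁅V, V'⁆ : VF W).1 =ᶠ[𝓝 w] VectorField.lieBracket ℂ (V : Fib q → Fib q) V' := by
  filter_upwards [W.isOpen.mem_nhds hw] with y hy using bracket_apply V V' hy

instance : LieRing (VF W) where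
  add_lie X Y Z := ext_on fun w hw => by
    change _ = (⁅X, Z⁆ : VF W).1 w + (⁅Y, Z⁆ : VF W).1 w
    rw [bracket_apply _ _ hw, bracket_apply _ _ hw, bracket_apply _ _ hw]
    exact VectorField.lieBracket_add_left (VF.differentiableAt X hw) (VF.differentiableAt Y hw)
  lie_add X Y Z := ext_on fun w hw => by
    change _ = (⁅X, Y⁆ : VF W).1 w + (⁅X, Z⁆ : VF W).1 w
    rw [bracket_apply _ _ hw, bracket_apply _ _ hw, bracket_apply _ _ hw]
    exact VectorField.lieBracket_add_right (VF.differentiableAt Y hw) (VF.differentiableAt Z hw)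
  lie_self X := ext_on fun w hw => by
    rw [bracket_apply _ _ hw]
    simp [VectorField.lieBracket]
  leibniz_lie X Y Z := ext_on fun w hw => by
    change _ = (⁅⁅X, Y⁆, Z⁆ : VF W).1 w + (⁅Y, ⁅X, Z⁆⁆ : VF W).1 w
    rw [bracket_apply _ _ hw, bracket_apply _ _ hw, bracket_apply _ _ hw,
      EventuallyEq.rfl.lieBracket_vectorField_eq (bracket_eventuallyEq Y Z hw),
      (bracket_eventuallyEq X Y hw).lieBracket_vectorField_eq EventuallyEq.rfl,
      EventuallyEq.rfl.lieBracket_vectorField_eq (bracket_eventuallyEq X Z hw)]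
    exact VectorField.leibniz_identity_lieBracket (n := minSmoothness ℂ 2) le_rfl
      (VF.analyticAt X hw).contDiffAt (VF.analyticAt Y hw).contDiffAt (VF.analyticAt Z hw).contDiffAt

instance : LieAlgebra ℂ (VF W) where
  lie_smul c X Y := ext_on fun w hw => by
    change _ = c • (⁅X, Y⁆ : VF W).1 w
    rw [bracket_apply _ _ hw, bracket_apply _ _ hw]
    exact VectorField.lieBracket_const_smul_right (VF.differentiableAt Y hw)

end VF

/-- An action of a Lie algebra `L` on `W`: a homomorphism from `L` to `𝒟(W)`. -/
abbrev LieAction (L : Type) [LieRing L] [LieAlgebra ℂ L] {q : ℕ} (W : Opens (Fib q)) : Type :=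
  L →ₗ⁅ℂ⁆ VF W

/-- Near `(a, b)`, the power series `∑ (x - x₀)^{l₁} (t - t₀)^{l₂} U^α ρ(𝔸^{l₁,l₂}_α)` and
`∑ (x - x₀)^{l₁} (t - t₀)^{l₂} U^β ρ(𝔹^{l₁,l₂}_β)` of the action `ρ` converge absolutely
to the analytic vector fields `A` and `B`. -/
def ArisesAt {m d q : ℕ} (p : ℕ) (F : Jet m (Fin (d + 1)) → Fin m → ℂ) (a : Jet m ℕ)
    {W : Opens (Fib q)} (ρ : LieAction (FAlg p F a) W) (b : Fib q)
    (A B : Jet m ℕ × Fib q → Fib q) : Prop :=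
  JetAnalyticAt A (a, b) ∧ JetAnalyticAt B (a, b) ∧
    ∀ᶠ y in 𝓝 (a, b),
      HasSum (fun e : Expo m (p + 1) => mono a e y.1 • (ρ (genA p F a e)).1 y.2) (A y) ∧
      HasSum (fun e : Expo m (p + d) => mono a e y.1 • (ρ (genB p F a e)).1 y.2) (B y)

/-- The actions `ρ₁` near `b₁` and `ρ₂` near `b₂` are locally isomorphic: there is a biholomorphic
map `φ` of an open neighborhood of `b₁` in `W₁` to an open neighborhood of `b₂` in `W₂` with
`φ(b₁) = b₂` and `φ_*(ρ₁(Y)) = ρ₂(Y)` for all `Y`. -/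
def LocallyIsomorphicAt {L : Type} [LieRing L] [LieAlgebra ℂ L] {q : ℕ} {W₁ W₂ : Opens (Fib q)}
    (ρ₁ : LieAction L W₁) (b₁ : Fib q) (ρ₂ : LieAction L W₂) (b₂ : Fib q) : Prop :=
  ∃ φ : OpenPartialHomeomorph (Fib q) (Fib q),
    φ.source ⊆ W₁ ∧ φ.target ⊆ W₂ ∧ b₁ ∈ φ.source ∧ φ b₁ = b₂ ∧
    AnalyticOnNhd ℂ φ φ.source ∧ AnalyticOnNhd ℂ φ.symm φ.target ∧
    ∀ Y : L, ∀ w ∈ φ.source, fderiv ℂ φ w ((ρ₁ Y).1 w) = (ρ₂ Y).1 (φ w)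

end

end EvCov

/-! A covering is a pair of commuting vector fields D_x + A and D_t + B on ℰ × W lifting D_x and
D_t, and a gauge transformation is a change of the fibre coordinates w that depends on the point of
ℰ. Both halves of the theorem rest on a normal form for coverings that is unique up to changes of w
alone.

Order the coordinates as t, x, u^1_0, …, u^m_0, u^1_1, … (`rank`) and attach to each coordinate c a
component Φ_c of the covering (`Phi`): B to t, A to x, ∂A/∂u^i_{k+1} to u^i_k. Since [∂/∂u^i_{k+1},
D_x] = ∂/∂u^i_k, differentiating the gauge equation for A by u^i_{k+1} gives the same law for all c:
if g does not depend on the coordinates after c, then g_w Φ'_c + ∂g/∂c = Φ_c ∘ g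
(`GaugePair.phi_eq`). A covering is normal if each Φ_c vanishes wherever the coordinates after c
have their values at a (`NormalAt`).

Existence of the normal form: order ≤ p makes Φ_c vanish from the coordinates u^i_p on. The finitely
many remaining coordinates are treated from the last to the first. Solving the ordinary differential
equation ∂g/∂c = Φ_c(g) with g = w at the value of c at a normalizes Φ_c, and the components treated
before are only multiplied by an invertible matrix (`exists_gauge_step`, `exists_normal_covering`).
Uniqueness: for a gauge transformation between two normal coverings the same law gives ∂g/∂c = 0,
again from the last coordinate to the first, so that g depends on w only
(`GaugePair.eventually_eq_base`).

Link with the algebra: the Taylor coefficients of A and B at a are vector fields on W. Normality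
says that exactly those coefficients vanish whose symbols are put to zero in 𝔽^p(ℰ, a)
(`incr_mem_specialM_iff`, `eventually_coeffNormal`, `normalAt_of_coeffNormal`), and the covering
equation says that the elements 𝐙 act by zero (`elemZ_eq_sum`, `eventually_coeff_covering`). The
columns allowed for 𝐁 are justified by `eventually_lineDeriv_B_eq_zero`. Hence a normal covering of
order ≤ p yields an action (`exists_action_of_normal`), and whatever arises from an action is normal
(`ArisesAt.normalAt`). In part (2) the two coverings are therefore related by a map φ of W alone; φ
relates the Taylor coefficients, hence the generators, hence the actions
(`GaugePair.locallyIsomorphicAt`).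

The analytic groundwork has three pieces. The space ℰ carries no norm, so calculus is done for
functions that factor locally through a continuous linear map to a normed space (`CylAnalyticAt`).
Flows depend analytically on all data by the inverse function theorem in a space of paths
(`exists_analytic_flow`). Identities between Taylor coefficients are obtained by replacing functions
by Taylor polynomials and counting orders of vanishing (`VanishAt`), which avoids termwise
differentiation of series. -/

namespace EvCov

noncomputable section

open Filter Topology TopologicalSpace

/-! ### Analytic functions of finitely many coordinates on a topological vector space -/

section Cylindrical

variable {P : Type} [AddCommGroup P] [Module ℂ P] [TopologicalSpace P]
  {P' : Type} [AddCommGroup P'] [Module ℂ P'] [TopologicalSpace P']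
  {E' : Type} [NormedAddCommGroup E'] [NormedSpace ℂ E']
  {E : Type} [NormedAddCommGroup E] [NormedSpace ℂ E]

/-- Near `c`, the function `f` is an analytic function of a continuous linear map to some normed
space. -/
def CylAnalyticAt (f : P → E) (c : P) : Prop :=
  ∃ (V : Type) (_ : NormedAddCommGroup V) (_ : NormedSpace ℂ V) (L : P →L[ℂ] V) (f₀ : V → E),
    AnalyticAt ℂ f₀ (L c) ∧ f =ᶠ[𝓝 c] fun y => f₀ (L y)

/-- All continuous linear images in normed spaces of the map `X` are cylindrical analytic. -/
def CylMapAt (X : P → P') (c : P) : Prop :=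
  ∀ (V : Type) [NormedAddCommGroup V] [NormedSpace ℂ V] (L : P' →L[ℂ] V),
    CylAnalyticAt (fun y => L (X y)) c

/-- The vector `ξ` is the derivative of the map `X` at `c` in the direction `v`, as seen by all
continuous linear maps to normed spaces. -/
def HasCylDeriv (X : P → P') (c v : P) (ξ : P') : Prop :=
  ∀ (V : Type) [NormedAddCommGroup V] [NormedSpace ℂ V] (L : P' →L[ℂ] V),
    lineDeriv ℂ (fun y => L (X y)) c v = L ξ

theorem cylAnalyticAt_const (e : E) (c : P) : CylAnalyticAt (fun _ => e) c :=
  ⟨ℂ, inferInstance, inferInstance, 0, fun _ => e, analyticAt_const, Eventually.of_forall fun _ => rfl⟩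

theorem cylAnalyticAt_clm (L : P →L[ℂ] E) (c : P) : CylAnalyticAt (fun y => L y) c :=
  ⟨E, inferInstance, inferInstance, L, id, analyticAt_id, Eventually.of_forall fun _ => rfl⟩

theorem cylMapAt_const (e : P') (c : P) : CylMapAt (fun _ => e) c :=
  fun _ _ _ _ => cylAnalyticAt_const _ c

theorem cylMapAt_clm (M : P →L[ℂ] P') (c : P) : CylMapAt (fun y => M y) c :=
  fun _ _ _ L => cylAnalyticAt_clm (L.comp M) c

theorem CylAnalyticAt.congr {f g : P → E} {c : P} (hf : CylAnalyticAt f c) (h : g =ᶠ[𝓝 c] f) :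
    CylAnalyticAt g c := by
  obtain ⟨V, i, j, L, f₀, h₀, h₁⟩ := hf
  exact ⟨V, i, j, L, f₀, h₀, h.trans h₁⟩

theorem CylAnalyticAt.eventually [CompleteSpace E] {f : P → E} {c : P} (hf : CylAnalyticAt f c) :
    ∀ᶠ y in 𝓝 c, CylAnalyticAt f y := by
  obtain ⟨V, i, j, L, f₀, h₀, h₁⟩ := hf
  filter_upwards [h₁.eventually_nhds, L.continuous.continuousAt.eventually h₀.eventually_analyticAt]
    with y h1 h2 using ⟨V, i, j, L, f₀, h2, h1⟩

theorem CylAnalyticAt.continuousAt {f : P → E} {c : P} (hf : CylAnalyticAt f c) :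
    ContinuousAt f c := by
  obtain ⟨V, i, j, L, f₀, h₀, h₁⟩ := hf
  exact (ContinuousAt.comp (f := L) h₀.continuousAt L.continuous.continuousAt).congr h₁.symm

theorem CylAnalyticAt.comp_analyticAt {f : P → E} {c : P} {g : E → E'} (hg : AnalyticAt ℂ g (f c))
    (hf : CylAnalyticAt f c) : CylAnalyticAt (fun y => g (f y)) c := by
  obtain ⟨V, i, j, L, f₀, h₀, h₁⟩ := hf
  refine ⟨V, i, j, L, fun v => g (f₀ v), ?_, h₁.mono fun y hy => by simp only [hy]⟩
  rw [h₁.self_of_nhds] at hg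
  exact hg.fun_comp h₀

theorem CylAnalyticAt.clm_comp {f : P → E} {c : P} (hf : CylAnalyticAt f c) (M : E →L[ℂ] E') :
    CylAnalyticAt (fun y => M (f y)) c :=
  hf.comp_analyticAt (M.analyticAt _)

theorem CylAnalyticAt.prodMk {f : P → E} {g : P → E'} {c : P} (hf : CylAnalyticAt f c)
    (hg : CylAnalyticAt g c) : CylAnalyticAt (fun y => (f y, g y)) c := by
  obtain ⟨V, i, j, L, f₀, h₀, h₁⟩ := hf
  obtain ⟨V', i', j', L', g₀, k₀, k₁⟩ := hg
  refine ⟨V × V', inferInstance, inferInstance, L.prod L', fun v => (f₀ v.1, g₀ v.2), ?_, ?_⟩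
  · exact (AnalyticAt.comp (g := f₀) (f := Prod.fst) h₀ analyticAt_fst).prod
      (AnalyticAt.comp (g := g₀) (f := Prod.snd) k₀ analyticAt_snd)
  · filter_upwards [h₁, k₁] with y h1 h2
    simp [h1, h2]

theorem CylAnalyticAt.add {f g : P → E} {c : P} (hf : CylAnalyticAt f c) (hg : CylAnalyticAt g c) :
    CylAnalyticAt (fun y => f y + g y) c :=
  (hf.prodMk hg).comp_analyticAt (g := fun e : E × E => e.1 + e.2) (analyticAt_fst.add analyticAt_snd)

theorem CylAnalyticAt.sub {f g : P → E} {c : P} (hf : CylAnalyticAt f c) (hg : CylAnalyticAt g c) :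
    CylAnalyticAt (fun y => f y - g y) c :=
  (hf.prodMk hg).comp_analyticAt (g := fun e : E × E => e.1 - e.2) (analyticAt_fst.sub analyticAt_snd)

theorem CylAnalyticAt.smul {f : P → ℂ} {g : P → E} {c : P} (hf : CylAnalyticAt f c)
    (hg : CylAnalyticAt g c) : CylAnalyticAt (fun y => f y • g y) c :=
  (hf.prodMk hg).comp_analyticAt (g := fun e : ℂ × E => e.1 • e.2)
    (analyticAt_fst.smul analyticAt_snd)

theorem CylAnalyticAt.mul {f g : P → ℂ} {c : P} (hf : CylAnalyticAt f c)
    (hg : CylAnalyticAt g c) : CylAnalyticAt (fun y => f y * g y) c :=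
  hf.smul hg

theorem CylAnalyticAt.pow {f : P → ℂ} {c : P} (hf : CylAnalyticAt f c) (n : ℕ) :
    CylAnalyticAt (fun y => f y ^ n) c :=
  hf.comp_analyticAt (g := fun e : ℂ => e ^ n) (analyticAt_id.pow n)

theorem CylAnalyticAt.sum {ι : Type*} (s : Finset ι) {f : ι → P → E} {c : P}
    (hf : ∀ i ∈ s, CylAnalyticAt (f i) c) : CylAnalyticAt (fun y => ∑ i ∈ s, f i y) c := by
  classical
  induction s using Finset.induction_on with
  | empty => simpa using cylAnalyticAt_const 0 c
  | insert i s hi ih =>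
    simp only [Finset.sum_insert hi]
    exact (hf i (by simp)).add (ih fun j hj => hf j (by simp [hj]))

theorem CylAnalyticAt.prod {ι : Type*} (s : Finset ι) {f : ι → P → ℂ} {c : P}
    (hf : ∀ i ∈ s, CylAnalyticAt (f i) c) : CylAnalyticAt (fun y => ∏ i ∈ s, f i y) c := by
  classical
  induction s using Finset.induction_on with
  | empty => simpa using cylAnalyticAt_const 1 c
  | insert i s hi ih =>
    simp only [Finset.prod_insert hi]
    exact (hf i (by simp)).mul (ih fun j hj => hf j (by simp [hj]))

/-- `CylMapAt` controls `G` only after composition with maps to normed spaces. Continuity of `G`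
itself is needed to pull back the neighborhood on which `f` factors. -/
theorem CylAnalyticAt.comp {f : P' → E} {G : P → P'} {c : P} (hf : CylAnalyticAt f (G c))
    (hG : CylMapAt G c) (hG' : ContinuousAt G c) : CylAnalyticAt (fun y => f (G y)) c := by
  obtain ⟨V, i, j, L, f₀, h₀, h₁⟩ := hf
  exact CylAnalyticAt.congr (CylAnalyticAt.comp_analyticAt (f := fun y => L (G y)) h₀ (hG V L))
    (Tendsto.eventually hG' h₁)

theorem CylAnalyticAt.comp_clm {f : P' → E} {M : P →L[ℂ] P'} {c : P} (hf : CylAnalyticAt f (M c)) :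
    CylAnalyticAt (fun y => f (M y)) c :=
  hf.comp (cylMapAt_clm M c) M.continuous.continuousAt

theorem CylAnalyticAt.analyticAt {f : E' → E} {c : E'} (hf : CylAnalyticAt f c) :
    AnalyticAt ℂ f c := by
  obtain ⟨V, i, j, L, f₀, h₀, h₁⟩ := hf
  exact (h₀.fun_comp (L.analyticAt c)).congr h₁.symm

theorem hasCylDeriv_const (e : P') (c v : P) : HasCylDeriv (fun _ => e) c v 0 := by
  intro V _ _ L
  simp [lineDeriv]

section Deriv

variable [IsTopologicalAddGroup P] [ContinuousSMul ℂ P]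

theorem tendsto_add_smul (c v : P) : Tendsto (fun s : ℂ => c + s • v) (𝓝 0) (𝓝 c) := by
  have : Continuous fun s : ℂ => c + s • v := by fun_prop
  simpa using this.tendsto 0

theorem lineDeriv_congr {f g : P → E} {c : P} (h : f =ᶠ[𝓝 c] g) (v : P) :
    lineDeriv ℂ f c v = lineDeriv ℂ g c v :=
  Filter.EventuallyEq.deriv_eq ((tendsto_add_smul c v).eventually h)

theorem lineDeriv_congr_eventually {f g : P → E} {c : P} (h : f =ᶠ[𝓝 c] g) (X : P → P) :
    (fun y => lineDeriv ℂ f y (X y)) =ᶠ[𝓝 c] fun y => lineDeriv ℂ g y (X y) := by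
  filter_upwards [h.eventually_nhds] with y hy using lineDeriv_congr hy _

theorem hasLineDerivAt_of_eventuallyEq {V : Type} [NormedAddCommGroup V] [NormedSpace ℂ V]
    {f : P → E} {c : P} {L : P →L[ℂ] V} {f₀ : V → E} (h₀ : DifferentiableAt ℂ f₀ (L c))
    (h : f =ᶠ[𝓝 c] fun y => f₀ (L y)) (v : P) :
    HasLineDerivAt ℂ f (fderiv ℂ f₀ (L c) (L v)) c v := by
  have h1 : HasDerivAt (fun s : ℂ => f₀ (L c + s • L v)) (fderiv ℂ f₀ (L c) (L v)) 0 :=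
    h₀.hasFDerivAt.hasLineDerivAt (L v)
  refine h1.congr_of_eventuallyEq ?_
  filter_upwards [(tendsto_add_smul c v).eventually h] with s hs
  simp [hs]

/-- `lineDeriv` is not additive in the direction in general; here it is, because it is the Fréchet
derivative of the finite model `f₀` composed with `L`. -/
theorem CylAnalyticAt.exists_clm {f : P → E} {c : P} (hf : CylAnalyticAt f c) :
    ∃ f' : P →L[ℂ] E, ∀ v, HasLineDerivAt ℂ f (f' v) c v := by
  obtain ⟨V, i, j, L, f₀, h₀, h₁⟩ := hf
  exact ⟨(fderiv ℂ f₀ (L c)).comp L,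
    fun v => hasLineDerivAt_of_eventuallyEq h₀.differentiableAt h₁ v⟩

theorem CylAnalyticAt.hasLineDerivAt {f : P → E} {c : P} (hf : CylAnalyticAt f c) (v : P) :
    HasLineDerivAt ℂ f (lineDeriv ℂ f c v) c v := by
  obtain ⟨f', h⟩ := hf.exists_clm
  exact (h v).lineDeriv ▸ h v

theorem CylAnalyticAt.lineDeriv_add {f : P → E} {c : P} (hf : CylAnalyticAt f c) (v v' : P) :
    lineDeriv ℂ f c (v + v') = lineDeriv ℂ f c v + lineDeriv ℂ f c v' := by
  obtain ⟨f', h⟩ := hf.exists_clm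
  rw [(h _).lineDeriv, (h _).lineDeriv, (h _).lineDeriv, map_add]

theorem hasCylDeriv_of_clm (M : P →L[ℂ] P') (c v : P) : HasCylDeriv (fun y => M y) c v (M v) := by
  intro V _ _ L
  have := hasLineDerivAt_of_eventuallyEq (f := fun y => L (M y)) (c := c) (L := L.comp M) (f₀ := id)
    differentiableAt_id (Eventually.of_forall fun _ => rfl) v
  simpa using this.lineDeriv

theorem CylAnalyticAt.lineDeriv_clm_comp {f : P → E} {c : P} (hf : CylAnalyticAt f c)
    (M : E →L[ℂ] E') (v : P) : lineDeriv ℂ (fun y => M (f y)) c v = M (lineDeriv ℂ f c v) :=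
  HasLineDerivAt.lineDeriv (HasFDerivAt.comp_hasDerivAt (0 : ℂ) M.hasFDerivAt (hf.hasLineDerivAt v))

theorem lineDeriv_fun_add {f g : P → E} {c : P} (hf : CylAnalyticAt f c) (hg : CylAnalyticAt g c)
    (v : P) : lineDeriv ℂ (fun y => f y + g y) c v = lineDeriv ℂ f c v + lineDeriv ℂ g c v :=
  HasLineDerivAt.lineDeriv (HasDerivAt.add (hf.hasLineDerivAt v) (hg.hasLineDerivAt v))

theorem lineDeriv_fun_sub {f g : P → E} {c : P} (hf : CylAnalyticAt f c) (hg : CylAnalyticAt g c)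
    (v : P) : lineDeriv ℂ (fun y => f y - g y) c v = lineDeriv ℂ f c v - lineDeriv ℂ g c v :=
  HasLineDerivAt.lineDeriv (HasDerivAt.sub (hf.hasLineDerivAt v) (hg.hasLineDerivAt v))

theorem lineDeriv_fun_smul {f : P → ℂ} {g : P → E} {c : P} (hf : CylAnalyticAt f c)
    (hg : CylAnalyticAt g c) (v : P) :
    lineDeriv ℂ (fun y => f y • g y) c v = f c • lineDeriv ℂ g c v + lineDeriv ℂ f c v • g c := by
  have := HasDerivAt.fun_smul (hf.hasLineDerivAt v) (hg.hasLineDerivAt v)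
  simp only [zero_smul, add_zero] at this
  exact HasLineDerivAt.lineDeriv this

theorem CylAnalyticAt.lineDeriv_comp [IsTopologicalAddGroup P'] [ContinuousSMul ℂ P']
    {f : P' → E} {G : P → P'} {c v : P} {ξ : P'} (hf : CylAnalyticAt f (G c))
    (hG : CylMapAt G c) (hG' : ContinuousAt G c) (h : HasCylDeriv G c v ξ) :
    lineDeriv ℂ (fun y => f (G y)) c v = lineDeriv ℂ f (G c) ξ := by
  obtain ⟨V, i, j, L, f₀, h₀, h₁⟩ := hf
  rw [(hasLineDerivAt_of_eventuallyEq h₀.differentiableAt h₁ ξ).lineDeriv,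
    lineDeriv_congr (f := fun y => f (G y)) (g := fun y => f₀ (L (G y)))
      (Tendsto.eventually hG' h₁)]
  have h2 := (hG V L).hasLineDerivAt v
  rw [h V L] at h2
  have h3 : HasFDerivAt f₀ (fderiv ℂ f₀ (L (G c))) (L (G (c + (0 : ℂ) • v))) := by
    simpa using h₀.differentiableAt.hasFDerivAt
  exact HasLineDerivAt.lineDeriv (h3.comp_hasDerivAt (0 : ℂ) h2)

variable [CompleteSpace E]

/-- The derivative is `fderiv f₀ (L y) (L (X y))`, so only the image of `X` under the one map `L`
enters. This is why fields with infinitely many components, such as D_t, cause no trouble. -/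
theorem CylAnalyticAt.lie {f : P → E} {X : P → P} {c : P} (hf : CylAnalyticAt f c)
    (hX : CylMapAt X c) : CylAnalyticAt (fun y => lineDeriv ℂ f y (X y)) c := by
  obtain ⟨V, i, j, L, f₀, h₀, h₁⟩ := hf
  have h2 : CylAnalyticAt (fun y => fderiv ℂ f₀ (L y)) c :=
    CylAnalyticAt.comp_analyticAt h₀.fderiv (cylAnalyticAt_clm L c)
  have h3 := (h2.prodMk (hX V L)).comp_analyticAt (g := fun e : (V →L[ℂ] E) × V => e.1 e.2)
    ((ContinuousLinearMap.analyticAt_bilinear (ContinuousLinearMap.id ℂ (V →L[ℂ] E)) _))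
  refine h3.congr ?_
  filter_upwards [h₁.eventually_nhds, L.continuous.continuousAt.eventually h₀.eventually_analyticAt]
    with y h4 h5 using (hasLineDerivAt_of_eventuallyEq h5.differentiableAt h4 _).lineDeriv

theorem CylAnalyticAt.lineDeriv_const {f : P → E} {c : P} (hf : CylAnalyticAt f c) (v : P) :
    CylAnalyticAt (fun y => lineDeriv ℂ f y v) c :=
  hf.lie (cylMapAt_const v c)

/-- The commutator of the derivatives along two vector fields is the derivative along their
commutator. -/
theorem CylAnalyticAt.lie_sub_lie {f : P → E} {X Y : P → P} {c ξ η : P} (hf : CylAnalyticAt f c)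
    (hX : CylMapAt X c) (hY : CylMapAt Y c) (hξ : HasCylDeriv Y c (X c) ξ)
    (hη : HasCylDeriv X c (Y c) η) :
    lineDeriv ℂ (fun y => lineDeriv ℂ f y (Y y)) c (X c)
      - lineDeriv ℂ (fun y => lineDeriv ℂ f y (X y)) c (Y c) = lineDeriv ℂ f c (ξ - η) := by
  obtain ⟨V, i, j, L, f₀, h₀, h₁⟩ := hf
  -- Product rule: a second derivative of `f₀` plus a term with the derivative of the field. The
  -- second derivatives cancel in the commutator by symmetry.
  have key : ∀ (Z : P → P) (v ζ : P), CylMapAt Z c → HasCylDeriv Z c v ζ →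
      lineDeriv ℂ (fun y => lineDeriv ℂ f y (Z y)) c v
        = fderiv ℂ (fderiv ℂ f₀) (L c) (L v) (L (Z c)) + fderiv ℂ f₀ (L c) (L ζ) := by
    intro Z v ζ hZ hζ
    have h2 : (fun y => lineDeriv ℂ f y (Z y)) =ᶠ[𝓝 c] fun y => fderiv ℂ f₀ (L y) (L (Z y)) := by
      filter_upwards [h₁.eventually_nhds,
        L.continuous.continuousAt.eventually h₀.eventually_analyticAt]
        with y h4 h5 using (hasLineDerivAt_of_eventuallyEq h5.differentiableAt h4 _).lineDeriv
    rw [lineDeriv_congr h2]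
    have h3 := hasLineDerivAt_of_eventuallyEq (f := fun y => fderiv ℂ f₀ (L y)) (c := c)
      h₀.fderiv.differentiableAt (Eventually.of_forall fun _ => rfl) v
    have h4 := (hZ V L).hasLineDerivAt v
    rw [hζ V L] at h4
    have := HasDerivAt.clm_apply h3 h4
    simp only [zero_smul, add_zero] at this
    exact HasLineDerivAt.lineDeriv this
  rw [key Y _ ξ hY hξ, key X _ η hX hη,
    (hasLineDerivAt_of_eventuallyEq h₀.differentiableAt h₁ _).lineDeriv]
  have hs : IsSymmSndFDerivAt ℂ f₀ (L c) :=
    ContDiffAt.isSymmSndFDerivAt_of_omega h₀.contDiffAt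
  rw [hs (L (X c)) (L (Y c)), map_sub, map_sub]
  abel

theorem CylAnalyticAt.lineDeriv_comm {f : P → E} {c : P} (hf : CylAnalyticAt f c) (v v' : P) :
    lineDeriv ℂ (fun y => lineDeriv ℂ f y v) c v' = lineDeriv ℂ (fun y => lineDeriv ℂ f y v') c v := by
  have := hf.lie_sub_lie (cylMapAt_const v' c) (cylMapAt_const v c) (hasCylDeriv_const v c _)
    (hasCylDeriv_const v' c _)
  rw [sub_zero, lineDeriv_zero] at this
  exact sub_eq_zero.mp this

/-- The derivative in a constant direction of the derivative along a vector field. -/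
theorem CylAnalyticAt.lineDeriv_lie {f : P → E} {X : P → P} {c v η : P} (hf : CylAnalyticAt f c)
    (hX : CylMapAt X c) (hη : HasCylDeriv X c v η) :
    lineDeriv ℂ (fun y => lineDeriv ℂ f y (X y)) c v
      = lineDeriv ℂ (fun y => lineDeriv ℂ f y v) c (X c) + lineDeriv ℂ f c η := by
  have := hf.lie_sub_lie hX (cylMapAt_const v c) (hasCylDeriv_const v c _) hη
  rw [zero_sub, ← neg_one_smul ℂ η, lineDeriv_smul, neg_one_smul] at this
  rw [← sub_eq_iff_eq_add', ← neg_sub, this, neg_neg]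

end Deriv

end Cylindrical

/-! ### Flows of analytic vector fields -/

section Flow

/-- The inverse function theorem for a family of maps over `E₁`, which is the identity over `x₀`. -/
theorem exists_analytic_fiber_inverse {E₁ E₂ : Type*} [NormedAddCommGroup E₁] [NormedSpace ℂ E₁]
    [CompleteSpace E₁] [NormedAddCommGroup E₂] [NormedSpace ℂ E₂] [CompleteSpace E₂]
    {f : E₁ × E₂ → E₂} {x₀ : E₁} {y₀ : E₂} (hf : AnalyticAt ℂ f (x₀, y₀))
    (h : ∀ᶠ y in 𝓝 y₀, f (x₀, y) = y) :
    ∃ g : E₁ × E₂ → E₂, AnalyticAt ℂ g (x₀, y₀) ∧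
      (∀ᶠ z in 𝓝 (x₀, y₀), g (z.1, f z) = z.2) ∧ ∀ᶠ z in 𝓝 (x₀, y₀), f (z.1, g z) = z.2 := by
  set D := fderiv ℂ f (x₀, y₀) with hD
  have hD2 : ∀ v, D (0, v) = v := by
    intro v
    have h1 : HasFDerivAt (fun y => f (x₀, y)) (D.comp (ContinuousLinearMap.inr ℂ E₁ E₂)) y₀ :=
      HasFDerivAt.comp y₀ (f := fun y => (x₀, y)) hf.differentiableAt.hasFDerivAt
        (hasFDerivAt_prodMk_right x₀ y₀)
    have h2 : HasFDerivAt (fun y => f (x₀, y)) (ContinuousLinearMap.id ℂ E₂) y₀ :=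
      (hasFDerivAt_id y₀).congr_of_eventuallyEq h
    simpa using DFunLike.congr_fun (h1.unique h2) v
  have hD1 : ∀ u v, D (u, v) = D (u, 0) + v := by
    intro u v
    have := map_add D (u, 0) (0, v)
    rw [hD2] at this
    simpa using this
  -- As f(x₀, ·) is the identity, the derivative of z ↦ (z.1, f z) is triangular with identities on
  -- the diagonal, and its inverse is (u, v) ↦ (u, v - D(u, 0)).
  let e : (E₁ × E₂) ≃L[ℂ] E₁ × E₂ := ContinuousLinearEquiv.equivOfInverse
    ((ContinuousLinearMap.fst ℂ E₁ E₂).prod D)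
    ((ContinuousLinearMap.fst ℂ E₁ E₂).prod (ContinuousLinearMap.snd ℂ E₁ E₂ -
      D.comp ((ContinuousLinearMap.inl ℂ E₁ E₂).comp (ContinuousLinearMap.fst ℂ E₁ E₂))))
    (by rintro ⟨u, v⟩; simp [hD1 u v]) (by rintro ⟨u, v⟩; simp [hD1 u (v - D (u, 0))])
  let Ψ : E₁ × E₂ → E₁ × E₂ := fun z => (z.1, f z)
  have hΨ : AnalyticAt ℂ Ψ (x₀, y₀) := analyticAt_fst.prod hf
  have hΨ' : HasStrictFDerivAt Ψ (e : (E₁ × E₂) →L[ℂ] E₁ × E₂) (x₀, y₀) :=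
    HasStrictFDerivAt.prodMk hasStrictFDerivAt_fst hf.hasStrictFDerivAt
  have hb : Ψ (x₀, y₀) = (x₀, y₀) := by simp [Ψ, h.self_of_nhds]
  have hinv : AnalyticAt ℂ (hΨ'.localInverse Ψ e (x₀, y₀)) (x₀, y₀) := by
    have := (hΨ'.toOpenPartialHomeomorph Ψ).analyticAt_symm' (a := (x₀, y₀)) (i := e)
      hΨ'.mem_toOpenPartialHomeomorph_source hΨ hΨ'.hasFDerivAt.fderiv
    rwa [HasStrictFDerivAt.toOpenPartialHomeomorph_coe, hb] at this
  have hr := hΨ'.eventually_right_inverse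
  rw [hb] at hr
  refine ⟨fun z => (hΨ'.localInverse Ψ e (x₀, y₀) z).2, analyticAt_snd.fun_comp hinv, ?_, ?_⟩
  · filter_upwards [hΨ'.eventually_left_inverse] with z hz
    change (hΨ'.localInverse Ψ e (x₀, y₀) (Ψ z)).2 = z.2
    rw [hz]
  · filter_upwards [hr] with z hz
    have h1 := congrArg Prod.fst hz
    have h2 := congrArg Prod.snd hz
    change (hΨ'.localInverse Ψ e (x₀, y₀) z).1 = z.1 at h1
    change f (hΨ'.localInverse Ψ e (x₀, y₀) z) = z.2 at h2
    rw [← h1]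
    exact h2

variable {E : Type*} [NormedAddCommGroup E] [NormedSpace ℂ E]

/-- Pointwise application of a continuous multilinear map to continuous functions. -/
def liftMultilinear {F : Type*} [NormedAddCommGroup F] [NormedSpace ℂ F] (K : Type*)
    [TopologicalSpace K] [CompactSpace K] {n : ℕ} (p : E [×n]→L[ℂ] F) :
    C(K, E) [×n]→L[ℂ] C(K, F) :=
  MultilinearMap.mkContinuous
    { toFun := fun h => ⟨fun τ => p fun i => h i τ, by fun_prop⟩
      map_update_add' := by
        intro _ m i x y
        ext τ
        have : ∀ z : C(K, E), (fun j => (Function.update m i z) j τ)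
            = Function.update (fun j => m j τ) i (z τ) := by
          intro z; ext j
          by_cases hj : j = i
          · subst hj; simp
          · simp [hj]
        simp only [ContinuousMap.coe_mk, ContinuousMap.add_apply, this, p.map_update_add]
      map_update_smul' := by
        intro _ m i c x
        ext τ
        have : ∀ z : C(K, E), (fun j => (Function.update m i z) j τ)
            = Function.update (fun j => m j τ) i (z τ) := by
          intro z; ext j
          by_cases hj : j = i
          · subst hj; simp
          · simp [hj]
        simp only [ContinuousMap.coe_mk, ContinuousMap.smul_apply, this, p.map_update_smul] }
    ‖p‖ (by
      intro h
      rw [ContinuousMap.norm_le _ (by positivity)]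
      intro τ
      refine (p.le_opNorm _).trans ?_
      gcongr with i
      exact (h i).norm_coe_le_norm τ)

/-- The superposition operator of an analytic map is analytic. -/
theorem exists_analytic_superposition {F : Type*} [NormedAddCommGroup F] [NormedSpace ℂ F]
    [CompleteSpace F] (K : Type*) [TopologicalSpace K] [CompactSpace K]
    {f : E → F} {y₀ : E} (hf : AnalyticAt ℂ f y₀) :
    ∃ N : C(K, E) → C(K, F), AnalyticAt ℂ N 0 ∧
      ∀ᶠ h in 𝓝 0, ∀ τ, N h τ = f (y₀ + h τ) := by
  obtain ⟨p, r, hp⟩ := hf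
  -- The pointwise lift does not increase the norms of the coefficients, so the lifted series
  -- converges at least on the same ball.
  let q : FormalMultilinearSeries ℂ C(K, E) C(K, F) := fun n => liftMultilinear K (p n)
  have hle : p.radius ≤ q.radius := by
    refine FormalMultilinearSeries.radius_le_of_le fun n => ?_
    exact MultilinearMap.mkContinuous_norm_le _ (norm_nonneg _) _
  have hr : 0 < q.radius := hp.r_pos.trans_le (hp.r_le.trans hle)
  refine ⟨q.sum, (q.hasFPowerSeriesOnBall hr).analyticAt, ?_⟩
  filter_upwards [Metric.eball_mem_nhds (0 : C(K, E)) hp.r_pos] with h hh τ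
  have h1 : HasSum (fun n => q n fun _ => h) (q.sum h) := by
    have := (q.hasFPowerSeriesOnBall hr).hasSum (y := h)
      (Metric.eball_subset_eball (hp.r_le.trans hle) hh)
    simpa using this
  have h2 : HasSum (fun n => p n fun _ => h τ) (q.sum h τ) :=
    (h1.map (ContinuousMap.evalCLM ℂ τ) (ContinuousMap.evalCLM ℂ τ).continuous)
  refine h2.unique (hp.hasSum ?_)
  rw [Metric.mem_eball, edist_zero_right] at hh ⊢
  refine lt_of_le_of_lt ?_ hh
  rw [← ofReal_norm, ← ofReal_norm]
  exact ENNReal.ofReal_le_ofReal (h.norm_coe_le_norm τ)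

/-- The primitive that vanishes at `0`. -/
def primitive : C(unitInterval, E) →L[ℂ] C(unitInterval, E) :=
  LinearMap.mkContinuous
    { toFun := fun y => ⟨fun τ => ∫ σ in (0 : ℝ)..τ, Set.IccExtend zero_le_one y σ, by
        have h : Continuous (Set.IccExtend (zero_le_one (α := ℝ)) y) := y.continuous.Icc_extend'
        exact (intervalIntegral.continuous_primitive (fun a b => h.intervalIntegrable a b) 0).comp
          continuous_subtype_val⟩
      map_add' := by
        intro y z
        ext τ
        have hy : Continuous (Set.IccExtend (zero_le_one (α := ℝ)) y) := y.continuous.Icc_extend'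
        have hz : Continuous (Set.IccExtend (zero_le_one (α := ℝ)) z) := z.continuous.Icc_extend'
        simp only [ContinuousMap.coe_mk, ContinuousMap.add_apply]
        rw [← intervalIntegral.integral_add (hy.intervalIntegrable _ _) (hz.intervalIntegrable _ _)]
        rfl
      map_smul' := by
        intro c y
        ext τ
        simp only [ContinuousMap.coe_mk, ContinuousMap.smul_apply, RingHom.id_apply]
        rw [← intervalIntegral.integral_smul]
        rfl }
    1 (by
      intro y
      rw [ContinuousMap.norm_le _ (by positivity)]
      intro τ
      refine (intervalIntegral.norm_integral_le_of_norm_le_const (C := ‖y‖)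
        fun σ _ => y.norm_coe_le_norm _).trans ?_
      rw [sub_zero, abs_of_nonneg τ.2.1, one_mul]
      exact mul_le_of_le_one_right (norm_nonneg _) τ.2.2)

theorem primitive_apply (y : C(unitInterval, E)) (τ : unitInterval) :
    primitive y τ = ∫ σ in (0 : ℝ)..τ, Set.IccExtend zero_le_one y σ := rfl

variable [CompleteSpace E]

/-- The local flow of an analytic vector field. -/
theorem exists_analytic_flow {Ξ : E → E} {y₀ : E} (hΞ : AnalyticAt ℂ Ξ y₀) :
    ∃ Fl : ℂ × E → E, AnalyticAt ℂ Fl (0, y₀) ∧ (∀ᶠ y in 𝓝 y₀, Fl (0, y) = y) ∧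
      ∀ᶠ p in 𝓝 ((0 : ℂ), y₀), HasDerivAt (fun s => Fl (s, p.2)) (Ξ (Fl p)) p.1 := by
  obtain ⟨N, hN, hN'⟩ := exists_analytic_superposition unitInterval hΞ
  let co : E →L[ℂ] C(unitInterval, E) := ContinuousLinearMap.const ℂ unitInterval
  have hco : ∀ e τ, co e τ = e := fun _ _ => rfl
  -- A zero ((s, e), h) of `f` is a path with h(τ) = e + s ∫₀^τ Ξ(y₀ + h): the displacement from y₀,
  -- at the time sτ, of the solution that starts at y₀ + e. At s = 0, e = 0 the map is the identity
  -- in h.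
  let f : (ℂ × E) × C(unitInterval, E) → C(unitInterval, E) :=
    fun z => z.2 - z.1.1 • primitive (N z.2) - co z.1.2
  have hf : AnalyticAt ℂ f ((0, 0), 0) := by
    have h1 : AnalyticAt ℂ (fun z : (ℂ × E) × C(unitInterval, E) => N z.2) ((0, 0), 0) :=
      AnalyticAt.fun_comp (g := N) (f := Prod.snd) hN analyticAt_snd
    have h2 : AnalyticAt ℂ (fun z : (ℂ × E) × C(unitInterval, E) => z.1.1) ((0, 0), 0) :=
      analyticAt_fst.fun_comp analyticAt_fst
    have h3 : AnalyticAt ℂ (fun z : (ℂ × E) × C(unitInterval, E) => z.1.2) ((0, 0), 0) :=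
      analyticAt_snd.fun_comp analyticAt_fst
    have h4 : AnalyticAt ℂ (fun z : (ℂ × E) × C(unitInterval, E) => primitive (N z.2)) ((0, 0), 0) :=
      AnalyticAt.fun_comp (g := (primitive : C(unitInterval, E) →L[ℂ] C(unitInterval, E))) (f := fun z : (ℂ × E) × C(unitInterval, E) => N z.2)
        (ContinuousLinearMap.analyticAt _ _) h1
    have h5 : AnalyticAt ℂ (fun z : (ℂ × E) × C(unitInterval, E) => co z.1.2) ((0, 0), 0) :=
      AnalyticAt.fun_comp (g := co) (f := fun z : (ℂ × E) × C(unitInterval, E) => z.1.2)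
        (co.analyticAt _) h3
    have h6 : AnalyticAt ℂ (fun z : (ℂ × E) × C(unitInterval, E) => z.1.1 • primitive (N z.2))
      ((0, 0), 0) := h2.fun_smul h4
    exact (analyticAt_snd.fun_sub h6).fun_sub h5
  obtain ⟨g, hg, hl, hr⟩ := exists_analytic_fiber_inverse hf
    (Eventually.of_forall fun y => by simp [f])
  let H : ℂ × E → C(unitInterval, E) := fun p => g (p, 0)
  have hH : AnalyticAt ℂ H (0, 0) :=
    AnalyticAt.fun_comp (g := g) (f := fun p : ℂ × E => (p, (0 : C(unitInterval, E))))
      hg (analyticAt_id.prod analyticAt_const)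
  have hH0 : H (0, 0) = 0 := by
    have := hl.self_of_nhds
    simpa [f] using this
  have hev : ∀ᶠ p in 𝓝 ((0 : ℂ), (0 : E)), f (p, H p) = 0 := by
    have : Tendsto (fun p : ℂ × E => (p, (0 : C(unitInterval, E)))) (𝓝 (0, 0)) (𝓝 ((0, 0), 0)) := by
      exact (Continuous.prodMk continuous_id continuous_const).tendsto _
    exact this.eventually hr
  obtain ⟨δ, hδ, hO⟩ := Metric.eventually_nhds_iff_ball.1
    (hl.and ((continuous_snd.tendsto ((((0 : ℂ), (0 : E))), (0 : C(unitInterval, E)))).eventually hN'))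
  have hN'' : ∀ h : C(unitInterval, E), ‖h‖ < δ → ∀ τ, N h τ = Ξ (y₀ + h τ) := by
    intro h hh
    exact (hO ((0, 0), h) (by simpa [Prod.dist_eq, hδ] using hh)).2
  -- The left inverse identity yields uniqueness among small paths.
  have huniq : ∀ (s : ℂ) (e : E) (h : C(unitInterval, E)), ‖s‖ < δ → ‖e‖ < δ → ‖h‖ < δ →
      f ((s, e), h) = 0 → h = H (s, e) := by
    intro s e h hs he hh h0
    have := (hO ((s, e), h) (by simpa [Prod.dist_eq] using ⟨⟨hs, he⟩, hh⟩)).1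
    rw [h0] at this
    exact this.symm
  have hHδ : ∀ᶠ p in 𝓝 ((0 : ℂ), (0 : E)), ‖H p‖ < δ := by
    exact Tendsto.eventually_lt_const (by simpa [hH0] using hδ) hH.continuousAt.norm
  -- the integral equation
  have hint : ∀ (s : ℂ) (e : E), ‖H (s, e)‖ < δ → f ((s, e), H (s, e)) = 0 → ∀ τ : unitInterval,
      H (s, e) τ = e + s • ∫ σ in (0 : ℝ)..τ,
        Set.IccExtend zero_le_one (fun ω => Ξ (y₀ + H (s, e) ω)) σ := by
    intro s e h1 h2 τ
    have h3 := DFunLike.congr_fun h2 τ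
    simp only [f, ContinuousMap.sub_apply, ContinuousMap.smul_apply, primitive_apply,
      ContinuousMap.zero_apply, hco] at h3
    rw [sub_sub, sub_eq_zero] at h3
    rw [h3, add_comm]
    have : ((N (H (s, e)) : C(unitInterval, E)) : unitInterval → E)
        = fun ω => Ξ (y₀ + H (s, e) ω) := funext (hN'' _ h1)
    rw [this]
  let Good : ℂ × E → Prop := fun p => ‖p.1‖ < δ ∧ ‖p.2‖ < δ ∧ ‖H p‖ < δ ∧ f (p, H p) = 0
  have hGood : ∀ᶠ p in 𝓝 ((0 : ℂ), (0 : E)), Good p := by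
    have h1 : ∀ᶠ p in 𝓝 ((0 : ℂ), (0 : E)), ‖p.1‖ < δ :=
      Tendsto.eventually_lt_const (by simpa using hδ) (continuous_fst.norm.tendsto _)
    have h2 : ∀ᶠ p in 𝓝 ((0 : ℂ), (0 : E)), ‖p.2‖ < δ :=
      Tendsto.eventually_lt_const (by simpa using hδ) (continuous_snd.norm.tendsto _)
    filter_upwards [h1, h2, hHδ, hev] with p a b c d using ⟨a, b, c, d⟩
  -- The path for the time rs is the initial piece of the path for the time s: by the substitution σ
  -- ↦ rσ both solve the same integral equation, and small solutions are unique.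
  have hscale : ∀ (s : ℂ) (e : E), Good (s, e) → ∀ r : unitInterval,
      H (((r : ℝ) : ℂ) * s, e) = (H (s, e)).comp ⟨fun τ => r * τ, by fun_prop⟩ := by
    rintro s e ⟨h1, h2, h3, h4⟩ r
    set k : C(unitInterval, E) := (H (s, e)).comp ⟨fun τ => r * τ, by fun_prop⟩ with hk
    have hr1 : ‖((r : ℝ) : ℂ)‖ ≤ 1 := by
      rw [Complex.norm_real, Real.norm_of_nonneg r.2.1]; exact r.2.2
    have hkδ : ‖k‖ < δ := by
      refine lt_of_le_of_lt ?_ h3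
      rw [ContinuousMap.norm_le _ (norm_nonneg _)]
      exact fun τ => (H (s, e)).norm_coe_le_norm _
    refine (huniq _ e k ?_ h2 hkδ ?_).symm
    · rw [norm_mul]
      exact (mul_le_of_le_one_left (norm_nonneg _) hr1).trans_lt h1
    · ext τ
      have h5 := hint s e h3 h4 (r * τ)
      have h6 : ((N k : C(unitInterval, E)) : unitInterval → E)
          = fun ω => Ξ (y₀ + H (s, e) (r * ω)) := funext (hN'' _ hkδ)
      have h7 : (r : ℝ) • ∫ σ in (0 : ℝ)..τ, Set.IccExtend zero_le_one
            (fun ω => Ξ (y₀ + H (s, e) (r * ω))) σ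
          = ∫ σ in (0 : ℝ)..(r * τ : unitInterval),
              Set.IccExtend zero_le_one (fun ω => Ξ (y₀ + H (s, e) ω)) σ := by
        have h8 := intervalIntegral.smul_integral_comp_mul_left (a := 0) (b := (τ : ℝ))
          (Set.IccExtend zero_le_one (fun ω => Ξ (y₀ + H (s, e) ω))) (r : ℝ)
        rw [mul_zero] at h8
        rw [Set.Icc.coe_mul, ← h8]
        congr 1
        refine intervalIntegral.integral_congr fun σ hσ => ?_
        rw [Set.uIcc_of_le τ.2.1] at hσ
        have h9 : σ ∈ Set.Icc (0 : ℝ) 1 := ⟨hσ.1, hσ.2.trans τ.2.2⟩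
        have h10 : (r : ℝ) * σ ∈ Set.Icc (0 : ℝ) 1 :=
          ⟨mul_nonneg r.2.1 h9.1, mul_le_one₀ r.2.2 h9.1 h9.2⟩
        simp only [Set.IccExtend_of_mem _ _ h9, Set.IccExtend_of_mem _ _ h10]
        rfl
      have h8 : k τ = H (s, e) (r * τ) := rfl
      simp only [f, ContinuousMap.sub_apply, ContinuousMap.smul_apply, primitive_apply,
        ContinuousMap.zero_apply, hco]
      rw [h6, h8, h5, ← h7, mul_smul, smul_comm, Complex.coe_smul]
      abel
  let Fl : ℂ × E → E := fun p => y₀ + H (p.1, p.2 - y₀) 1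
  have hsub : Tendsto (fun p : ℂ × E => (p.1, p.2 - y₀)) (𝓝 (0, y₀)) (𝓝 (0, 0)) := by
    have : Continuous (fun p : ℂ × E => (p.1, p.2 - y₀)) := by fun_prop
    simpa using this.tendsto (0, y₀)
  have hFl : AnalyticAt ℂ Fl (0, y₀) := by
    have h1 : AnalyticAt ℂ (fun p : ℂ × E => (p.1, p.2 - y₀)) (0, y₀) :=
      analyticAt_fst.prod (analyticAt_snd.fun_sub analyticAt_const)
    have h2 : AnalyticAt ℂ (fun p : ℂ × E => H (p.1, p.2 - y₀)) (0, y₀) :=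
      AnalyticAt.fun_comp (g := H) (by simpa using hH) h1
    exact analyticAt_const.fun_add (AnalyticAt.fun_comp
      (g := (ContinuousMap.evalCLM ℂ (1 : unitInterval) : C(unitInterval, E) →L[ℂ] E))
      (ContinuousLinearMap.analyticAt _ _) h2)
  -- Comparing the derivatives of r ↦ Fl(rs, y) at r = 1 from the chain rule and from the integral
  -- equation gives s ∂Fl/∂s = s Ξ(Fl), which can be divided by s only for s ≠ 0.
  have hne : ∀ᶠ p in 𝓝 ((0 : ℂ), y₀), p.1 ≠ 0 → fderiv ℂ Fl p (1, 0) = Ξ (Fl p) := by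
    filter_upwards [hsub.eventually hGood, hFl.eventually_analyticAt] with p hp hp' hp0
    obtain ⟨s, y⟩ := p
    simp only at hp hp' hp0
    obtain ⟨h1, h2, h3, h4⟩ := id hp
    have hc : Continuous (Set.IccExtend (zero_le_one (α := ℝ))
        (fun ω => Ξ (y₀ + H (s, y - y₀) ω))) := by
      refine Continuous.Icc_extend' ?_
      have : ((N (H (s, y - y₀)) : C(unitInterval, E)) : unitInterval → E)
        = fun ω => Ξ (y₀ + H (s, y - y₀) ω) := funext (hN'' _ h3)
      rw [← this]
      exact ContinuousMap.continuous _
    have hψ := ((hc.integral_hasStrictDerivAt 0 1).hasDerivAt.const_smul s).const_add y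
    have hφ : HasDerivAt (fun r : ℝ => Fl ((r : ℂ) * s, y)) (s • fderiv ℂ Fl (s, y) (1, 0)) 1 := by
      have h5 : HasDerivAt (fun r : ℝ => (r : ℂ) * s) (1 * s) 1 :=
        HasDerivAt.mul_const (HasDerivAt.ofReal_comp (hasDerivAt_id (1 : ℝ))) s
      have h6 : HasDerivAt (fun s' : ℂ => Fl (s', y)) (fderiv ℂ Fl (s, y) (1, 0)) s := by
        have := HasFDerivAt.comp_hasDerivAt s (f := fun s' : ℂ => (s', y))
          hp'.differentiableAt.hasFDerivAt ((hasDerivAt_id s).prodMk (hasDerivAt_const s y))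
        exact this
      have := HasDerivAt.scomp_of_eq (1 : ℝ) h6 h5 (by simp)
      rw [one_mul] at this
      exact this
    have heq : Set.EqOn (fun r : ℝ => Fl ((r : ℂ) * s, y)) (fun r => y + s • ∫ σ in (0 : ℝ)..r,
        Set.IccExtend zero_le_one (fun ω => Ξ (y₀ + H (s, y - y₀) ω)) σ) (Set.Icc 0 1) := by
      intro r hr
      have h5 := hscale s (y - y₀) hp ⟨r, hr⟩
      have h6 := hint s (y - y₀) h3 h4 ⟨r, hr⟩
      have h7 : Fl ((r : ℂ) * s, y) = y₀ + H (s, y - y₀) (⟨r, hr⟩ * 1) := by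
        change y₀ + H ((r : ℂ) * s, y - y₀) 1 = _
        rw [h5]
        rfl
      simp only
      rw [h7, mul_one, h6]
      abel
    have h1mem : (1 : ℝ) ∈ Set.Icc (0 : ℝ) 1 := ⟨zero_le_one, le_rfl⟩
    -- The two expressions agree on [0, 1] only, so the derivatives at the end point 1 are compared
    -- within this interval.
    have h5 := (uniqueDiffOn_Icc (zero_lt_one (α := ℝ)) 1 h1mem).eq_deriv _
      (hφ.hasDerivWithinAt.congr heq.symm (heq h1mem).symm) hψ.hasDerivWithinAt
    rw [Set.IccExtend_of_mem _ _ h1mem] at h5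
    exact smul_right_injective E hp0 h5
  refine ⟨Fl, hFl, ?_, ?_⟩
  · have h1 : Tendsto (fun y : E => (((0 : ℂ)), y - y₀)) (𝓝 y₀) (𝓝 (0, 0)) := by
      have : Continuous (fun y : E => (((0 : ℂ)), y - y₀)) := by fun_prop
      simpa using this.tendsto y₀
    filter_upwards [h1.eventually hGood] with y hy
    have := hint 0 (y - y₀) hy.2.2.1 hy.2.2.2 1
    simp only [zero_smul, add_zero] at this
    simp [Fl, this]
  · have hΞFl : ∀ᶠ p in 𝓝 ((0 : ℂ), y₀), AnalyticAt ℂ Ξ (Fl p) := by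
      have h0 : Fl (0, y₀) = y₀ := by simp [Fl, hH0]
      have := hΞ.eventually_analyticAt
      rw [← h0] at this
      exact hFl.continuousAt.eventually this
    filter_upwards [hne.eventually_nhds, hFl.eventually_analyticAt, hΞFl] with p h1 h2 h3
    obtain ⟨s, y⟩ := p
    have h4 : HasDerivAt (fun s' : ℂ => Fl (s', y)) (fderiv ℂ Fl (s, y) (1, 0)) s :=
      HasFDerivAt.comp_hasDerivAt s (f := fun s' : ℂ => (s', y))
        h2.differentiableAt.hasFDerivAt ((hasDerivAt_id s).prodMk (hasDerivAt_const s y))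
    have h5 : fderiv ℂ Fl (s, y) (1, 0) = Ξ (Fl (s, y)) := by
      have hι : ContinuousAt (fun s' : ℂ => (s', y)) s := by fun_prop
      have hu : ContinuousAt (fun s' : ℂ => fderiv ℂ Fl (s', y) (1, 0)) s :=
        ContinuousAt.clm_apply (ContinuousAt.comp (g := fderiv ℂ Fl)
          (f := fun s' : ℂ => (s', y)) h2.fderiv.continuousAt hι) continuousAt_const
      have hv : ContinuousAt (fun s' : ℂ => Ξ (Fl (s', y))) s :=
        ContinuousAt.comp (g := Ξ) (f := fun s' : ℂ => Fl (s', y)) h3.continuousAt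
          (ContinuousAt.comp (g := Fl) (f := fun s' : ℂ => (s', y)) h2.continuousAt hι)
      -- At s = 0 the equation follows by continuity from s ≠ 0.
      by_cases hs : s = 0
      · subst hs
        have := (ContinuousAt.eventuallyEq_nhds_iff_eventuallyEq_nhdsNE hu hv).1 (by
          filter_upwards [nhdsWithin_le_nhds (hι.eventually h1), self_mem_nhdsWithin] with s' h6 h7
            using h6 h7)
        exact this.self_of_nhds
      · exact h1.self_of_nhds hs
    rw [← h5]
    exact h4

/-- Analytic solutions of an ordinary differential equation for a function with values in `F`
along the lines `s ↦ θ + s e`, with arbitrary initial values at `s = 0`. -/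
theorem exists_analytic_solution {Θ F : Type*} [NormedAddCommGroup Θ] [NormedSpace ℂ Θ]
    [CompleteSpace Θ] [NormedAddCommGroup F] [NormedSpace ℂ F] [CompleteSpace F]
    {V : Θ × F → F} {θ₀ : Θ} {b : F} (hV : AnalyticAt ℂ V (θ₀, b)) (e : Θ) :
    ∃ y : ℂ × Θ × F → F, AnalyticAt ℂ y (0, θ₀, b) ∧ (∀ᶠ p in 𝓝 (θ₀, b), y (0, p) = p.2) ∧
      ∀ᶠ p in 𝓝 ((0 : ℂ), θ₀, b),
        HasDerivAt (fun s => y (s, p.2)) (V (p.2.1 + p.1 • e, y p)) p.1 := by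
  -- The equation becomes autonomous when the parameter θ is made an unknown that moves with
  -- constant velocity `e`.
  obtain ⟨Fl, h1, h2, h3⟩ := exists_analytic_flow (Ξ := fun q : Θ × F => (e, V q)) (y₀ := (θ₀, b))
    (analyticAt_const.prod hV)
  refine ⟨fun p => (Fl p).2, analyticAt_snd.fun_comp h1, h2.mono fun p hp => by simp [hp], ?_⟩
  have h2' := (continuous_snd.tendsto ((0 : ℂ), θ₀, b)).eventually h2
  obtain ⟨δ, hδ, hO⟩ := Metric.eventually_nhds_iff_ball.1 (h3.and h2')
  filter_upwards [Metric.ball_mem_nhds _ hδ] with p hp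
  have hsub : ∀ s ∈ Metric.ball (0 : ℂ) δ, (s, p.2) ∈ Metric.ball ((0 : ℂ), θ₀, b) δ := by
    intro s hs
    rw [Metric.mem_ball, Prod.dist_eq] at hp ⊢
    exact max_lt hs ((le_max_right _ _).trans_lt hp)
  have hp1 : p.1 ∈ Metric.ball (0 : ℂ) δ := by
    rw [Metric.mem_ball, Prod.dist_eq] at hp
    exact (le_max_left _ _).trans_lt hp
  -- The first component minus s e has derivative zero, so it keeps its initial value θ.
  have h4 : ∀ s ∈ Metric.ball (0 : ℂ) δ, HasDerivAt (fun s => (Fl (s, p.2)).1 - s • e) 0 s := by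
    intro s hs
    have := ((hasFDerivAt_fst (𝕜 := ℂ) (p := Fl (s, p.2))).comp_hasDerivAt s (hO _ (hsub s hs)).1).sub
      ((hasDerivAt_id s).smul_const e)
    rw [one_smul, ContinuousLinearMap.coe_fst', sub_self] at this
    exact this
  have h5 : (Fl p).1 = p.2.1 + p.1 • e := by
    have h6 := Metric.isOpen_ball.is_const_of_deriv_eq_zero (𝕜 := ℂ)
      (convex_ball (0 : ℂ) δ).isPreconnected
      (fun s hs => (h4 s hs).differentiableAt.differentiableWithinAt)
      (fun s hs => (h4 s hs).deriv) hp1 (Metric.mem_ball_self hδ)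
    have h7 := (hO _ (hsub 0 (Metric.mem_ball_self hδ))).2
    simp only at h7
    simp only [h7, zero_smul, sub_zero] at h6
    rw [← h6]
    simp
  have h6 := (hasFDerivAt_snd (𝕜 := ℂ) (p := Fl p)).comp_hasDerivAt p.1 (hO p hp).1
  rw [← h5]
  exact h6

end Flow

/-! ### Coordinates on jets -/

/-- The coordinates `x` (`none`), `t` (`some none`) and `u^i_k` on `Jet m K`. -/
abbrev Coord (m : ℕ) (K : Type) : Type := Option (Option (Fin m × K))

/-- The coordinate functions. -/
def co {m : ℕ} {K : Type} : Coord m K → Jet m K → ℂ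
  | none, z => z.1
  | some none, z => z.2.1
  | some (some ik), z => z.2.2 ik.1 ik.2

/-- The coordinate vectors. -/
def bv {m : ℕ} : Coord m ℕ → Jet m ℕ
  | none => ex m
  | some none => et m
  | some (some ik) => eu ik.1 ik.2

/-- The inclusion of the coordinates with `k < n` in all coordinates. -/
def up {m n : ℕ} (c : Coord m (Fin n)) : Coord m ℕ :=
  Option.map (Option.map (Prod.map id Fin.val)) c

section Coordinates

variable {m : ℕ}

theorem jet_ext {K : Type} {z z' : Jet m K} (h : ∀ c, co c z = co c z') : z = z' :=
  Prod.ext (h none) (Prod.ext (h (some none)) (funext fun i => funext fun k => h (some (some (i, k)))))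

theorem co_add {K : Type} (c : Coord m K) (z z' : Jet m K) : co c (z + z') = co c z + co c z' := by
  rcases c with _ | _ | c <;> rfl

theorem co_sub {K : Type} (c : Coord m K) (z z' : Jet m K) : co c (z - z') = co c z - co c z' := by
  rcases c with _ | _ | c <;> rfl

theorem co_smul {K : Type} (c : Coord m K) (s : ℂ) (z : Jet m K) : co c (s • z) = s * co c z := by
  rcases c with _ | _ | c <;> rfl

theorem co_zero {K : Type} (c : Coord m K) : co c (0 : Jet m K) = 0 := by
  rcases c with _ | _ | c <;> rfl

/-- The coordinate functions as continuous linear maps. -/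
def coL {K : Type} (c : Coord m K) : Jet m K →L[ℂ] ℂ where
  toFun := co c
  map_add' := co_add c
  map_smul' := co_smul c
  cont := by
    rcases c with _ | _ | c
    · exact continuous_fst
    · exact continuous_fst.comp continuous_snd
    · exact (continuous_apply c.2).comp ((continuous_apply c.1).comp
        (continuous_snd.comp continuous_snd))

theorem coL_apply {K : Type} (c : Coord m K) (z : Jet m K) : coL c z = co c z := rfl

theorem co_bv (c c' : Coord m ℕ) : co c (bv c') = if c = c' then 1 else 0 := by
  rcases c with _ | _ | ⟨i, k⟩ <;> rcases c' with _ | _ | ⟨i', k'⟩ <;>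
    simp [co, bv, ex, et, eu]
  by_cases h : i = i'
  · subst h
    by_cases h' : k = k'
    · subst h'; simp
    · simp [h']
  · simp [h]

theorem up_injective {n : ℕ} : Function.Injective (up : Coord m (Fin n) → Coord m ℕ) :=
  Option.map_injective (Option.map_injective
    (Function.injective_id.prodMap Fin.val_injective))

theorem co_trunc {n : ℕ} (c : Coord m (Fin n)) (z : Jet m ℕ) : co c (trunc n z) = co (up c) z := by
  rcases c with _ | _ | c <;> rfl

/-- `trunc` as a continuous linear map. -/
def truncL (n : ℕ) : Jet m ℕ →L[ℂ] Jet m (Fin n) where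
  toFun := trunc n
  map_add' _ _ := rfl
  map_smul' _ _ := rfl
  cont := by
    unfold trunc
    fun_prop

theorem truncL_apply (n : ℕ) (z : Jet m ℕ) : truncL n z = trunc n z := rfl

/-- Extension of a finite jet by zero. -/
def extendL (n : ℕ) : Jet m (Fin n) →L[ℂ] Jet m ℕ where
  toFun ζ := (ζ.1, ζ.2.1, fun i k => if h : k < n then ζ.2.2 i ⟨k, h⟩ else 0)
  map_add' ζ ζ' := by
    refine jet_ext fun c => ?_
    rcases c with _ | _ | ⟨i, k⟩
    · rfl
    · rfl
    · by_cases h : k < n <;> simp [co, h]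
  map_smul' s ζ := by
    refine jet_ext fun c => ?_
    rcases c with _ | _ | ⟨i, k⟩
    · rfl
    · rfl
    · by_cases h : k < n <;> simp [co, h]
  cont := by
    refine continuous_fst.prodMk ((continuous_fst.comp continuous_snd).prodMk ?_)
    refine continuous_pi fun i => continuous_pi fun k => ?_
    by_cases h : k < n
    · simp only [h, dite_true]
      fun_prop
    · simp only [h, dite_false]
      exact continuous_const

theorem trunc_extendL (n : ℕ) (ζ : Jet m (Fin n)) : trunc n (extendL n ζ) = ζ := by
  refine jet_ext fun c => ?_
  rcases c with _ | _ | ⟨i, k⟩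
  · rfl
  · rfl
  · simp [co, trunc, extendL]

theorem norm_le_iff_co {n : ℕ} {ζ : Jet m (Fin n)} {r : ℝ} (hr : 0 ≤ r) :
    ‖ζ‖ ≤ r ↔ ∀ c, ‖co c ζ‖ ≤ r := by
  constructor
  · intro h c
    have h1 := (norm_fst_le ζ).trans h
    have h2 := (norm_snd_le ζ).trans h
    rcases c with _ | _ | ⟨i, k⟩
    · exact h1
    · exact (norm_fst_le ζ.2).trans h2
    · exact (norm_le_pi_norm (ζ.2.2 i) k).trans
        ((norm_le_pi_norm ζ.2.2 i).trans ((norm_snd_le ζ.2).trans h2))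
  · intro h
    refine max_le (h none) (max_le (h (some none)) ?_)
    exact (pi_norm_le_iff_of_nonneg hr).2 fun i =>
      (pi_norm_le_iff_of_nonneg hr).2 fun k => h (some (some (i, k)))

theorem norm_co_le {n : ℕ} (ζ : Jet m (Fin n)) (c : Coord m (Fin n)) : ‖co c ζ‖ ≤ ‖ζ‖ :=
  (norm_le_iff_co (norm_nonneg ζ)).1 le_rfl c

/-- Every neighborhood of a jet contains a cylinder over a ball. -/
theorem exists_cylinder_subset {a : Jet m ℕ} {U : Set (Jet m ℕ)} (hU : U ∈ 𝓝 a) (n₀ : ℕ) :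
    ∃ n, n₀ ≤ n ∧ ∃ δ > 0, ∀ z, ‖trunc n (z - a)‖ < δ → z ∈ U := by
  let 𝓕 : ℕ → Filter (Jet m ℕ) := fun n => comap (trunc n) (𝓝 (trunc n a))
  have hmono : ∀ {n n'}, n ≤ n' → 𝓕 n' ≤ 𝓕 n := by
    intro n n' h
    let r : Jet m (Fin n') → Jet m (Fin n) :=
      fun ζ => (ζ.1, ζ.2.1, fun i k => ζ.2.2 i (Fin.castLE h k))
    have hr : Continuous r := by fun_prop
    have hc : (trunc n : Jet m ℕ → _) = r ∘ trunc n' := rfl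
    have : Tendsto (trunc n : Jet m ℕ → _) (𝓕 n') (𝓝 (trunc n a)) := by
      rw [hc]
      exact (hr.tendsto (trunc n' a)).comp tendsto_comap
    exact this.le_comap
  -- Each coordinate is seen by some truncation, and convergence in the product topology is
  -- convergence of the coordinates. As the filters `𝓕 n` are directed, a neighborhood of `a` then
  -- belongs to a single one of them.
  have hle : (⨅ n, 𝓕 n) ≤ 𝓝 a := by
    change Tendsto id (⨅ n, 𝓕 n) (𝓝 a)
    have h : ∀ n, Tendsto (trunc n : Jet m ℕ → _) (⨅ n, 𝓕 n) (𝓝 (trunc n a)) :=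
      fun n => tendsto_comap.mono_left (iInf_le _ n)
    have h1 : ∀ (n : ℕ) (c : Coord m (Fin n)),
        Tendsto (co (up c)) (⨅ n, 𝓕 n) (𝓝 (co (up c) a)) := by
      intro n c
      have := ((coL c).continuous.tendsto (trunc n a)).comp (h n)
      simpa [Function.comp_def, coL_apply, co_trunc] using this
    have h2 : Tendsto (fun z : Jet m ℕ => z.2.2) (⨅ n, 𝓕 n) (𝓝 a.2.2) := by
      refine tendsto_pi_nhds.2 fun i => tendsto_pi_nhds.2 fun k => ?_
      exact h1 (k + 1) (some (some (i, Fin.last k)))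
    exact (h1 0 none).prodMk_nhds ((h1 0 (some none)).prodMk_nhds h2)
  have hU' := hle hU
  rw [mem_iInf_of_directed] at hU'
  · obtain ⟨n, hn⟩ := hU'
    have hn' := hmono (le_max_left n n₀) hn
    obtain ⟨V, hV, hVU⟩ := mem_comap.1 hn'
    obtain ⟨δ, hδ, hb⟩ := Metric.mem_nhds_iff.1 hV
    refine ⟨max n n₀, le_max_right _ _, δ, hδ, fun z hz => hVU (hb ?_)⟩
    rw [Metric.mem_ball, dist_eq_norm]
    exact hz
  · intro n n'
    exact ⟨max n n', hmono (le_max_left _ _), hmono (le_max_right _ _)⟩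

theorem cylinder_mem_nhds (a : Jet m ℕ) (n : ℕ) {δ : ℝ} (hδ : 0 < δ) :
    {z | ‖trunc n (z - a)‖ < δ} ∈ 𝓝 a := by
  have : Continuous fun z : Jet m ℕ => ‖trunc n (z - a)‖ :=
    continuous_norm.comp ((truncL n).continuous.comp (continuous_id.sub continuous_const))
  refine this.continuousAt.eventually_lt continuousAt_const ?_
  rw [sub_self]
  simpa [← truncL_apply] using hδ

theorem exists_cylinder_prod_subset {F : Type*} [SeminormedAddCommGroup F] {a : Jet m ℕ} {b : F}
    {U : Set (Jet m ℕ × F)} (hU : U ∈ 𝓝 (a, b)) (n₀ : ℕ) :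
    ∃ n, n₀ ≤ n ∧ ∃ δ > 0, ∀ z w, ‖trunc n (z - a)‖ < δ → ‖w - b‖ < δ → (z, w) ∈ U := by
  obtain ⟨U₁, h₁, U₂, h₂, h⟩ := mem_nhds_prod_iff.1 hU
  obtain ⟨n, hn, δ, hδ, h₃⟩ := exists_cylinder_subset h₁ n₀
  obtain ⟨ε, hε, h₄⟩ := Metric.mem_nhds_iff.1 h₂
  refine ⟨n, hn, min δ ε, lt_min hδ hε, fun z w hz hw => h ⟨h₃ z (hz.trans_le (min_le_left _ _)),
    h₄ ?_⟩⟩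
  rw [Metric.mem_ball, dist_eq_norm]
  exact hw.trans_le (min_le_right _ _)

/-- A continuous linear map to a normed space depends on finitely many coordinates only. -/
theorem exists_clm_eq_extendL {V : Type*} [NormedAddCommGroup V] [NormedSpace ℂ V]
    (L : Jet m ℕ →L[ℂ] V) (n₀ : ℕ) : ∃ n, n₀ ≤ n ∧ ∀ z, L z = L (extendL n (trunc n z)) := by
  have h : L ⁻¹' Metric.ball 0 1 ∈ 𝓝 (0 : Jet m ℕ) :=
    L.continuous.continuousAt.preimage_mem_nhds (by simpa using Metric.ball_mem_nhds _ one_pos)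
  obtain ⟨n, hn, δ, hδ, hz⟩ := exists_cylinder_subset h n₀
  -- All multiples of such a `v` stay in the cylinder, on which `‖L‖ < 1`; the multiple normalized
  -- to `‖L‖ = 1` gives a contradiction.
  have key : ∀ v, trunc n v = 0 → L v = 0 := by
    intro v hv
    by_contra hne
    have h1 : ‖L v‖ ≠ 0 := norm_ne_zero_iff.2 hne
    have h2 := hz (((‖L v‖ : ℂ)⁻¹) • v) (by
      rw [sub_zero, ← truncL_apply, map_smul, truncL_apply, hv, smul_zero, norm_zero]
      exact hδ)
    rw [Set.mem_preimage, map_smul, mem_ball_zero_iff, norm_smul, norm_inv, Complex.norm_real,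
      norm_norm, inv_mul_cancel₀ h1] at h2
    exact lt_irrefl _ h2
  refine ⟨n, hn, fun z => ?_⟩
  rw [← sub_eq_zero, ← map_sub]
  apply key
  rw [← truncL_apply, map_sub, truncL_apply, truncL_apply, trunc_extendL, sub_self]

theorem extendL_trunc_eq_sum (n : ℕ) (z : Jet m ℕ) :
    extendL n (trunc n z) = ∑ c : Coord m (Fin n), co (up c) z • bv (up c) := by
  refine jet_ext fun c' => ?_
  have h : co c' (∑ c : Coord m (Fin n), co (up c) z • bv (up c))
      = ∑ c : Coord m (Fin n), co (up c) z * if c' = up c then 1 else 0 := by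
    rw [← coL_apply, map_sum]
    refine Finset.sum_congr rfl fun c _ => ?_
    rw [coL_apply, co_smul, co_bv]
  rw [h]
  by_cases hc : ∃ c : Coord m (Fin n), up c = c'
  · obtain ⟨c, rfl⟩ := hc
    rw [Finset.sum_eq_single c]
    · rw [if_pos rfl, mul_one, ← co_trunc, trunc_extendL, co_trunc]
    · intro c'' _ hne
      rw [if_neg fun h => hne (up_injective h).symm, mul_zero]
    · simp
  · rw [Finset.sum_eq_zero fun c _ => by rw [if_neg fun h => hc ⟨c, h.symm⟩, mul_zero]]
    rcases c' with _ | _ | ⟨i, k⟩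
    · exact absurd ⟨none, rfl⟩ hc
    · exact absurd ⟨some none, rfl⟩ hc
    · have : ¬ k < n := fun hk => hc ⟨some (some (i, ⟨k, hk⟩)), rfl⟩
      simp [co, extendL, this]

theorem exists_clm_eq_sum {V : Type*} [NormedAddCommGroup V] [NormedSpace ℂ V]
    (L : Jet m ℕ →L[ℂ] V) :
    ∃ n, ∀ z, L z = ∑ c : Coord m (Fin n), co (up c) z • L (bv (up c)) := by
  obtain ⟨n, -, h⟩ := exists_clm_eq_extendL L 0
  refine ⟨n, fun z => ?_⟩
  rw [h, extendL_trunc_eq_sum, map_sum]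
  simp

theorem clm_eq_zero_of_co {V : Type*} [NormedAddCommGroup V] [NormedSpace ℂ V]
    (L : Jet m ℕ →L[ℂ] V) {z : Jet m ℕ} (h : ∀ c, co c z = 0 ∨ L (bv c) = 0) : L z = 0 := by
  obtain ⟨n, hn⟩ := exists_clm_eq_sum L
  rw [hn]
  refine Finset.sum_eq_zero fun c _ => ?_
  rcases h (up c) with h | h <;> simp [h]

end Coordinates

/-! ### Cylindrical analyticity on jet spaces, tested on coordinates -/

section CylJet

variable {m q : ℕ} {P : Type} [AddCommGroup P] [Module ℂ P] [TopologicalSpace P]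
  {E : Type} [NormedAddCommGroup E] [NormedSpace ℂ E]

/-- A continuous linear map to a normed space sees only finitely many coordinates, so no uniformity
over the coordinates of `X` is needed. -/
theorem cylMapAt_of_co {X : P → Jet m ℕ} {c : P}
    (h : ∀ i, CylAnalyticAt (fun y => co i (X y)) c) : CylMapAt X c := by
  intro V _ _ L
  obtain ⟨n, hn⟩ := exists_clm_eq_sum L
  rw [show (fun y => L (X y)) = _ from funext fun y => hn (X y)]
  exact CylAnalyticAt.sum _ fun i _ => (h (up i)).smul (cylAnalyticAt_const _ c)

theorem CylMapAt.co {X : P → Jet m ℕ} {c : P} (h : CylMapAt X c) (i : Coord m ℕ) :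
    CylAnalyticAt (fun y => co i (X y)) c :=
  h ℂ (coL i)

theorem hasCylDeriv_of_co [IsTopologicalAddGroup P] [ContinuousSMul ℂ P] {X : P → Jet m ℕ}
    {c v : P} {ξ : Jet m ℕ} (hX : CylMapAt X c)
    (h : ∀ i, lineDeriv ℂ (fun y => co i (X y)) c v = co i ξ) : HasCylDeriv X c v ξ := by
  intro V _ _ L
  obtain ⟨n, hn⟩ := exists_clm_eq_sum L
  rw [hn ξ, show (fun y => L (X y)) = _ from funext fun y => hn (X y)]
  refine HasLineDerivAt.lineDeriv ?_
  unfold HasLineDerivAt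
  refine HasDerivAt.fun_sum fun i _ => ?_
  have h1 := ((hX.co (up i)).hasLineDerivAt v)
  rw [h (up i)] at h1
  exact HasDerivAt.smul_const h1 _

theorem CylMapAt.prodMk {P' : Type} [AddCommGroup P'] [Module ℂ P'] [TopologicalSpace P']
    {X : P → P'} {A : P → E} {c : P} (hX : CylMapAt X c) (hA : CylAnalyticAt A c) :
    CylMapAt (fun y => (X y, A y)) c := by
  intro V _ _ L
  have h : ∀ y, L (X y, A y) = (L.comp (ContinuousLinearMap.inl ℂ P' E)) (X y)
      + (L.comp (ContinuousLinearMap.inr ℂ P' E)) (A y) := by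
    intro y
    simp [← map_add]
  simp only [h]
  exact (hX V _).add (hA.clm_comp _)

theorem HasCylDeriv.prodMk [IsTopologicalAddGroup P] [ContinuousSMul ℂ P]
    {P' : Type} [AddCommGroup P'] [Module ℂ P'] [TopologicalSpace P']
    {X : P → P'} {A : P → E} {c v : P} {ξ : P'} (hX : CylMapAt X c)
    (hA : CylAnalyticAt A c) (h : HasCylDeriv X c v ξ) :
    HasCylDeriv (fun y => (X y, A y)) c v (ξ, lineDeriv ℂ A c v) := by
  intro V _ _ L
  have h' : ∀ (p : P') (e : E), L (p, e) = (L.comp (ContinuousLinearMap.inl ℂ P' E)) p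
      + (L.comp (ContinuousLinearMap.inr ℂ P' E)) e := by
    intro p e
    simp [← map_add]
  simp only [h']
  rw [lineDeriv_fun_add (hX V _) (hA.clm_comp _), h V _, hA.lineDeriv_clm_comp]

/-- This is the bridge to the definition in the statement. A continuous linear map from ℰ × W to a
normed space factors through a truncation of the jet. -/
theorem jetAnalyticAt_iff {f : Jet m ℕ × Fib q → Fib q} {c : Jet m ℕ × Fib q} :
    JetAnalyticAt f c ↔ CylAnalyticAt f c := by
  constructor
  · rintro ⟨n, f₀, h₀, h⟩
    exact ⟨Jet m (Fin n) × Fib q, inferInstance, inferInstance,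
      ((truncL n).comp (ContinuousLinearMap.fst ℂ _ _)).prod (ContinuousLinearMap.snd ℂ _ _),
      f₀, h₀, h⟩
  · rintro ⟨V, _, _, L, f₀, h₀, h⟩
    obtain ⟨n, -, hn⟩ := exists_clm_eq_extendL (L.comp (ContinuousLinearMap.inl ℂ _ _)) 0
    have hL : ∀ y : Jet m ℕ × Fib q, L y = L (extendL n (trunc n y.1), y.2) := by
      intro y
      have h1 := hn y.1
      simp only [ContinuousLinearMap.comp_apply, ContinuousLinearMap.inl_apply] at h1
      have h2 : ∀ (z : Jet m ℕ) (w : Fib q), L (z, w) = L (z, 0) + L (0, w) := by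
        intro z w; simp [← map_add]
      rw [← Prod.mk.eta (p := y), h2, h1, ← h2]
    refine ⟨n, fun y => f₀ (L (extendL n y.1, y.2)), ?_, ?_⟩
    · let M : Jet m (Fin n) × Fib q →L[ℂ] V := L.comp (((extendL n).comp
        (ContinuousLinearMap.fst ℂ _ _)).prod (ContinuousLinearMap.snd ℂ _ _))
      have : AnalyticAt ℂ f₀ (M (trunc n c.1, c.2)) := by
        rw [hL] at h₀
        exact h₀
      exact AnalyticAt.fun_comp (f := M) this (M.analyticAt _)
    · filter_upwards [h] with y hy
      rw [hy, hL]

end CylJet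

/-! ### Resetting coordinates -/

section Reset

variable {m : ℕ}

/-- The jet with prescribed coordinates. -/
def mkJet {K : Type} (f : Coord m K → ℂ) : Jet m K :=
  (f none, f (some none), fun i k => f (some (some (i, k))))

theorem co_mkJet {K : Type} (f : Coord m K → ℂ) (c : Coord m K) : co c (mkJet f) = f c := by
  rcases c with _ | _ | c <;> rfl

open Classical in
/-- The linear map that keeps the coordinates in `S` and annihilates the other ones. -/
def keepL (S : Set (Coord m ℕ)) : Jet m ℕ →L[ℂ] Jet m ℕ where
  toFun z := mkJet fun c => if c ∈ S then co c z else 0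
  map_add' z z' := jet_ext fun c => by
    simp only [co_mkJet, co_add]
    split_ifs <;> simp
  map_smul' s z := jet_ext fun c => by
    simp only [co_mkJet, co_smul, RingHom.id_apply]
    split_ifs <;> simp
  cont := by
    have h : ∀ c, Continuous fun z : Jet m ℕ => if c ∈ S then co c z else 0 := by
      intro c
      split_ifs
      · exact (coL c).continuous
      · exact continuous_const
    exact (h none).prodMk ((h (some none)).prodMk
      (continuous_pi fun i => continuous_pi fun k => h (some (some (i, k)))))

open Classical in
theorem co_keepL (S : Set (Coord m ℕ)) (c : Coord m ℕ) (z : Jet m ℕ) :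
    co c (keepL S z) = if c ∈ S then co c z else 0 := by
  change co c (mkJet fun c => if c ∈ S then co c z else 0) = _
  rw [co_mkJet]

/-- The point whose coordinates in `S` are those of `z`, and whose other coordinates are those
of `a`. -/
def reset (S : Set (Coord m ℕ)) (a z : Jet m ℕ) : Jet m ℕ := a + keepL S (z - a)

open Classical in
theorem co_reset (S : Set (Coord m ℕ)) (a z : Jet m ℕ) (c : Coord m ℕ) :
    co c (reset S a z) = if c ∈ S then co c z else co c a := by
  rw [reset, co_add, co_keepL]
  split_ifs
  · rw [co_sub]; ring
  · rw [add_zero]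

theorem reset_self (S : Set (Coord m ℕ)) (a : Jet m ℕ) : reset S a a = a := by
  simp [reset]

theorem continuous_reset (S : Set (Coord m ℕ)) (a : Jet m ℕ) : Continuous (reset S a) :=
  continuous_const.add ((keepL S).continuous.comp (continuous_id.sub continuous_const))

theorem cylMapAt_reset (S : Set (Coord m ℕ)) (a c : Jet m ℕ) : CylMapAt (reset S a) c := by
  refine cylMapAt_of_co fun i => ?_
  classical
  simp only [co_reset]
  split_ifs
  · exact cylAnalyticAt_clm (coL i) c
  · exact cylAnalyticAt_const _ c

/-- The coordinates with `k < n`. -/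
def cols (m n : ℕ) : Set (Coord m ℕ) := Set.range (up : Coord m (Fin n) → Coord m ℕ)

theorem reset_cols (n : ℕ) (a z : Jet m ℕ) :
    reset (cols m n) a z = a + extendL n (trunc n (z - a)) := by
  rw [reset]
  congr 1
  refine jet_ext fun c => ?_
  rw [co_keepL]
  split_ifs with h
  · obtain ⟨c, rfl⟩ := h
    rw [← co_trunc, ← co_trunc, trunc_extendL]
  · rcases c with _ | _ | ⟨i, k⟩
    · exact absurd ⟨none, rfl⟩ h
    · exact absurd ⟨some none, rfl⟩ h
    · have : ¬ k < n := fun hk => h ⟨some (some (i, ⟨k, hk⟩)), rfl⟩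
      simp [co, extendL, this]

theorem mem_cols_u {n : ℕ} {i : Fin m} {k : ℕ} : (some (some (i, k)) : Coord m ℕ) ∈ cols m n ↔ k < n := by
  constructor
  · rintro ⟨_ | _ | ⟨j, l⟩, h⟩
    · cases h
    · cases h
    · have : some (some (j, (l : ℕ))) = (some (some (i, k)) : Coord m ℕ) := h
      simp only [Option.some.injEq, Prod.mk.injEq] at this
      rw [← this.2]
      exact l.2
  · intro h
    exact ⟨some (some (i, ⟨k, h⟩)), rfl⟩

variable {q : ℕ} {E : Type} [NormedAddCommGroup E] [NormedSpace ℂ E]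

theorem CylAnalyticAt.lineDeriv_eq_zero_of_co {f : Jet m ℕ × Fib q → E} {y : Jet m ℕ × Fib q}
    (hf : CylAnalyticAt f y) {v : Jet m ℕ}
    (h : ∀ c, co c v = 0 ∨ lineDeriv ℂ f y (bv c, 0) = 0) : lineDeriv ℂ f y (v, 0) = 0 := by
  obtain ⟨f', hf'⟩ := hf.exists_clm
  have := clm_eq_zero_of_co (f'.comp (ContinuousLinearMap.inl ℂ _ _)) (z := v) fun c => by
    rcases h c with h | h
    · exact Or.inl h
    · right
      rw [← h, (hf' _).lineDeriv]
      rfl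
  rw [(hf' _).lineDeriv]
  exact this

theorem tendsto_reset_prod (S : Set (Coord m ℕ)) (a : Jet m ℕ) (b : Fib q) :
    Tendsto (fun y : Jet m ℕ × Fib q => (reset S a y.1, y.2)) (𝓝 (a, b)) (𝓝 (a, b)) := by
  have : Continuous fun y : Jet m ℕ × Fib q => (reset S a y.1, y.2) :=
    ((continuous_reset S a).comp continuous_fst).prodMk continuous_snd
  simpa [reset_self] using this.tendsto (a, b)

/-- A function whose derivatives in the coordinates outside `S` vanish does not depend on these
coordinates. -/
theorem CylAnalyticAt.eventually_eq_reset [CompleteSpace E] {f : Jet m ℕ × Fib q → E}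
    {a : Jet m ℕ} {b : Fib q} (hf : CylAnalyticAt f (a, b)) {S : Set (Coord m ℕ)}
    (h : ∀ᶠ y in 𝓝 (a, b), ∀ c ∉ S, lineDeriv ℂ f y (bv c, 0) = 0) :
    ∀ᶠ y in 𝓝 (a, b), f y = f (reset S a y.1, y.2) := by
  obtain ⟨n, -, δ, hδ, hU⟩ := exists_cylinder_prod_subset (h.and hf.eventually) 0
  have h1 : {y : Jet m ℕ × Fib q | ‖trunc n (y.1 - a)‖ < δ} ∈ 𝓝 (a, b) :=
    (continuous_fst.tendsto (a, b)).eventually (cylinder_mem_nhds a n hδ)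
  have h2 : {y : Jet m ℕ × Fib q | ‖y.2 - b‖ < δ} ∈ 𝓝 (a, b) := by
    refine (continuous_snd.sub continuous_const).norm.continuousAt.eventually_lt
      continuousAt_const ?_
    simpa using hδ
  filter_upwards [h1, h2] with y hy1 hy2
  set v := y.1 - reset S a y.1 with hv
  have hcov : ∀ c ∈ S, co c v = 0 := by
    intro c hc
    rw [hv, co_sub, co_reset, if_pos hc, sub_self]
  -- The segment from the reset point to `y` stays in the cylinder, since each coordinate of its
  -- difference from `a` either is that of `y.1 - a` or is scaled by s ≤ 1. Along the segment the
  -- derivative of `f` vanishes.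
  have hmem : ∀ s : ℝ, s ∈ Set.Icc (0 : ℝ) 1 →
      ‖trunc n (reset S a y.1 + (s : ℂ) • v - a)‖ < δ := by
    intro s hs
    refine lt_of_le_of_lt ?_ hy1
    refine (norm_le_iff_co (norm_nonneg _)).2 fun c => ?_
    refine le_trans ?_ (norm_co_le (trunc n (y.1 - a)) c)
    rw [co_trunc, co_trunc, co_sub, co_add, co_smul, co_sub, co_sub, co_reset]
    split_ifs with hc
    · simp
    · rw [add_sub_cancel_left, norm_mul, Complex.norm_real, Real.norm_of_nonneg hs.1]
      exact mul_le_of_le_one_left (norm_nonneg _) hs.2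
  have hder : ∀ s : ℝ, s ∈ Set.Icc (0 : ℝ) 1 →
      HasDerivAt (fun s : ℝ => f (reset S a y.1 + (s : ℂ) • v, y.2)) 0 s := by
    intro s hs
    obtain ⟨h3, h4⟩ := hU _ _ (hmem s hs) hy2
    have h5 := h4.hasLineDerivAt (v, 0)
    rw [h4.lineDeriv_eq_zero_of_co fun c => (em (c ∈ S)).imp (hcov c) (h3 c)] at h5
    have h6 : HasDerivAt (fun σ : ℂ => f (reset S a y.1 + σ • v, y.2)) 0 (s : ℂ) := by
      have h7 := HasDerivAt.comp_sub_const (s : ℂ) (s : ℂ)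
        (f := fun t : ℂ => f ((reset S a y.1 + (s : ℂ) • v, y.2) + t • (v, (0 : Fib q))))
        (f' := (0 : E)) (by rw [sub_self]; exact h5)
      refine h7.congr_of_eventuallyEq (Eventually.of_forall fun σ => ?_)
      simp only [Prod.smul_mk, Prod.mk_add_mk, smul_zero, add_zero]
      rw [add_assoc, ← add_smul, add_sub_cancel]
    have h8 := HasDerivAt.scomp (h := fun r : ℝ => (r : ℂ)) s h6
      (HasDerivAt.ofReal_comp (hasDerivAt_id s))
    rw [smul_zero] at h8
    exact h8
  have h9 := constant_of_has_deriv_right_zero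
    (fun s hs => (hder s hs).continuousAt.continuousWithinAt)
    (fun s hs => (hder s ⟨hs.1, hs.2.le⟩).hasDerivWithinAt) 1 ⟨zero_le_one, le_rfl⟩
  simp only [Complex.ofReal_one, one_smul, Complex.ofReal_zero, zero_smul, add_zero] at h9
  rw [← h9, hv, add_sub_cancel]

/-- A function that does not depend on the coordinates with `k ≥ n` is an analytic function of the
coordinates with `k < n`. -/
theorem CylAnalyticAt.exists_eq_trunc {f : Jet m ℕ × Fib q → E} {a : Jet m ℕ} {b : Fib q}
    (hf : CylAnalyticAt f (a, b)) {n : ℕ}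
    (h : ∀ᶠ y in 𝓝 (a, b), f y = f (reset (cols m n) a y.1, y.2)) :
    ∃ f₀ : Jet m (Fin n) × Fib q → E, AnalyticAt ℂ f₀ (trunc n a, b) ∧
      ∀ᶠ y in 𝓝 (a, b), f y = f₀ (trunc n y.1, y.2) := by
  let M : Jet m (Fin n) × Fib q →L[ℂ] Jet m ℕ × Fib q :=
    ((extendL n).comp (ContinuousLinearMap.fst ℂ _ _)).prod (ContinuousLinearMap.snd ℂ _ _)
  let G : Jet m (Fin n) × Fib q → Jet m ℕ × Fib q :=
    fun y => (a + extendL n (y.1 - trunc n a), y.2)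
  have hG : ∀ y, G y = M y + (a - extendL n (trunc n a), 0) := by
    intro y
    simp only [G, M, map_sub, ContinuousLinearMap.prod_apply, ContinuousLinearMap.comp_apply,
      ContinuousLinearMap.coe_fst', ContinuousLinearMap.coe_snd', Prod.mk_add_mk, add_zero]
    congr 1
    abel
  have hG0 : G (trunc n a, b) = (a, b) := by simp [G]
  have hGc : Continuous G := by
    rw [show G = _ from funext hG]
    exact M.continuous.add continuous_const
  have hGm : CylMapAt G (trunc n a, b) := by
    intro V _ _ L
    simp only [hG, map_add]
    exact (cylAnalyticAt_clm (L.comp M) _).add (cylAnalyticAt_const _ _)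
  refine ⟨fun y => f (G y), CylAnalyticAt.analyticAt (CylAnalyticAt.comp (by rwa [hG0]) hGm
    hGc.continuousAt), ?_⟩
  filter_upwards [h] with y hy
  rw [hy, reset_cols]
  simp only [G, ← truncL_apply, map_sub]

theorem CylAnalyticAt.exists_level {f : Jet m ℕ × Fib q → E} {c : Jet m ℕ × Fib q}
    (hf : CylAnalyticAt f c) (n₀ : ℕ) :
    ∃ n, n₀ ≤ n ∧ ∀ᶠ y in 𝓝 c, ∀ i ∉ cols m n, lineDeriv ℂ f y (bv i, 0) = 0 := by
  obtain ⟨V, _, _, L, f₀, h₀, h⟩ := hf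
  obtain ⟨n, hn, hL⟩ := exists_clm_eq_extendL (L.comp (ContinuousLinearMap.inl ℂ _ _)) n₀
  refine ⟨n, hn, ?_⟩
  filter_upwards [h.eventually_nhds] with y hy i hi
  have h1 : trunc n (bv i) = 0 := by
    refine jet_ext fun c' => ?_
    rw [co_trunc, co_bv, if_neg fun h' => hi ⟨c', h'⟩, co_zero]
  have h2 : L (bv i, 0) = 0 := by
    have := hL (bv i)
    rw [h1, map_zero, map_zero] at this
    exact this
  rw [lineDeriv_congr hy]
  simp only [lineDeriv, map_add, map_smul, h2, smul_zero, add_zero]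
  exact deriv_const _ _

end Reset

/-! ### Total derivatives as vector fields -/

section Fields

variable {m d q : ℕ} {E : Type} [NormedAddCommGroup E] [NormedSpace ℂ E]

/-- The vector field of `D_x`. -/
def xField (z : Jet m ℕ) : Jet m ℕ := (1, 0, fun i k => z.2.2 i (k + 1))

/-- The derivative of `xField`. -/
def xShift (v : Jet m ℕ) : Jet m ℕ := (0, 0, fun i k => v.2.2 i (k + 1))

/-- The vector field of `D_t`. -/
def tField (F : Jet m (Fin (d + 1)) → Fin m → ℂ) (z : Jet m ℕ) : Jet m ℕ :=
  (0, 1, fun i k => (Dx^[k] fun y => F (trunc (d + 1) y) i) z)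

/-- The vector field `D_x + A` on `ℰ × W`. -/
def xLift (A : Jet m ℕ × Fib q → Fib q) (y : Jet m ℕ × Fib q) : Jet m ℕ × Fib q :=
  (xField y.1, A y)

/-- The vector field `D_t + B` on `ℰ × W`. -/
def tLift (F : Jet m (Fin (d + 1)) → Fin m → ℂ) (B : Jet m ℕ × Fib q → Fib q)
    (y : Jet m ℕ × Fib q) : Jet m ℕ × Fib q :=
  (tField F y.1, B y)

theorem CylMapAt.comp_clm {P P' P'' : Type} [AddCommGroup P] [Module ℂ P] [TopologicalSpace P]
    [AddCommGroup P'] [Module ℂ P'] [TopologicalSpace P'] [AddCommGroup P''] [Module ℂ P'']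
    [TopologicalSpace P''] {X : P' → P''} {M : P →L[ℂ] P'} {c : P} (hX : CylMapAt X (M c)) :
    CylMapAt (fun y => X (M y)) c :=
  fun V _ _ L => (hX V L).comp_clm

/-- This is the commutator [∂/∂u^i_{k+1}, D_x] = ∂/∂u^i_k, on which the normal form depends. -/
theorem xShift_eu (i : Fin m) (k : ℕ) : xShift (eu i (k + 1)) = eu i k := by
  refine jet_ext fun c => ?_
  rcases c with _ | _ | ⟨j, l⟩
  · rfl
  · rfl
  · simp only [co, xShift, eu]
    by_cases h : j = i
    · subst h
      by_cases h' : l = k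
      · subst h'; simp
      · have : l + 1 ≠ k + 1 := by omega
        simp [h']
    · simp [h]

theorem cylMapAt_xField (z : Jet m ℕ) : CylMapAt xField z := by
  refine cylMapAt_of_co fun c => ?_
  rcases c with _ | _ | ⟨i, k⟩
  · exact cylAnalyticAt_const 1 z
  · exact cylAnalyticAt_const 0 z
  · exact cylAnalyticAt_clm (coL (some (some (i, k + 1)))) z

theorem lineDeriv_co_xField (z v : Jet m ℕ) (c : Coord m ℕ) :
    lineDeriv ℂ (fun y => co c (xField y)) z v = co c (xShift v) := by
  rcases c with _ | _ | ⟨i, k⟩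
  · exact deriv_const _ _
  · exact deriv_const _ _
  · have := hasCylDeriv_of_clm (coL (some (some (i, k + 1)))) z v ℂ (ContinuousLinearMap.id ℂ ℂ)
    exact this

theorem hasCylDeriv_xField (z v : Jet m ℕ) : HasCylDeriv xField z v (xShift v) :=
  hasCylDeriv_of_co (cylMapAt_xField z) (lineDeriv_co_xField z v)

theorem CylAnalyticAt.Dx [CompleteSpace E] {f : Jet m ℕ → E} {z : Jet m ℕ}
    (hf : CylAnalyticAt f z) : CylAnalyticAt (Dx f) z :=
  hf.lie (cylMapAt_xField z)

theorem cylAnalyticAt_iterate_Dx {F : Jet m (Fin (d + 1)) → Fin m → ℂ} {z : Jet m ℕ}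
    (hF : AnalyticAt ℂ F (trunc (d + 1) z)) (i : Fin m) (k : ℕ) :
    CylAnalyticAt (Dx^[k] fun y => F (trunc (d + 1) y) i) z := by
  induction k with
  | zero =>
    exact CylAnalyticAt.clm_comp (f := fun y => F (trunc (d + 1) y))
      ⟨_, inferInstance, inferInstance, truncL (d + 1), F, hF, Eventually.of_forall fun _ => rfl⟩
      (ContinuousLinearMap.proj i)
  | succ k ih =>
    rw [Function.iterate_succ_apply']
    exact ih.Dx

theorem eventually_analyticAt_trunc {F : Jet m (Fin (d + 1)) → Fin m → ℂ} {z : Jet m ℕ}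
    (hF : AnalyticAt ℂ F (trunc (d + 1) z)) :
    ∀ᶠ z' in 𝓝 z, AnalyticAt ℂ F (trunc (d + 1) z') :=
  (truncL (d + 1)).continuous.continuousAt.eventually hF.eventually_analyticAt

theorem cylMapAt_tField {F : Jet m (Fin (d + 1)) → Fin m → ℂ} {z : Jet m ℕ}
    (hF : AnalyticAt ℂ F (trunc (d + 1) z)) : CylMapAt (tField F) z := by
  refine cylMapAt_of_co fun c => ?_
  rcases c with _ | _ | ⟨i, k⟩
  · exact cylAnalyticAt_const 0 z
  · exact cylAnalyticAt_const 1 z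
  · exact cylAnalyticAt_iterate_Dx hF i k

/-- Each application of D_x raises the order by at most one: commuting ∂/∂u^j_{l+1} past D_x leaves
∂/∂u^j_l, which is covered by the induction hypothesis. -/
theorem lineDeriv_iterate_Dx_eq_zero {F : Jet m (Fin (d + 1)) → Fin m → ℂ} (k : ℕ) {z : Jet m ℕ}
    (hF : AnalyticAt ℂ F (trunc (d + 1) z)) (i j : Fin m) {l : ℕ} (hl : d + k < l) :
    lineDeriv ℂ (Dx^[k] fun y => F (trunc (d + 1) y) i) z (eu j l) = 0 := by
  induction k generalizing z l with
  | zero =>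
    have h : ∀ t : ℂ, trunc (d + 1) (z + t • eu j l) = trunc (d + 1) z := by
      intro t
      rw [← truncL_apply, map_add, map_smul, truncL_apply, truncL_apply]
      have : trunc (d + 1) (eu j l) = 0 := by
        refine jet_ext fun c => ?_
        rw [co_trunc, co_zero]
        have := co_bv (up c) (some (some (j, l)))
        rw [if_neg] at this
        · exact this
        · rintro h
          have h1 : (some (some (j, l)) : Coord m ℕ) ∈ cols m (d + 1) := ⟨c, h⟩
          rw [mem_cols_u] at h1
          omega
      rw [this, smul_zero, add_zero]
    simp only [Function.iterate_zero, id_eq, lineDeriv, h]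
    exact deriv_const _ _
  | succ k ih =>
    rw [Function.iterate_succ_apply']
    obtain ⟨l, rfl⟩ : ∃ l', l = l' + 1 := ⟨l - 1, by omega⟩
    have h1 := (cylAnalyticAt_iterate_Dx hF i k).lineDeriv_lie (cylMapAt_xField z)
      (hasCylDeriv_xField z (eu j (l + 1)))
    have h2 : (fun y => lineDeriv ℂ (Dx^[k] fun y => F (trunc (d + 1) y) i) y (eu j (l + 1)))
        =ᶠ[𝓝 z] fun _ => 0 := by
      filter_upwards [eventually_analyticAt_trunc hF] with y hy using ih hy (by omega)
    rw [lineDeriv_congr h2, xShift_eu, ih hF (by omega), add_zero] at h1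
    exact h1.trans (deriv_const _ _)

theorem cylMapAt_xLift {A : Jet m ℕ × Fib q → Fib q} {y : Jet m ℕ × Fib q}
    (hA : CylAnalyticAt A y) : CylMapAt (xLift A) y :=
  CylMapAt.prodMk (CylMapAt.comp_clm (M := ContinuousLinearMap.fst ℂ (Jet m ℕ) (Fib q))
    (cylMapAt_xField y.1)) hA

theorem cylMapAt_tLift {F : Jet m (Fin (d + 1)) → Fin m → ℂ} {B : Jet m ℕ × Fib q → Fib q}
    {y : Jet m ℕ × Fib q} (hF : AnalyticAt ℂ F (trunc (d + 1) y.1)) (hB : CylAnalyticAt B y) :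
    CylMapAt (tLift F B) y :=
  CylMapAt.prodMk (CylMapAt.comp_clm (M := ContinuousLinearMap.fst ℂ (Jet m ℕ) (Fib q))
    (cylMapAt_tField hF)) hB

theorem hasCylDeriv_xLift {A : Jet m ℕ × Fib q → Fib q} {y : Jet m ℕ × Fib q}
    (hA : CylAnalyticAt A y) (v : Jet m ℕ × Fib q) :
    HasCylDeriv (xLift A) y v (xShift v.1, lineDeriv ℂ A y v) := by
  have h := CylMapAt.comp_clm (M := ContinuousLinearMap.fst ℂ (Jet m ℕ) (Fib q))
    (cylMapAt_xField y.1)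
  exact HasCylDeriv.prodMk h hA (hasCylDeriv_of_co h fun c => lineDeriv_co_xField y.1 v.1 c)

theorem hasCylDeriv_tLift {F : Jet m (Fin (d + 1)) → Fin m → ℂ} {B : Jet m ℕ × Fib q → Fib q}
    {y : Jet m ℕ × Fib q} (hF : AnalyticAt ℂ F (trunc (d + 1) y.1)) (hB : CylAnalyticAt B y)
    (v : Jet m ℕ × Fib q) :
    HasCylDeriv (tLift F B) y v
      ((0, 0, fun i k => lineDeriv ℂ (Dx^[k] fun y => F (trunc (d + 1) y) i) y.1 v.1),
        lineDeriv ℂ B y v) := by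
  have h := CylMapAt.comp_clm (M := ContinuousLinearMap.fst ℂ (Jet m ℕ) (Fib q))
    (cylMapAt_tField (z := y.1) hF)
  refine HasCylDeriv.prodMk h hB (hasCylDeriv_of_co h fun c => ?_)
  rcases c with _ | _ | ⟨i, k⟩
  · exact deriv_const _ _
  · exact deriv_const _ _
  · rfl

theorem lineDeriv_slice (f : Jet m ℕ × Fib q → E) (y : Jet m ℕ × Fib q) (v : Jet m ℕ) :
    lineDeriv ℂ (fun z => f (z, y.2)) y.1 v = lineDeriv ℂ f y (v, 0) := by
  have : ∀ t : ℂ, (y.1 + t • v, y.2) = y + t • (v, (0 : Fib q)) :=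
    fun t => Prod.ext rfl (by simp)
  simp only [lineDeriv, this]

theorem Dx_slice (f : Jet m ℕ × Fib q → E) (y : Jet m ℕ × Fib q) :
    Dx (fun z => f (z, y.2)) y.1 = lineDeriv ℂ f y (xField y.1, 0) :=
  lineDeriv_slice f y _

theorem Dt_slice (F : Jet m (Fin (d + 1)) → Fin m → ℂ) (f : Jet m ℕ × Fib q → E)
    (y : Jet m ℕ × Fib q) :
    Dt F (fun z => f (z, y.2)) y.1 = lineDeriv ℂ f y (tField F y.1, 0) :=
  lineDeriv_slice f y _

theorem CylAnalyticAt.slice_right {f : Jet m ℕ × Fib q → E} {y : Jet m ℕ × Fib q}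
    (hf : CylAnalyticAt f y) : AnalyticAt ℂ (fun w => f (y.1, w)) y.2 := by
  refine CylAnalyticAt.analyticAt (CylAnalyticAt.comp (G := fun w => (y.1, w)) (c := y.2) hf ?_
    (by fun_prop))
  exact CylMapAt.prodMk (cylMapAt_const _ _) (cylAnalyticAt_clm (ContinuousLinearMap.id ℂ _) _)

theorem CylAnalyticAt.slice_left {f : Jet m ℕ × Fib q → E} {y : Jet m ℕ × Fib q}
    (hf : CylAnalyticAt f y) : CylAnalyticAt (fun z => f (z, y.2)) y.1 := by
  refine CylAnalyticAt.comp (G := fun z => (z, y.2)) (c := y.1) hf ?_ (by fun_prop)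
  exact CylMapAt.prodMk (cylMapAt_clm (ContinuousLinearMap.id ℂ _) _) (cylAnalyticAt_const _ _)

theorem CylAnalyticAt.fderiv_slice {f : Jet m ℕ × Fib q → E} {y : Jet m ℕ × Fib q}
    (hf : CylAnalyticAt f y) (v : Fib q) :
    fderiv ℂ (fun w => f (y.1, w)) y.2 v = lineDeriv ℂ f y (0, v) := by
  rw [← hf.slice_right.differentiableAt.lineDeriv_eq_fderiv]
  have : ∀ t : ℂ, (y.1, y.2 + t • v) = y + t • ((0 : Jet m ℕ), v) :=
    fun t => Prod.ext (by simp) rfl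
  simp only [lineDeriv, this]

theorem CylAnalyticAt.lineDeriv_mk {f : Jet m ℕ × Fib q → E} {y : Jet m ℕ × Fib q}
    (hf : CylAnalyticAt f y) (v : Jet m ℕ) (ω : Fib q) :
    lineDeriv ℂ f y (v, ω) = lineDeriv ℂ f y (v, 0) + lineDeriv ℂ f y (0, ω) := by
  rw [← hf.lineDeriv_add]
  simp

end Fields

/-! ### Coverings and gauge transformations in terms of vector fields -/

section Gauge

variable {m d q : ℕ} {F : Jet m (Fin (d + 1)) → Fin m → ℂ}

/-- The two halves of the bracket are absorbed into the derivatives, which leaves (D_x + A)(B) =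
(D_t + B)(A), the vanishing of the fibre part of the commutator of the lifted fields. -/
theorem covering_eq_iff {A B : Jet m ℕ × Fib q → Fib q} {y : Jet m ℕ × Fib q}
    (hA : CylAnalyticAt A y) (hB : CylAnalyticAt B y) :
    Dx (fun z => B (z, y.2)) y.1 - Dt F (fun z => A (z, y.2)) y.1
        + VectorField.lieBracket ℂ (fun w => A (y.1, w)) (fun w => B (y.1, w)) y.2 = 0 ↔
      lineDeriv ℂ B y (xLift A y) = lineDeriv ℂ A y (tLift F B y) := by
  rw [Dx_slice, Dt_slice, VectorField.lieBracket, hA.fderiv_slice, hB.fderiv_slice, xLift, tLift,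
    hA.lineDeriv_mk (tField F y.1) (B y), hB.lineDeriv_mk (xField y.1) (A y)]
  rw [sub_add_sub_comm, sub_eq_zero]

theorem isCoveringAt_iff {A B : Jet m ℕ × Fib q → Fib q} {c : Jet m ℕ × Fib q} :
    IsCoveringAt F A B c ↔ CylAnalyticAt A c ∧ CylAnalyticAt B c ∧
      ∀ᶠ y in 𝓝 c, lineDeriv ℂ B y (xLift A y) = lineDeriv ℂ A y (tLift F B y) := by
  rw [IsCoveringAt, jetAnalyticAt_iff, jetAnalyticAt_iff]
  refine and_congr_right fun hA => and_congr_right fun hB => ?_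
  refine eventually_congr ?_
  filter_upwards [hA.eventually, hB.eventually] with y h1 h2 using covering_eq_iff h1 h2

/-- The vector fields `D_x + A` and `D_t + B` of a covering commute. -/
theorem lie_comm_of_covering {A B : Jet m ℕ × Fib q → Fib q} {y : Jet m ℕ × Fib q}
    (hF : AnalyticAt ℂ F (trunc (d + 1) y.1)) (hA : CylAnalyticAt A y) (hB : CylAnalyticAt B y)
    (h : lineDeriv ℂ B y (xLift A y) = lineDeriv ℂ A y (tLift F B y))
    {E : Type} [NormedAddCommGroup E] [NormedSpace ℂ E] [CompleteSpace E]
    {f : Jet m ℕ × Fib q → E} (hf : CylAnalyticAt f y) :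
    lineDeriv ℂ (fun y => lineDeriv ℂ f y (tLift F B y)) y (xLift A y)
      = lineDeriv ℂ (fun y => lineDeriv ℂ f y (xLift A y)) y (tLift F B y) := by
  have h1 := hf.lie_sub_lie (cylMapAt_xLift hA) (cylMapAt_tLift hF hB)
    (hasCylDeriv_tLift hF hB _) (hasCylDeriv_xLift hA _)
  rw [← sub_eq_zero, h1, h]
  -- The jet part of the commutator vanishes because D_x maps each component D_x^k(F^i) of D_t to
  -- the next one.
  have h2 : ((0, 0, fun i k => lineDeriv ℂ (Dx^[k] fun y => F (trunc (d + 1) y) i) y.1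
      (xLift A y).1) : Jet m ℕ) = xShift (tLift F B y).1 := by
    refine jet_ext fun c => ?_
    rcases c with _ | _ | ⟨i, k⟩
    · rfl
    · rfl
    · simp only [co, xShift, tLift, tField]
      rw [Function.iterate_succ_apply']
      rfl
  rw [h2, sub_self, lineDeriv_zero]

/-- Gauge transformations, in terms of the vector fields `D_x + A` and `D_t + B`. -/
structure GaugePair (F : Jet m (Fin (d + 1)) → Fin m → ℂ) (a : Jet m ℕ)
    (b : Fib q) (A B : Jet m ℕ × Fib q → Fib q)
    (b' : Fib q) (A' B' : Jet m ℕ × Fib q → Fib q) (g h : Jet m ℕ × Fib q → Fib q) : Prop where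
  hg : CylAnalyticAt g (a, b')
  hh : CylAnalyticAt h (a, b)
  map_base : g (a, b') = b
  left_inv : ∀ᶠ y in 𝓝 (a, b'), h (y.1, g y) = y.2
  right_inv : ∀ᶠ y in 𝓝 (a, b), g (y.1, h y) = y.2
  eq_x : ∀ᶠ y in 𝓝 (a, b'), lineDeriv ℂ g y (xLift A' y) = A (y.1, g y)
  eq_t : ∀ᶠ y in 𝓝 (a, b'), lineDeriv ℂ g y (tLift F B' y) = B (y.1, g y)

/-- The derivative of g in w and the total derivative combine into one derivative along the lifted
field, so that the rest of the argument uses only the chain rule on ℰ × W. -/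
theorem gaugeEquivAt_iff {a : Jet m ℕ} {b b' : Fib q} {A B A' B' : Jet m ℕ × Fib q → Fib q} :
    GaugeEquivAt F a b A B b' A' B' ↔ ∃ g h, GaugePair F a b A B b' A' B' g h := by
  have key : ∀ g : Jet m ℕ × Fib q → Fib q, CylAnalyticAt g (a, b') →
      ((∀ᶠ y in 𝓝 (a, b'),
        fderiv ℂ (fun w => g (y.1, w)) y.2 (A' y) + Dx (fun z => g (z, y.2)) y.1 = A (y.1, g y) ∧
        fderiv ℂ (fun w => g (y.1, w)) y.2 (B' y) + Dt F (fun z => g (z, y.2)) y.1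
          = B (y.1, g y)) ↔
      (∀ᶠ y in 𝓝 (a, b'), lineDeriv ℂ g y (xLift A' y) = A (y.1, g y)) ∧
        ∀ᶠ y in 𝓝 (a, b'), lineDeriv ℂ g y (tLift F B' y) = B (y.1, g y)) := by
    intro g hg
    rw [← eventually_and]
    refine eventually_congr ?_
    filter_upwards [hg.eventually] with y hy
    rw [Dx_slice, Dt_slice, hy.fderiv_slice, hy.fderiv_slice, xLift, tLift,
      hy.lineDeriv_mk (xField y.1) (A' y), hy.lineDeriv_mk (tField F y.1) (B' y), add_comm, add_comm (lineDeriv ℂ g y (0, B' y))]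
  constructor
  · rintro ⟨g, h, h1, h2, h3, h4, h5, h6⟩
    rw [jetAnalyticAt_iff] at h1 h2
    exact ⟨g, h, h1, h2, h3, h4, h5, ((key g h1).1 h6).1, ((key g h1).1 h6).2⟩
  · rintro ⟨g, h, H⟩
    exact ⟨g, h, jetAnalyticAt_iff.2 H.hg, jetAnalyticAt_iff.2 H.hh, H.map_base, H.left_inv,
      H.right_inv, (key g H.hg).2 ⟨H.eq_x, H.eq_t⟩⟩

section Graph

variable {E : Type} [NormedAddCommGroup E] [NormedSpace ℂ E]

theorem CylAnalyticAt.graph_continuousAt {g : Jet m ℕ × Fib q → Fib q} {y : Jet m ℕ × Fib q}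
    (hg : CylAnalyticAt g y) : ContinuousAt (fun y : Jet m ℕ × Fib q => (y.1, g y)) y :=
  continuousAt_fst.prodMk hg.continuousAt

theorem CylAnalyticAt.graph_cylMapAt {g : Jet m ℕ × Fib q → Fib q} {y : Jet m ℕ × Fib q}
    (hg : CylAnalyticAt g y) : CylMapAt (fun y : Jet m ℕ × Fib q => (y.1, g y)) y :=
  CylMapAt.prodMk (cylMapAt_clm (ContinuousLinearMap.fst ℂ _ _) y) hg

theorem CylAnalyticAt.comp_graph {f : Jet m ℕ × Fib q → E} {g : Jet m ℕ × Fib q → Fib q}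
    {y : Jet m ℕ × Fib q} (hf : CylAnalyticAt f (y.1, g y)) (hg : CylAnalyticAt g y) :
    CylAnalyticAt (fun y => f (y.1, g y)) y :=
  CylAnalyticAt.comp (G := fun y : Jet m ℕ × Fib q => (y.1, g y)) hf hg.graph_cylMapAt
    hg.graph_continuousAt

theorem CylAnalyticAt.comp_graph_of_eq {f : Jet m ℕ × Fib q → E} {g : Jet m ℕ × Fib q → Fib q}
    {a : Jet m ℕ} {b b' : Fib q} (hf : CylAnalyticAt f (a, b)) (hg : CylAnalyticAt g (a, b'))
    (hb : g (a, b') = b) : CylAnalyticAt (fun y => f (y.1, g y)) (a, b') := by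
  subst hb
  exact CylAnalyticAt.comp_graph hf hg

theorem CylAnalyticAt.tendsto_graph {g : Jet m ℕ × Fib q → Fib q}
    {a : Jet m ℕ} {b b' : Fib q} (hg : CylAnalyticAt g (a, b')) (hb : g (a, b') = b) :
    Tendsto (fun y : Jet m ℕ × Fib q => (y.1, g y)) (𝓝 (a, b')) (𝓝 (a, b)) := by
  subst hb
  exact hg.graph_continuousAt

theorem CylAnalyticAt.lineDeriv_comp_graph {f : Jet m ℕ × Fib q → E}
    {g : Jet m ℕ × Fib q → Fib q} {y : Jet m ℕ × Fib q} (hf : CylAnalyticAt f (y.1, g y))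
    (hg : CylAnalyticAt g y) (v : Jet m ℕ × Fib q) :
    lineDeriv ℂ (fun y => f (y.1, g y)) y v
      = lineDeriv ℂ f (y.1, g y) (v.1, lineDeriv ℂ g y v) :=
  CylAnalyticAt.lineDeriv_comp (G := fun y : Jet m ℕ × Fib q => (y.1, g y)) hf hg.graph_cylMapAt
    hg.graph_continuousAt (HasCylDeriv.prodMk (cylMapAt_clm (ContinuousLinearMap.fst ℂ _ _) y) hg
      (hasCylDeriv_of_clm (ContinuousLinearMap.fst ℂ _ _) y v))

theorem lineDeriv_snd (y v : Jet m ℕ × Fib q) :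
    lineDeriv ℂ (fun y : Jet m ℕ × Fib q => y.2) y v = v.2 :=
  hasCylDeriv_of_clm (ContinuousLinearMap.snd ℂ (Jet m ℕ) (Fib q)) y v _ (ContinuousLinearMap.id ℂ (Fib q))

end Graph

variable {a : Jet m ℕ} {b b' b'' : Fib q} {A B A' B' A'' B'' g h g' h' : Jet m ℕ × Fib q → Fib q}

theorem GaugePair.tendsto (H : GaugePair F a b A B b' A' B' g h) :
    Tendsto (fun y : Jet m ℕ × Fib q => (y.1, g y)) (𝓝 (a, b')) (𝓝 (a, b)) :=
  H.hg.tendsto_graph H.map_base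

theorem GaugePair.inv_map_base (H : GaugePair F a b A B b' A' B' g h) : h (a, b) = b' := by
  have := H.left_inv.self_of_nhds
  simpa [H.map_base] using this

/-- Differentiating h(·, g) = w along D_x + A' and D_t + B' at the point over h(y), and inserting
the gauge equations, gives the equations for `h`. -/
theorem GaugePair.symm (H : GaugePair F a b A B b' A' B' g h) :
    GaugePair F a b' A' B' b A B h g := by
  have hb := H.inv_map_base
  have ht : Tendsto (fun y : Jet m ℕ × Fib q => (y.1, h y)) (𝓝 (a, b)) (𝓝 (a, b')) :=
    H.hh.tendsto_graph hb
  refine ⟨H.hh, H.hg, hb, H.right_inv, H.left_inv, ?_, ?_⟩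
  · filter_upwards [H.right_inv, ht.eventually H.left_inv.eventually_nhds, H.hh.eventually,
      ht.eventually H.eq_x, ht.eventually H.hg.eventually] with y h1 h2 h3 h4 h5
    have h6 : CylAnalyticAt h ((y.1, h y).1, g (y.1, h y)) := by
      simp only [h1]; exact h3
    have h7 := h6.lineDeriv_comp_graph h5 (xLift A' (y.1, h y))
    rw [lineDeriv_congr h2, lineDeriv_snd, h4] at h7
    simp only [h1] at h7
    exact h7.symm
  · filter_upwards [H.right_inv, ht.eventually H.left_inv.eventually_nhds, H.hh.eventually,
      ht.eventually H.eq_t, ht.eventually H.hg.eventually] with y h1 h2 h3 h4 h5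
    have h6 : CylAnalyticAt h ((y.1, h y).1, g (y.1, h y)) := by
      simp only [h1]; exact h3
    have h7 := h6.lineDeriv_comp_graph h5 (tLift F B' (y.1, h y))
    rw [lineDeriv_congr h2, lineDeriv_snd, h4] at h7
    simp only [h1] at h7
    exact h7.symm

theorem GaugePair.trans (H : GaugePair F a b A B b' A' B' g h)
    (H' : GaugePair F a b' A' B' b'' A'' B'' g' h') :
    GaugePair F a b A B b'' A'' B'' (fun y => g (y.1, g' y)) (fun y => h' (y.1, h y)) := by
  have t' := H'.tendsto
  have t := H.symm.tendsto
  have e1 : CylAnalyticAt (fun y : Jet m ℕ × Fib q => g (y.1, g' y)) (a, b'') :=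
    H.hg.comp_graph_of_eq H'.hg H'.map_base
  have e2 : CylAnalyticAt (fun y : Jet m ℕ × Fib q => h' (y.1, h y)) (a, b) :=
    H'.hh.comp_graph_of_eq H.hh H.inv_map_base
  refine ⟨e1, e2, by simp [H'.map_base, H.map_base], ?_, ?_, ?_, ?_⟩
  · filter_upwards [H'.left_inv, t'.eventually H.left_inv] with y h1 h2
    simp only [h2, h1]
  · filter_upwards [H.right_inv, t.eventually H'.right_inv] with y h1 h2
    simp only [h2, h1]
  · filter_upwards [t'.eventually H.hg.eventually, H'.hg.eventually, H'.eq_x,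
      t'.eventually H.eq_x] with y h1 h2 h3 h4
    rw [h1.lineDeriv_comp_graph h2, h3]
    exact h4
  · filter_upwards [t'.eventually H.hg.eventually, H'.hg.eventually, H'.eq_t,
      t'.eventually H.eq_t] with y h1 h2 h3 h4
    rw [h1.lineDeriv_comp_graph h2, h3]
    exact h4

/-- The derivative of `h` in the fibre is a left inverse, by differentiation of h(·, g) = w. -/
theorem GaugePair.lineDeriv_fiber_injective (H : GaugePair F a b A B b' A' B' g h) :
    ∀ᶠ y in 𝓝 (a, b'), ∀ ω, lineDeriv ℂ g y (0, ω) = 0 → ω = 0 := by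
  filter_upwards [H.left_inv.eventually_nhds, H.hg.eventually, H.tendsto.eventually H.hh.eventually]
    with y h1 h2 h3 ω hω
  have h4 := h3.lineDeriv_comp_graph h2 (0, ω)
  rw [lineDeriv_congr h1, lineDeriv_snd, hω] at h4
  exact h4.trans lineDeriv_zero

/-- Transport of a covering along a gauge transformation. -/
theorem exists_gaugePair_of_inverse (hF : AnalyticAt ℂ F (trunc (d + 1) a))
    (hcov : IsCoveringAt F A B (a, b)) (hg : CylAnalyticAt g (a, b'))
    (hh : CylAnalyticAt h (a, b)) (hb : g (a, b') = b)
    (hl : ∀ᶠ y in 𝓝 (a, b'), h (y.1, g y) = y.2) (hr : ∀ᶠ y in 𝓝 (a, b), g (y.1, h y) = y.2) :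
    ∃ A' B', GaugePair F a b A B b' A' B' g h ∧ IsCoveringAt F A' B' (a, b') := by
  obtain ⟨hA, hB, heq⟩ := isCoveringAt_iff.1 hcov
  have tG : Tendsto (fun y : Jet m ℕ × Fib q => (y.1, g y)) (𝓝 (a, b')) (𝓝 (a, b)) :=
    hg.tendsto_graph hb
  have hF' : ∀ᶠ y in 𝓝 (a, b), AnalyticAt ℂ F (trunc (d + 1) y.1) :=
    (continuous_fst.tendsto (a, b)).eventually (eventually_analyticAt_trunc hF)
  -- The new covering is forced: A' and B' are the derivatives of `h` along D_x + A and D_t + B,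
  -- evaluated at g.
  obtain ⟨Xh, hXh'⟩ : ∃ Xh : Jet m ℕ × Fib q → Fib q, Xh = fun y => lineDeriv ℂ h y (xLift A y) :=
    ⟨_, rfl⟩
  obtain ⟨Th, hTh'⟩ : ∃ Th : Jet m ℕ × Fib q → Fib q, Th = fun y => lineDeriv ℂ h y (tLift F B y) :=
    ⟨_, rfl⟩
  have hXh : CylAnalyticAt Xh (a, b) := hXh' ▸ hh.lie (cylMapAt_xLift hA)
  have hTh : CylAnalyticAt Th (a, b) := hTh' ▸ hh.lie (cylMapAt_tLift hF hB)
  have hA' : CylAnalyticAt (fun y : Jet m ℕ × Fib q => Xh (y.1, g y)) (a, b') :=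
    hXh.comp_graph_of_eq hg hb
  have hB' : CylAnalyticAt (fun y : Jet m ℕ × Fib q => Th (y.1, g y)) (a, b') :=
    hTh.comp_graph_of_eq hg hb
  have ex : ∀ᶠ y in 𝓝 (a, b'),
      lineDeriv ℂ g y (xLift (fun y => Xh (y.1, g y)) y) = A (y.1, g y) := by
    filter_upwards [tG.eventually hr.eventually_nhds, hl, hg.eventually,
      tG.eventually hh.eventually] with y h1 h2 h3 h4
    have h5 : CylAnalyticAt g ((y.1, g y).1, h (y.1, g y)) := by
      simp only [h2]; exact h3
    have h6 := h5.lineDeriv_comp_graph h4 (xLift A (y.1, g y))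
    rw [lineDeriv_congr h1, lineDeriv_snd] at h6
    simp only [h2] at h6
    rw [xLift, hXh']
    exact h6.symm
  have et : ∀ᶠ y in 𝓝 (a, b'),
      lineDeriv ℂ g y (tLift F (fun y => Th (y.1, g y)) y) = B (y.1, g y) := by
    filter_upwards [tG.eventually hr.eventually_nhds, hl, hg.eventually,
      tG.eventually hh.eventually] with y h1 h2 h3 h4
    have h5 : CylAnalyticAt g ((y.1, g y).1, h (y.1, g y)) := by
      simp only [h2]; exact h3
    have h6 := h5.lineDeriv_comp_graph h4 (tLift F B (y.1, g y))
    rw [lineDeriv_congr h1, lineDeriv_snd] at h6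
    simp only [h2] at h6
    rw [tLift, hTh']
    exact h6.symm
  have hcomm : ∀ᶠ y in 𝓝 (a, b), lineDeriv ℂ Th y (xLift A y) = lineDeriv ℂ Xh y (tLift F B y) := by
    filter_upwards [hh.eventually, hA.eventually, hB.eventually, heq, hF'] with y h6 h7 h8 h9 h10
    rw [hTh', hXh']
    exact lie_comm_of_covering h10 h7 h8 h9 h6
  -- The chain rule turns this into the statement that D_x + A and D_t + B commute on `h`, which is
  -- `hcomm`.
  have hcov' : ∀ᶠ y in 𝓝 (a, b'),
      lineDeriv ℂ (fun y : Jet m ℕ × Fib q => Th (y.1, g y)) y (xLift (fun y => Xh (y.1, g y)) y)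
        = lineDeriv ℂ (fun y : Jet m ℕ × Fib q => Xh (y.1, g y)) y
          (tLift F (fun y => Th (y.1, g y)) y) := by
    filter_upwards [ex, et, hg.eventually, tG.eventually hXh.eventually,
      tG.eventually hTh.eventually, tG.eventually hcomm] with y h1 h2 h3 h4 h5 h6
    rw [h5.lineDeriv_comp_graph h3, h4.lineDeriv_comp_graph h3, h1, h2]
    exact h6
  exact ⟨fun y => Xh (y.1, g y), fun y => Th (y.1, g y), ⟨hg, hh, hb, hl, hr, ex, et⟩,
    isCoveringAt_iff.2 ⟨hA', hB', hcov'⟩⟩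

end Gauge

/-! ### Normal coverings -/

section Rank

variable {m : ℕ}

/-- The position of a coordinate in the order `t, x, u^1_0, …, u^m_0, u^1_1, …`. -/
def rank : Coord m ℕ → ℕ
  | none => 1
  | some none => 0
  | some (some ik) => 2 + ik.2 * m + ik.1

/-- The number `2 + n * m` counts x, t and the first n columns u^i_0, …, u^i_{n-1}. -/
theorem rank_u_lt_iff {i : Fin m} {k n : ℕ} :
    rank (some (some (i, k)) : Coord m ℕ) < 2 + n * m ↔ k < n := by
  have hi := i.2
  simp only [rank]
  constructor
  · intro h
    by_contra hk
    have := Nat.mul_le_mul_right m (not_lt.1 hk)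
    omega
  · intro h
    have := Nat.mul_le_mul_right m (Nat.succ_le_of_lt h)
    rw [Nat.succ_mul] at this
    omega

theorem rank_injective : Function.Injective (rank : Coord m ℕ → ℕ) := by
  intro c c' h
  rcases c with _ | _ | ⟨i, k⟩ <;> rcases c' with _ | _ | ⟨i', k'⟩
  · rfl
  · simp [rank] at h
  · simp [rank] at h; omega
  · simp [rank] at h
  · rfl
  · simp [rank] at h; omega
  · simp [rank] at h; omega
  · simp [rank] at h
  · have h1 : k = k' := by
      rcases lt_trichotomy k k' with hk | hk | hk
      · have h2 := (rank_u_lt_iff (i := i)).2 hk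
        rw [h] at h2
        simp only [rank] at h2
        omega
      · exact hk
      · have h2 := (rank_u_lt_iff (i := i')).2 hk
        rw [← h] at h2
        simp only [rank] at h2
        omega
    subst h1
    simp only [rank] at h
    have : i = i' := Fin.ext (by omega)
    subst this
    rfl

theorem exists_u_of_le_rank {n : ℕ} {c : Coord m ℕ} (h : 2 + n * m ≤ rank c) :
    ∃ i k, c = some (some (i, k)) ∧ n ≤ k := by
  rcases c with _ | _ | ⟨i, k⟩
  · simp only [rank] at h; omega
  · simp only [rank] at h; omega
  · exact ⟨i, k, rfl, by_contra fun hk => absurd (rank_u_lt_iff.2 (not_le.1 hk)) (not_lt.2 h)⟩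

theorem rank_u_succ (i : Fin m) (k : ℕ) :
    rank (some (some (i, k)) : Coord m ℕ) < rank (some (some (i, k + 1)) : Coord m ℕ) := by
  have := i.2
  simp only [rank, Nat.succ_mul]
  omega

end Rank

section Normal

variable {m d q : ℕ} {F : Jet m (Fin (d + 1)) → Fin m → ℂ}

/-- The component of a covering that can be normalized by a gauge transformation in which the
coordinate `c` is the last one: `B` for `t`, `A` for `x`, and `∂A/∂u^i_{k+1}` for `u^i_k`. -/
def Phi (A B : Jet m ℕ × Fib q → Fib q) : Coord m ℕ → Jet m ℕ × Fib q → Fib q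
  | none => A
  | some none => B
  | some (some ik) => fun y => lineDeriv ℂ A y (eu ik.1 (ik.2 + 1), 0)

/-- The component of the covering that belongs to `c` vanishes at the points whose coordinates
after `c` are those of `a`. -/
def NormalAt (a : Jet m ℕ) (b : Fib q) (A B : Jet m ℕ × Fib q → Fib q) (c : Coord m ℕ) : Prop :=
  ∀ᶠ y in 𝓝 (a, b), (∀ c', rank c < rank c' → co c' y.1 = co c' a) → Phi A B c y = 0

theorem CylAnalyticAt.phi {A B : Jet m ℕ × Fib q → Fib q} {y : Jet m ℕ × Fib q}
    (hA : CylAnalyticAt A y) (hB : CylAnalyticAt B y) (c : Coord m ℕ) :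
    CylAnalyticAt (Phi A B c) y := by
  rcases c with _ | _ | ⟨i, k⟩
  · exact hA
  · exact hB
  · exact hA.lineDeriv_const _

variable {a : Jet m ℕ} {b b' : Fib q} {A B A' B' g h : Jet m ℕ × Fib q → Fib q}

/-- Transformation of the components under a gauge transformation that does not depend on the
coordinates of rank greater than `r`. -/
theorem GaugePair.phi_eq (H : GaugePair F a b A B b' A' B' g h) (hA : CylAnalyticAt A (a, b))
    (hA' : CylAnalyticAt A' (a, b')) {r : ℕ}
    (hind : ∀ᶠ y in 𝓝 (a, b'), ∀ c, r < rank c → lineDeriv ℂ g y (bv c, 0) = 0)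
    {c : Coord m ℕ} (hc : r ≤ rank c) :
    ∀ᶠ y in 𝓝 (a, b'), lineDeriv ℂ g y (0, Phi A' B' c y) + lineDeriv ℂ g y (bv c, 0)
      = Phi A B c (y.1, g y) := by
  rcases c with _ | _ | ⟨i, k⟩
  · filter_upwards [H.eq_x, H.hg.eventually, hind] with y h1 h2 h3
    -- The difference D_x - ∂/∂x involves only the ∂/∂u^i_k, whose coordinates come after x.
    have h4 : lineDeriv ℂ g y (xField y.1 - bv none, 0) = 0 := by
      refine h2.lineDeriv_eq_zero_of_co fun c => ?_
      rcases c with _ | _ | ⟨i, k⟩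
      · left; simp [co, bv, ex, xField]
      · left; simp [co, bv, ex, xField]
      · right; exact h3 _ (by simp only [rank] at hc ⊢; omega)
    have h5 : (xField y.1, A' y) = ((0 : Jet m ℕ), A' y) + (bv none, 0)
        + (xField y.1 - bv none, 0) := by simp
    rw [xLift, h5, h2.lineDeriv_add, h2.lineDeriv_add, h4, add_zero] at h1
    exact h1
  · filter_upwards [H.eq_t, H.hg.eventually, hind] with y h1 h2 h3
    -- Likewise D_t - ∂/∂t involves only the ∂/∂u^i_k.
    have h4 : lineDeriv ℂ g y (tField F y.1 - bv (some none), 0) = 0 := by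
      refine h2.lineDeriv_eq_zero_of_co fun c => ?_
      rcases c with _ | _ | ⟨i, k⟩
      · left; simp [co, bv, et, tField]
      · left; simp [co, bv, et, tField]
      · right; exact h3 _ (by simp only [rank] at hc ⊢; omega)
    have h5 : (tField F y.1, B' y) = ((0 : Jet m ℕ), B' y) + (bv (some none), 0)
        + (tField F y.1 - bv (some none), 0) := by simp
    rw [tLift, h5, h2.lineDeriv_add, h2.lineDeriv_add, h4, add_zero] at h1
    exact h1
  · have hr : r < rank (some (some (i, k + 1)) : Coord m ℕ) := hc.trans_lt (rank_u_succ i k)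
    filter_upwards [H.eq_x.eventually_nhds, H.hg.eventually, hind.eventually_nhds,
      H.tendsto.eventually hA.eventually, hA'.eventually] with y h1 h2 h3 h4 h5
    -- Differentiate (D_x + A')g = A ∘ g by u^i_{k+1}. As g does not depend on this coordinate, what
    -- remains on the left is the commutator ∂g/∂u^i_k + g_w ∂A'/∂u^i_{k+1}.
    have h6 := h2.lineDeriv_lie (cylMapAt_xLift h5) (hasCylDeriv_xLift h5 (eu i (k + 1), 0))
    have h7 : (fun y => lineDeriv ℂ g y (eu i (k + 1), 0)) =ᶠ[𝓝 y] fun _ => 0 :=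
      h3.mono fun y' h => h (some (some (i, k + 1))) hr
    have h8 : lineDeriv ℂ (fun _ : Jet m ℕ × Fib q => (0 : Fib q)) y (xLift A' y) = 0 :=
      deriv_const _ _
    rw [lineDeriv_congr h1, h4.lineDeriv_comp_graph h2, lineDeriv_congr h7, h8, zero_add,
      show lineDeriv ℂ g y (eu i (k + 1), 0) = 0 from h7.self_of_nhds] at h6
    simp only [xShift_eu] at h6
    rw [h2.lineDeriv_mk (eu i k)] at h6
    exact (add_comm _ _).trans h6.symm

/-- A gauge transformation between normal coverings does not depend on the jet coordinates. -/
theorem GaugePair.eventually_eq_base (H : GaugePair F a b A B b' A' B' g h)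
    (hA : CylAnalyticAt A (a, b)) (hA' : CylAnalyticAt A' (a, b'))
    (hn : ∀ c, NormalAt a b A B c) (hn' : ∀ c, NormalAt a b' A' B' c) :
    ∀ᶠ y in 𝓝 (a, b'), g y = g (a, y.2) := by
  -- Descent on the rank: independence of the coordinates of rank > r implies independence of the
  -- one of rank r.
  have key : ∀ r, (∀ᶠ y in 𝓝 (a, b'), ∀ c, r ≤ rank c → lineDeriv ℂ g y (bv c, 0) = 0) →
      ∀ᶠ y in 𝓝 (a, b'), ∀ c, lineDeriv ℂ g y (bv c, 0) = 0 := by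
    intro r
    induction r with
    | zero => exact fun h => h.mono fun y hy c => hy c (Nat.zero_le _)
    | succ r ih =>
      intro hr
      apply ih
      by_cases hc : ∃ c : Coord m ℕ, rank c = r
      · obtain ⟨c, rfl⟩ := hc
        have hind : ∀ᶠ y in 𝓝 (a, b'), ∀ c', rank c < rank c' →
            lineDeriv ℂ g y (bv c', 0) = 0 := hr
        have h1 := H.phi_eq hA hA' hind le_rfl
        -- Where the later coordinates are those of `a`, both components Φ vanish by normality, and
        -- the transformation law reduces to ∂g/∂c = 0.
        have h2 : ∀ᶠ y in 𝓝 (a, b'), (∀ c', rank c < rank c' → co c' y.1 = co c' a) →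
            lineDeriv ℂ g y (bv c, 0) = 0 := by
          filter_upwards [h1, hn' c, H.tendsto.eventually (hn c)] with y h3 h4 h5 h6
          rw [h4 h6, h5 h6] at h3
          have : ((0 : Jet m ℕ), (0 : Fib q)) = 0 := rfl
          rwa [this, lineDeriv_zero, zero_add] at h3
        -- Since g does not depend on the later coordinates, neither does ∂g/∂c, so they may be
        -- reset to their values at `a`.
        have h3 : ∀ᶠ y in 𝓝 (a, b'), lineDeriv ℂ g y (bv c, 0)
            = lineDeriv ℂ g (reset {c' | rank c' ≤ rank c} a y.1, y.2) (bv c, 0) := by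
          refine (H.hg.lineDeriv_const (bv c, 0)).eventually_eq_reset ?_
          filter_upwards [hind.eventually_nhds, H.hg.eventually] with y h4 h5 c' hc'
          rw [h5.lineDeriv_comm]
          have h6 : (fun y => lineDeriv ℂ g y (bv c', 0)) =ᶠ[𝓝 y] fun _ => 0 :=
            h4.mono fun y' h => h c' (not_le.1 hc')
          rw [lineDeriv_congr h6]
          exact deriv_const _ _
        filter_upwards [h3, (tendsto_reset_prod {c' | rank c' ≤ rank c} a b').eventually h2, hr]
          with y h4 h5 h6 c' hc'
        rcases hc'.eq_or_lt with h7 | h7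
        · rw [← rank_injective h7, h4]
          refine h5 fun c'' hc'' => ?_
          rw [co_reset, if_neg (by simpa using hc'')]
        · exact h6 c' h7
      -- For m = 0 there are no coordinates of rank ≥ 2, so a rank may be unoccupied.
      · filter_upwards [hr] with y hy c h1
        exact hy c (lt_of_le_of_ne h1 fun h2 => hc ⟨c, h2.symm⟩)
  -- The descent can start because g depends on finitely many coordinates.
  obtain ⟨n, -, hn⟩ := H.hg.exists_level 0
  have h1 := key (2 + n * m) (hn.mono fun y hy c hc => hy c (by
    obtain ⟨i, k, rfl, hk⟩ := exists_u_of_le_rank hc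
    rw [mem_cols_u]
    omega))
  filter_upwards [H.hg.eventually_eq_reset (S := ∅) (h1.mono fun y hy c _ => hy c)] with y hy
  rw [hy]
  congr 2
  refine jet_ext fun c => ?_
  rw [co_reset, if_neg (by simp)]

end Normal

/-! ### Existence of normal coverings -/

section Existence

variable {m d q : ℕ} {F : Jet m (Fin (d + 1)) → Fin m → ℂ} {a : Jet m ℕ} {b : Fib q}

/-- Solution of a differential equation in the coordinate `c`, with an inverse. -/
theorem exists_gauge_solution {V : Jet m ℕ × Fib q → Fib q} (hV : CylAnalyticAt V (a, b))
    (c : Coord m ℕ) :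
    ∃ g h : Jet m ℕ × Fib q → Fib q, CylAnalyticAt g (a, b) ∧ CylAnalyticAt h (a, b) ∧
      g (a, b) = b ∧ (∀ᶠ y in 𝓝 (a, b), h (y.1, g y) = y.2) ∧
      (∀ᶠ y in 𝓝 (a, b), g (y.1, h y) = y.2) ∧
      (∀ y, ∀ c', rank c < rank c' → lineDeriv ℂ g y (bv c', 0) = 0) ∧
      ∀ᶠ y in 𝓝 (a, b), (∀ c', rank c < rank c' → co c' y.1 = co c' a) →
        lineDeriv ℂ g y (bv c, 0) = V (y.1, g y) := by
  obtain ⟨n, V₀, hV₀, hVV₀⟩ := jetAnalyticAt_iff.2 hV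
  obtain ⟨sol, hs, hs0, hs'⟩ := exists_analytic_solution hV₀ (trunc n (bv c))
  -- The solution starts with the value w at the point where `c` and all later coordinates are those
  -- of `a`. The map `ι` records the time (the increment of `c`), this initial point and w. Later
  -- coordinates are discarded, so g does not depend on them.
  let S : Set (Coord m ℕ) := {c' | rank c' < rank c}
  let ι : Jet m ℕ × Fib q → ℂ × Jet m (Fin n) × Fib q :=
    fun y => (co c y.1 - co c a, trunc n (reset S a y.1), y.2)
  have hι0 : ∀ w, ι (a, w) = (0, trunc n a, w) := fun w => by simp [ι, reset_self]
  have hι : CylAnalyticAt ι (a, b) := by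
    refine CylAnalyticAt.prodMk ?_ (CylAnalyticAt.prodMk ?_ ?_)
    · exact (cylAnalyticAt_clm ((coL c).comp (ContinuousLinearMap.fst ℂ _ _)) (a, b)).sub
        (cylAnalyticAt_const _ _)
    · exact CylAnalyticAt.comp_clm (f := fun z => truncL n (reset S a z))
        (M := ContinuousLinearMap.fst ℂ (Jet m ℕ) (Fib q)) (c := (a, b))
        (cylMapAt_reset S a a _ (truncL n))
    · exact cylAnalyticAt_clm (ContinuousLinearMap.snd ℂ (Jet m ℕ) (Fib q)) _
  let g : Jet m ℕ × Fib q → Fib q := fun y => sol (ι y)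
  have hg : CylAnalyticAt g (a, b) := CylAnalyticAt.comp_analyticAt (by rwa [hι0]) hι
  have hline : ∀ (y : Jet m ℕ × Fib q) (t : ℂ) (c' : Coord m ℕ), rank c ≤ rank c' →
      ι (y + t • (bv c', 0)) = ((ι y).1 + (if c = c' then t else 0), (ι y).2) := by
    intro y t c' hc'
    have h1 : reset S a (y.1 + t • bv c') = reset S a y.1 := by
      refine jet_ext fun c'' => ?_
      rw [co_reset, co_reset]
      split_ifs with h
      · have : c'' ≠ c' := by
          rintro rfl
          exact absurd hc' (not_le.2 h)
        rw [co_add, co_smul, co_bv, if_neg this, mul_zero, add_zero]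
      · rfl
    simp only [ι, Prod.fst_add, Prod.smul_fst, Prod.snd_add, Prod.smul_snd, smul_zero, add_zero, h1,
      co_add, co_smul, co_bv]
    congr 1
    split_ifs <;> ring
  have hgind : ∀ y, ∀ c', rank c < rank c' → lineDeriv ℂ g y (bv c', 0) = 0 := by
    intro y c' hc'
    have h1 : ∀ t : ℂ, g (y + t • (bv c', 0)) = g y := by
      intro t
      have hne : c ≠ c' := by
        rintro rfl
        exact lt_irrefl _ hc'
      simp only [g, hline y t c' hc'.le, if_neg hne, add_zero]
    simp only [lineDeriv, h1]
    exact deriv_const _ _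
  have hga : ∀ᶠ w in 𝓝 b, g (a, w) = w := by
    have h1 : Tendsto (fun w : Fib q => (trunc n a, w)) (𝓝 b) (𝓝 (trunc n a, b)) :=
      (Continuous.prodMk continuous_const continuous_id).tendsto b
    filter_upwards [h1.eventually hs0] with w hw
    simp only [g, hι0, hw]
  have hgb : g (a, b) = b := hga.self_of_nhds
  have hgeq : ∀ᶠ y in 𝓝 (a, b), (∀ c', rank c < rank c' → co c' y.1 = co c' a) →
      lineDeriv ℂ g y (bv c, 0) = V (y.1, g y) := by
    have hι' : Tendsto ι (𝓝 (a, b)) (𝓝 (0, trunc n a, b)) := by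
      rw [← hι0]; exact hι.continuousAt
    filter_upwards [hι'.eventually hs', (hg.tendsto_graph hgb).eventually hVV₀] with y h1 h2 h3
    have h4 : trunc n (reset S a y.1) + (co c y.1 - co c a) • trunc n (bv c) = trunc n y.1 := by
      rw [← truncL_apply, ← truncL_apply, ← truncL_apply, ← map_smul, ← map_add]
      congr 1
      refine jet_ext fun c' => ?_
      rw [co_add, co_smul, co_reset, co_bv]
      rcases lt_trichotomy (rank c') (rank c) with h | h | h
      · have : c' ≠ c := by rintro rfl; exact lt_irrefl _ h
        rw [if_pos (show c' ∈ S from h), if_neg this, mul_zero, add_zero]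
      · rw [rank_injective h, if_neg (by simp [S]), if_pos rfl]
        ring
      · have : c' ≠ c := by rintro rfl; exact lt_irrefl _ h
        rw [if_neg (by simpa [S] using h.le), if_neg this, mul_zero, add_zero, h3 c' h]
    rw [h2]
    change HasDerivAt (fun s => sol (s, (ι y).2))
      (V₀ (trunc n (reset S a y.1) + (co c y.1 - co c a) • trunc n (bv c), g y)) (ι y).1 at h1
    rw [h4] at h1
    have h5 := HasDerivAt.comp_const_add (f := fun s => sol (s, (ι y).2)) (ι y).1 0
      (by rwa [add_zero])
    refine HasLineDerivAt.lineDeriv (v := (bv c, (0 : Fib q))) ?_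
    refine HasDerivAt.congr_of_eventuallyEq h5 (Eventually.of_forall fun t => ?_)
    simp only [g, hline y t c le_rfl, if_true]
  obtain ⟨n', g₀, hg₀, hgg₀⟩ := jetAnalyticAt_iff.2 hg
  let M : Jet m ℕ × Fib q →L[ℂ] Jet m (Fin n') × Fib q :=
    ((truncL n').comp (ContinuousLinearMap.fst ℂ _ _)).prod (ContinuousLinearMap.snd ℂ _ _)
  -- At the jet `a` the time is 0 and g(a, w) = w, so the fibrewise inverse function theorem applies
  -- to the finite-dimensional model.
  obtain ⟨h₀, hh₀, hl, hr⟩ := exists_analytic_fiber_inverse hg₀ (by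
    have h1 : Tendsto (fun w : Fib q => (a, w)) (𝓝 b) (𝓝 (a, b)) :=
      (Continuous.prodMk continuous_const continuous_id).tendsto b
    filter_upwards [hga, h1.eventually hgg₀] with w h2 h3
    exact h3.symm.trans h2)
  have hM : Tendsto M (𝓝 (a, b)) (𝓝 (trunc n' a, b)) := M.continuous.tendsto (a, b)
  have hh : CylAnalyticAt (fun y => h₀ (M y)) (a, b) :=
    CylAnalyticAt.comp_analyticAt (f := fun y => M y) hh₀ (cylAnalyticAt_clm M (a, b))
  have hl' : ∀ᶠ y in 𝓝 (a, b), h₀ (M (y.1, g y)) = y.2 := by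
    filter_upwards [hM.eventually hl, hgg₀] with y h1 h2
    rw [h2]
    exact h1
  have hhb : h₀ (M (a, b)) = b := by
    have := hl'.self_of_nhds
    rwa [hgb] at this
  refine ⟨g, fun y => h₀ (M y), hg, hh, hgb, hl', ?_, hgind, hgeq⟩
  filter_upwards [hM.eventually hr, (hh.tendsto_graph hhb).eventually hgg₀] with y h1 h2
  rw [h2]
  exact h1

variable {A B : Jet m ℕ × Fib q → Fib q}

/-- The point is the order of quantifiers: one neighborhood must serve all coordinates. Beyond some
level the derivatives vanish in any case, and finitely many conditions remain. -/
theorem orderLEAt_of_forall {p : ℕ} {b : Fib q} {A : Jet m ℕ × Fib q → Fib q}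
    (hA : CylAnalyticAt A (a, b)) (h : ∀ (i : Fin m) (k : ℕ), p ≤ k →
      ∀ᶠ y in 𝓝 (a, b), lineDeriv ℂ A y (eu i (k + 1), 0) = 0) : OrderLEAt p A (a, b) := by
  obtain ⟨n, -, hn⟩ := hA.exists_level 0
  have h1 : ∀ᶠ y in 𝓝 (a, b), ∀ ik : Fin m × Fin n, p ≤ (ik.2 : ℕ) →
      lineDeriv ℂ A y (eu ik.1 (ik.2 + 1), 0) = 0 := by
    rw [eventually_all]
    intro ik
    by_cases hk : p ≤ (ik.2 : ℕ)
    · exact (h ik.1 ik.2 hk).mono fun _ hy _ => hy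
    · exact Eventually.of_forall fun _ h => absurd h hk
  filter_upwards [hn, h1] with y h2 h3 i s hs
  rw [lineDeriv_slice]
  obtain ⟨k, rfl⟩ : ∃ k, s = k + 1 := ⟨s - 1, by omega⟩
  by_cases hk : k < n
  · exact h3 (i, ⟨k, hk⟩) (by simpa using (by omega : p ≤ k))
  · exact h2 (some (some (i, k + 1))) (by rw [mem_cols_u]; omega)

/-- With ∂g/∂c = Φ_c(g) the transformation law gives g_w Φ'_c = 0 where the later coordinates are
those of `a`. For later c' it gives g_w Φ'_{c'} = Φ_{c'} ∘ g, so normality there persists. The order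
persists for the same reason, since it is a condition on the Φ of the u^i_k with k ≥ p, all of which
come after `c`. -/
theorem exists_gauge_step (hF : AnalyticAt ℂ F (trunc (d + 1) a)) {p : ℕ}
    (hcov : IsCoveringAt F A B (a, b)) (hord : OrderLEAt p A (a, b)) {c : Coord m ℕ}
    (hc : rank c < 2 + p * m) (hn : ∀ c', rank c < rank c' → NormalAt a b A B c') :
    ∃ A' B' g h, GaugePair F a b A B b A' B' g h ∧ IsCoveringAt F A' B' (a, b) ∧
      OrderLEAt p A' (a, b) ∧ ∀ c', rank c ≤ rank c' → NormalAt a b A' B' c' := by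
  obtain ⟨hA, hB, -⟩ := isCoveringAt_iff.1 hcov
  obtain ⟨g, h, hg, hh, hb, hl, hr, hind, heq⟩ := exists_gauge_solution (hA.phi hB c) c
  obtain ⟨A', B', H, hcov'⟩ := exists_gaugePair_of_inverse hF hcov hg hh hb hl hr
  have hA' := (isCoveringAt_iff.1 hcov').1
  have hphi : ∀ c', rank c ≤ rank c' → _ := fun c' hc' =>
    H.phi_eq hA hA' (Eventually.of_forall hind) hc'
  refine ⟨A', B', g, h, H, hcov', orderLEAt_of_forall hA' fun i k hk => ?_, fun c' hc' => ?_⟩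
  · have hc' : rank c < rank (some (some (i, k)) : Coord m ℕ) := by
      refine hc.trans_le (not_lt.1 fun h => ?_)
      exact absurd (rank_u_lt_iff.1 h) (not_lt.2 hk)
    filter_upwards [hphi _ hc'.le, H.lineDeriv_fiber_injective, H.tendsto.eventually hord]
      with y h1 h2 h3
    have h4 := (lineDeriv_slice A (y.1, g y) _).symm.trans (h3 i (k + 1) (by omega))
    rw [hind y _ hc', add_zero] at h1
    exact h2 _ (h1.trans h4)
  · rcases hc'.eq_or_lt with h0 | h0
    · rw [← rank_injective h0]
      filter_upwards [hphi c le_rfl, H.lineDeriv_fiber_injective, heq] with y h1 h2 h3 h4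
      rw [h3 h4] at h1
      exact h2 _ (add_eq_right.1 h1)
    · filter_upwards [hphi c' hc', H.lineDeriv_fiber_injective, H.tendsto.eventually (hn c' h0)]
        with y h1 h2 h3 h4
      rw [hind y c' h0, add_zero, h3 h4] at h1
      exact h2 _ h1

/-- Every covering of order at most `p` is gauge equivalent to a normal one. -/
theorem exists_normal_covering (hF : AnalyticAt ℂ F (trunc (d + 1) a)) {p : ℕ}
    (hcov : IsCoveringAt F A B (a, b)) (hord : OrderLEAt p A (a, b)) :
    ∃ A' B', GaugeEquivAt F a b A B b A' B' ∧ IsCoveringAt F A' B' (a, b) ∧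
      OrderLEAt p A' (a, b) ∧ ∀ c, NormalAt a b A' B' c := by
  have key : ∀ j r, r + j = 2 + p * m → ∃ A' B' g h, GaugePair F a b A B b A' B' g h ∧
      IsCoveringAt F A' B' (a, b) ∧ OrderLEAt p A' (a, b) ∧
      ∀ c, r ≤ rank c → NormalAt a b A' B' c := by
    intro j
    induction j with
    | zero =>
      rintro r hr
      obtain ⟨hA, hB, -⟩ := isCoveringAt_iff.1 hcov
      refine ⟨A, B, fun y => y.2, fun y => y.2, ⟨?_, ?_, rfl, Eventually.of_forall fun _ => rfl,
        Eventually.of_forall fun _ => rfl, Eventually.of_forall fun y => ?_,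
        Eventually.of_forall fun y => ?_⟩, hcov, hord, fun c hc => ?_⟩
      · exact cylAnalyticAt_clm (ContinuousLinearMap.snd ℂ (Jet m ℕ) (Fib q)) _
      · exact cylAnalyticAt_clm (ContinuousLinearMap.snd ℂ (Jet m ℕ) (Fib q)) _
      · rw [lineDeriv_snd]; rfl
      · rw [lineDeriv_snd]; rfl
      -- From rank `2 + p * m` on, Φ is a derivative ∂A/∂u^i_{k+1} with k ≥ p, which vanishes by the
      -- bound on the order.
      · obtain ⟨i, k, rfl, hk⟩ := exists_u_of_le_rank (n := p) (c := c) (by omega)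
        filter_upwards [hord] with y hy _
        have := hy i (k + 1) (by omega)
        rwa [lineDeriv_slice] at this
    | succ j ih =>
      intro r hr
      obtain ⟨A', B', g, h, H, hcov', hord', hn⟩ := ih (r + 1) (by omega)
      by_cases hc : ∃ c : Coord m ℕ, rank c = r
      · obtain ⟨c, rfl⟩ := hc
        obtain ⟨A'', B'', g', h', H', hcov'', hord'', hn'⟩ :=
          exists_gauge_step hF hcov' hord' (c := c) (by omega) fun c' hc' => hn c' hc'
        exact ⟨A'', B'', _, _, H.trans H', hcov'', hord'', hn'⟩
      · exact ⟨A', B', g, h, H, hcov', hord', fun c hc' =>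
          hn c (lt_of_le_of_ne hc' fun h' => hc ⟨c, h'.symm⟩)⟩
  obtain ⟨A', B', g, h, H, hcov', hord', hn⟩ := key (2 + p * m) 0 (by omega)
  exact ⟨A', B', gaugeEquivAt_iff.2 ⟨g, h, H⟩, hcov', hord', fun c => hn c (Nat.zero_le _)⟩

/-- In a covering of order at most `p`, the components of `B` depend on the `u^i_k` with
`k < p + d` only. -/
theorem eventually_lineDeriv_B_eq_zero (hF : AnalyticAt ℂ F (trunc (d + 1) a)) {p : ℕ}
    (hcov : IsCoveringAt F A B (a, b)) (hord : OrderLEAt p A (a, b)) :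
    ∀ᶠ y in 𝓝 (a, b), ∀ c ∉ cols m (p + d), lineDeriv ℂ B y (bv c, 0) = 0 := by
  obtain ⟨hA, hB, heq⟩ := isCoveringAt_iff.1 hcov
  have hF' : ∀ᶠ y in 𝓝 (a, b), AnalyticAt ℂ F (trunc (d + 1) y.1) :=
    (continuous_fst.tendsto (a, b)).eventually (eventually_analyticAt_trunc hF)
  -- Differentiate (D_x + A)(B) = (D_t + B)(A) by u^i_{k+1}, on which neither A nor B depends. On
  -- the left ∂B/∂u^i_k remains; on the right only terms ∂A/∂u^j_{l'} · ∂D_x^{l'}(F^j)/∂u^i_{k+1}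
  -- with l' ≤ p, and these vanish because d + l' < k + 1.
  have step : ∀ k, p + d ≤ k →
      (∀ᶠ y in 𝓝 (a, b), ∀ c ∉ cols m (k + 1), lineDeriv ℂ B y (bv c, 0) = 0) →
      ∀ᶠ y in 𝓝 (a, b), ∀ c ∉ cols m k, lineDeriv ℂ B y (bv c, 0) = 0 := by
    intro k hk h0
    filter_upwards [heq.eventually_nhds, hA.eventually, hB.eventually, h0.eventually_nhds, hF',
      hord.eventually_nhds] with y h1 h2 h3 h4 h5 h6 c hc
    by_cases hc' : c ∈ cols m (k + 1)
    · rcases c with _ | _ | ⟨i, l⟩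
      · exact absurd ⟨none, rfl⟩ hc
      · exact absurd ⟨some none, rfl⟩ hc
      · rw [mem_cols_u] at hc hc'
        obtain rfl : l = k := by omega
        have e0 : (fun y => lineDeriv ℂ B y (eu i (l + 1), 0)) =ᶠ[𝓝 y] fun _ => 0 :=
          h4.mono fun y' h => h (some (some (i, l + 1))) (by rw [mem_cols_u]; omega)
        have e1 : (fun y => lineDeriv ℂ A y (eu i (l + 1), 0)) =ᶠ[𝓝 y] fun _ => 0 :=
          h6.mono fun y' h => by
            have := h i (l + 1) (by omega)
            rwa [lineDeriv_slice] at this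
        have e2 := h3.lineDeriv_lie (cylMapAt_xLift h2) (hasCylDeriv_xLift h2 (eu i (l + 1), 0))
        have e3 := h2.lineDeriv_lie (cylMapAt_tLift h5 h3)
          (hasCylDeriv_tLift h5 h3 (eu i (l + 1), 0))
        have z1 : lineDeriv ℂ (fun _ : Jet m ℕ × Fib q => (0 : Fib q)) y (xLift A y) = 0 :=
          deriv_const _ _
        have z2 : lineDeriv ℂ (fun _ : Jet m ℕ × Fib q => (0 : Fib q)) y (tLift F B y) = 0 :=
          deriv_const _ _
        rw [lineDeriv_congr e0, z1, zero_add,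
          show lineDeriv ℂ A y (eu i (l + 1), 0) = 0 from e1.self_of_nhds] at e2
        rw [lineDeriv_congr e1, z2, zero_add,
          show lineDeriv ℂ B y (eu i (l + 1), 0) = 0 from e0.self_of_nhds] at e3
        simp only [xShift_eu] at e2
        change lineDeriv ℂ B y (eu i l, 0) = 0
        rw [← e2, lineDeriv_congr h1, e3]
        refine h2.lineDeriv_eq_zero_of_co fun c => ?_
        rcases c with _ | _ | ⟨j, l'⟩
        · exact Or.inl rfl
        · exact Or.inl rfl
        · by_cases hl : p < l'
          · right
            have := h6.self_of_nhds j l' hl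
            rwa [lineDeriv_slice] at this
          · left
            exact lineDeriv_iterate_Dx_eq_zero l' h5 j i (by omega)
    · exact h4.self_of_nhds c hc'
  obtain ⟨n, hn, hB'⟩ := hB.exists_level (p + d)
  obtain ⟨j, rfl⟩ := Nat.exists_eq_add_of_le hn
  clear hn
  induction j with
  | zero => exact hB'
  | succ j ih => exact ih (step _ (by omega) hB')

end Existence

/-! ### Iterated derivatives -/

section IteratedDerivative

variable {P : Type} [AddCommGroup P] [Module ℂ P]
  {E : Type} [NormedAddCommGroup E] [NormedSpace ℂ E]

/-- The iterated derivative in the directions of a list of vectors. -/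
def dIter (vs : List P) (f : P → E) : P → E := vs.foldr (fun v g y => lineDeriv ℂ g y v) f

theorem dIter_cons (v : P) (vs : List P) (f : P → E) :
    dIter (v :: vs) f = fun y => lineDeriv ℂ (dIter vs f) y v := rfl

theorem dIter_append (vs vs' : List P) (f : P → E) :
    dIter (vs ++ vs') f = dIter vs (dIter vs' f) := List.foldr_append

theorem dIter_zero (vs : List P) : dIter vs (fun _ : P => (0 : E)) = fun _ => 0 := by
  induction vs with
  | nil => rfl
  | cons v vs ih =>
    rw [dIter_cons, ih]
    funext y
    simp [lineDeriv]

variable [TopologicalSpace P] [IsTopologicalAddGroup P] [ContinuousSMul ℂ P]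

theorem dIter_congr {f g : P → E} {c : P} (vs : List P) (h : f =ᶠ[𝓝 c] g) :
    dIter vs f =ᶠ[𝓝 c] dIter vs g := by
  induction vs with
  | nil => exact h
  | cons v vs ih => exact lineDeriv_congr_eventually ih fun _ => v

variable [CompleteSpace E]

theorem CylAnalyticAt.dIter {f : P → E} {c : P} (hf : CylAnalyticAt f c) (vs : List P) :
    CylAnalyticAt (dIter vs f) c := by
  induction vs with
  | nil => exact hf
  | cons v vs ih => exact ih.lineDeriv_const v

theorem dIter_add {f g : P → E} {c : P} (hf : CylAnalyticAt f c) (hg : CylAnalyticAt g c)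
    (vs : List P) :
    EvCov.dIter vs (fun y => f y + g y) =ᶠ[𝓝 c] fun y => EvCov.dIter vs f y + EvCov.dIter vs g y := by
  induction vs with
  | nil => exact EventuallyEq.rfl
  | cons v vs ih =>
    refine (lineDeriv_congr_eventually ih fun _ => v).trans ?_
    filter_upwards [(hf.dIter vs).eventually, (hg.dIter vs).eventually] with y h1 h2
      using lineDeriv_fun_add h1 h2 v

theorem dIter_clm_comp {E' : Type} [NormedAddCommGroup E'] [NormedSpace ℂ E'] [CompleteSpace E']
    {f : P → E} {c : P} (hf : CylAnalyticAt f c) (M : E →L[ℂ] E') (vs : List P) :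
    EvCov.dIter vs (fun y => M (f y)) =ᶠ[𝓝 c] fun y => M (EvCov.dIter vs f y) := by
  induction vs with
  | nil => exact EventuallyEq.rfl
  | cons v vs ih =>
    refine (lineDeriv_congr_eventually ih fun _ => v).trans ?_
    filter_upwards [(hf.dIter vs).eventually] with y h1 using h1.lineDeriv_clm_comp M v

/-- Mixed derivatives commute, so only the multiset of directions matters. -/
theorem dIter_perm {f : P → E} {c : P} (hf : CylAnalyticAt f c) {vs vs' : List P}
    (h : vs.Perm vs') : EvCov.dIter vs f =ᶠ[𝓝 c] EvCov.dIter vs' f := by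
  induction h with
  | nil => exact EventuallyEq.rfl
  | cons v _ ih => exact lineDeriv_congr_eventually ih fun _ => v
  | swap v v' l =>
    filter_upwards [(hf.dIter l).eventually] with y h1 using h1.lineDeriv_comm v v'
  | trans _ _ ih ih' => exact ih.trans ih'

end IteratedDerivative

/-! ### Exponents, monomials and Taylor coefficients -/

section Exponents

variable {m n : ℕ}

/-- The exponents as functions of the coordinates. -/
def expo : Expo m n ≃ (Coord m (Fin n) → ℕ) where
  toFun e
    | none => e.1
    | some none => e.2.1
    | some (some ik) => e.2.2 ik.1 ik.2
  invFun f := (f none, f (some none), fun i k => f (some (some (i, k))))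
  left_inv _ := rfl
  right_inv f := by
    funext c
    rcases c with _ | _ | ⟨i, k⟩ <;> rfl

/-- The total degree of an exponent. -/
def deg (e : Expo m n) : ℕ := ∑ c, expo e c

theorem prod_coord {M : Type*} [CommMonoid M] (f : Coord m (Fin n) → M) :
    ∏ c, f c = f none * f (some none) * ∏ i, ∏ k, f (some (some (i, k))) := by
  rw [Fintype.prod_option, Fintype.prod_option, Fintype.prod_prod_type, mul_assoc]

theorem mono_eq_prod (a z : Jet m ℕ) (e : Expo m n) :
    mono a e z = ∏ c, (co (up c) z - co (up c) a) ^ expo e c := by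
  rw [prod_coord]
  rfl

theorem finite_deg_le (m n N : ℕ) : {e : Expo m n | deg e ≤ N}.Finite := by
  have h : (expo '' {e : Expo m n | deg e ≤ N}).Finite := by
    refine Set.Finite.subset (Set.Finite.pi' fun _ => Set.finite_Iic N) ?_
    rintro _ ⟨e, he, rfl⟩ c
    exact (Finset.single_le_sum (f := expo e) (fun _ _ => Nat.zero_le _) (Finset.mem_univ c)).trans he
  exact h.of_finite_image expo.injective.injOn

/-- The list of directions of the iterated partial derivative that belongs to an exponent. -/
def dirs (e : Expo m n) : List (Jet m ℕ) :=
  List.replicate e.1 (ex m) ++ (List.replicate e.2.1 (et m) ++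
    (List.finRange m ×ˢ List.finRange n).flatMap fun ik =>
      List.replicate (e.2.2 ik.1 ik.2) (eu ik.1 ik.2))

/-- In this form all coordinates enter alike, whereas the Taylor coefficient of the statement treats
x, t and the u^i_k separately. -/
theorem dirs_coe (e : Expo m n) :
    (dirs e : Multiset (Jet m ℕ)) = ∑ c, Multiset.replicate (expo e c) (bv (up c)) := by
  have h : ∀ l : List (Fin m × Fin n), ((l.flatMap fun ik =>
      List.replicate (e.2.2 ik.1 ik.2) (eu ik.1 ik.2) : List (Jet m ℕ)) : Multiset (Jet m ℕ))
        = (l.map fun ik => Multiset.replicate (expo e (some (some ik))) (bv (up (some (some ik))))).sum := by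
    intro l
    induction l with
    | nil => rfl
    | cons ik l ih =>
      rw [List.flatMap_cons, ← Multiset.coe_add, ih, List.map_cons, List.sum_cons]
      rfl
  rw [dirs, ← Multiset.coe_add, ← Multiset.coe_add, h, Fintype.sum_option, Fintype.sum_option]
  congr 2
  have h2 : (List.finRange m ×ˢ List.finRange n).Nodup :=
    (List.nodup_finRange m).product (List.nodup_finRange n)
  have h3 : (List.finRange m ×ˢ List.finRange n).toFinset = Finset.univ := by
    ext ⟨i, k⟩
    simp
  rw [← List.sum_toFinset _ h2, h3]

theorem length_dirs (e : Expo m n) : (dirs e).length = deg e := by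
  rw [← Multiset.coe_card, dirs_coe, Multiset.card_sum]
  simp [deg]

/-- The product of the factorials of the entries of an exponent. -/
def efact (e : Expo m n) : ℕ := ∏ c, (expo e c).factorial

theorem iterate_pd (v : Jet m ℕ) (k : ℕ) (f : Jet m ℕ → ℂ) :
    (pd v)^[k] f = dIter (List.replicate k v) f := by
  induction k with
  | zero => rfl
  | succ k ih =>
    rw [Function.iterate_succ_apply', ih, List.replicate_succ, dIter_cons]
    rfl

/-- The Taylor coefficient of a vector-valued function. -/
def tcoeff {E : Type} [NormedAddCommGroup E] [NormedSpace ℂ E] (a : Jet m ℕ) (e : Expo m n)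
    (f : Jet m ℕ → E) : E := (efact e : ℂ)⁻¹ • dIter (dirs e) f a

theorem taylorCoeff_eq (a : Jet m ℕ) (e : Expo m n) (f : Jet m ℕ → ℂ) :
    taylorCoeff a e f = tcoeff a e f := by
  have h : ∀ l : List (Fin m × Fin n),
      l.foldr (fun ik g => (pd (eu ik.1 ik.2))^[e.2.2 ik.1 ik.2] g) f
        = dIter (l.flatMap fun ik => List.replicate (e.2.2 ik.1 ik.2) (eu ik.1 ik.2)) f := by
    intro l
    induction l with
    | nil => rfl
    | cons ik l ih => rw [List.foldr_cons, ih, List.flatMap_cons, dIter_append, iterate_pd]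
  rw [taylorCoeff, tcoeff, h, iterate_pd, iterate_pd, dirs, dIter_append, dIter_append,
    smul_eq_mul, efact, prod_coord, div_eq_inv_mul]
  rfl

end Exponents

section TaylorCoefficients

variable {m n : ℕ} {E : Type} [NormedAddCommGroup E] [NormedSpace ℂ E] {a : Jet m ℕ}

theorem tcoeff_congr {f g : Jet m ℕ → E} (h : f =ᶠ[𝓝 a] g) (e : Expo m n) :
    tcoeff a e f = tcoeff a e g := by
  rw [tcoeff, tcoeff, (dIter_congr (dirs e) h).self_of_nhds]

theorem tcoeff_zero (e : Expo m n) : tcoeff a e (fun _ => (0 : E)) = 0 := by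
  rw [tcoeff, dIter_zero, smul_zero]

variable [CompleteSpace E]

theorem tcoeff_add {f g : Jet m ℕ → E} (hf : CylAnalyticAt f a) (hg : CylAnalyticAt g a)
    (e : Expo m n) : tcoeff a e (fun z => f z + g z) = tcoeff a e f + tcoeff a e g := by
  rw [tcoeff, (dIter_add hf hg (dirs e)).self_of_nhds, smul_add]
  rfl

theorem tcoeff_clm_comp {E' : Type} [NormedAddCommGroup E'] [NormedSpace ℂ E'] [CompleteSpace E']
    {f : Jet m ℕ → E} (hf : CylAnalyticAt f a) (M : E →L[ℂ] E') (e : Expo m n) :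
    tcoeff a e (fun z => M (f z)) = M (tcoeff a e f) := by
  rw [tcoeff, (dIter_clm_comp hf M (dirs e)).self_of_nhds, tcoeff, map_smul]

theorem tcoeff_sub {f g : Jet m ℕ → E} (hf : CylAnalyticAt f a) (hg : CylAnalyticAt g a)
    (e : Expo m n) : tcoeff a e (fun z => f z - g z) = tcoeff a e f - tcoeff a e g := by
  have h := tcoeff_add (hf.sub hg) hg e
  simp only [sub_add_cancel] at h
  rw [h, add_sub_cancel_right]

theorem tcoeff_smul_const {f : Jet m ℕ → ℂ} (hf : CylAnalyticAt f a) (v : E) (e : Expo m n) :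
    tcoeff a e (fun z => f z • v) = tcoeff a e f • v :=
  tcoeff_clm_comp hf ((ContinuousLinearMap.id ℂ ℂ).smulRight v) e

theorem tcoeff_sum {ι : Type*} (s : Finset ι) {f : ι → Jet m ℕ → E}
    (hf : ∀ i ∈ s, CylAnalyticAt (f i) a) (e : Expo m n) :
    tcoeff a e (fun z => ∑ i ∈ s, f i z) = ∑ i ∈ s, tcoeff a e (f i) := by
  classical
  induction s using Finset.induction_on with
  | empty => simpa using tcoeff_zero e
  | insert i s hi ih =>
    simp only [Finset.sum_insert hi]
    rw [tcoeff_add (hf i (by simp)) (CylAnalyticAt.sum s fun j hj => hf j (by simp [hj])),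
      ih fun j hj => hf j (by simp [hj])]

/-- The exponent with the entry that belongs to the coordinate `c` increased by one. -/
def incr (c : Coord m (Fin n)) (e : Expo m n) : Expo m n :=
  expo.symm (expo e + Pi.single c 1)

theorem expo_incr (c : Coord m (Fin n)) (e : Expo m n) : expo (incr c e) = expo e + Pi.single c 1 :=
  expo.apply_symm_apply _

theorem efact_incr (c : Coord m (Fin n)) (e : Expo m n) :
    efact (incr c e) = (expo e c + 1) * efact e := by
  rw [efact, efact, expo_incr, ← Finset.mul_prod_erase _ _ (Finset.mem_univ c),
    
    ← Finset.mul_prod_erase Finset.univ (fun c => (expo e c).factorial) (Finset.mem_univ c), ← mul_assoc]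
  congr 1
  · simp [Nat.factorial_succ]
  · refine Finset.prod_congr rfl fun c' hc' => ?_
    simp [Pi.single_eq_of_ne (Finset.ne_of_mem_erase hc')]

theorem dirs_incr (c : Coord m (Fin n)) (e : Expo m n) :
    (dirs (incr c e)).Perm (dirs e ++ [bv (up c)]) := by
  rw [← Multiset.coe_eq_coe, ← Multiset.coe_add, dirs_coe, dirs_coe, expo_incr]
  simp only [Pi.add_apply, Multiset.replicate_add, Finset.sum_add_distrib]
  congr 1
  rw [Finset.sum_eq_single c]
  · simp
  · intro c' _ hc'
    simp [Pi.single_eq_of_ne hc']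
  · simp

theorem tcoeff_lineDeriv {f : Jet m ℕ → E} (hf : CylAnalyticAt f a) (c : Coord m (Fin n))
    (e : Expo m n) :
    tcoeff a e (fun z => lineDeriv ℂ f z (bv (up c))) = ((expo e c + 1 : ℕ) : ℂ) • tcoeff a (incr c e) f := by
  rw [tcoeff, tcoeff, (dIter_perm hf (dirs_incr c e)).self_of_nhds, dIter_append, efact_incr,
    smul_smul]
  congr 1
  rw [Nat.cast_mul, mul_inv, ← mul_assoc, mul_inv_cancel₀ (Nat.cast_ne_zero.2 (Nat.succ_ne_zero _)),
    one_mul]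

theorem cylAnalyticAt_mono (e : Expo m n) (c : Jet m ℕ) : CylAnalyticAt (mono a e) c := by
  rw [show mono a e = _ from funext fun z => mono_eq_prod a z e]
  exact CylAnalyticAt.prod _ fun i _ =>
    ((cylAnalyticAt_clm (coL (up i)) c).sub (cylAnalyticAt_const _ c)).pow _

end TaylorCoefficients

/-! ### Order of vanishing -/

section Vanishing

open Asymptotics

variable {m n : ℕ} {E : Type} [NormedAddCommGroup E] [NormedSpace ℂ E]
  {E' : Type} [NormedAddCommGroup E'] [NormedSpace ℂ E']
  {E'' : Type} [NormedAddCommGroup E''] [NormedSpace ℂ E''] {a : Jet m ℕ}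

/-- The function `f` is analytic near `a` and vanishes at `a` to the order `N`. -/
def VanishAt (a : Jet m ℕ) (f : Jet m ℕ → E) (N : ℕ) : Prop :=
  CylAnalyticAt f a ∧ ∃ n, f =O[𝓝 a] fun z => ‖trunc n (z - a)‖ ^ N

theorem norm_trunc_mono {n n' : ℕ} (h : n ≤ n') (v : Jet m ℕ) : ‖trunc n v‖ ≤ ‖trunc n' v‖ := by
  refine (norm_le_iff_co (norm_nonneg _)).2 fun c => ?_
  rw [co_trunc]
  rcases c with _ | _ | ⟨i, k⟩
  · exact norm_co_le (trunc n' v) none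
  · exact norm_co_le (trunc n' v) (some none)
  · exact norm_co_le (trunc n' v) (some (some (i, ⟨k, k.2.trans_le h⟩)))

theorem isBigO_norm_trunc {n n' : ℕ} (h : n ≤ n') (N : ℕ) :
    (fun z => ‖trunc n (z - a)‖ ^ N) =O[𝓝 a] fun z => ‖trunc n' (z - a)‖ ^ N := by
  refine IsBigO.of_bound 1 (Eventually.of_forall fun z => ?_)
  rw [one_mul, Real.norm_of_nonneg (by positivity), Real.norm_of_nonneg (by positivity)]
  gcongr
  exact norm_trunc_mono h _

theorem CylAnalyticAt.vanishAt_zero {f : Jet m ℕ → E} (hf : CylAnalyticAt f a) : VanishAt a f 0 := by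
  refine ⟨hf, 0, ?_⟩
  simp only [pow_zero]
  exact hf.continuousAt.isBigO_one ℝ

theorem VanishAt.add {f g : Jet m ℕ → E} {N : ℕ} (hf : VanishAt a f N) (hg : VanishAt a g N) :
    VanishAt a (fun z => f z + g z) N := by
  obtain ⟨hf, n, hn⟩ := hf
  obtain ⟨hg, n', hn'⟩ := hg
  exact ⟨hf.add hg, max n n', (hn.trans (isBigO_norm_trunc (le_max_left _ _) N)).add
    (hn'.trans (isBigO_norm_trunc (le_max_right _ _) N))⟩

theorem VanishAt.bilin {f : Jet m ℕ → E} {g : Jet m ℕ → E'} {N M : ℕ} (hf : VanishAt a f N)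
    (hg : VanishAt a g M) (T : E →L[ℂ] E' →L[ℂ] E'') :
    VanishAt a (fun z => T (f z) (g z)) (N + M) := by
  obtain ⟨hf, n, hn⟩ := hf
  obtain ⟨hg, n', hn'⟩ := hg
  refine ⟨(hf.prodMk hg).comp_analyticAt (g := fun e : E × E' => T e.1 e.2)
    (T.analyticAt_bilinear _), max n n', ?_⟩
  have h := (hn.trans (isBigO_norm_trunc (le_max_left n n') N)).norm_left.mul
    (hn'.trans (isBigO_norm_trunc (le_max_right n n') M)).norm_left
  simp only [← pow_add] at h
  refine IsBigO.trans (IsBigO.of_bound ‖T‖ (Eventually.of_forall fun z => ?_)) h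
  rw [norm_mul, norm_norm, norm_norm, ← mul_assoc]
  exact T.le_opNorm₂ _ _

/-- Cauchy's estimate for s ↦ f(z + sX(z)) on a disc of radius comparable to the distance of z from
a costs one power of this distance. -/
theorem VanishAt.lie {f : Jet m ℕ → E} {X : Jet m ℕ → Jet m ℕ} {N : ℕ} [CompleteSpace E]
    (hf : VanishAt a f (N + 1)) (hX : CylMapAt X a) :
    VanishAt a (fun z => lineDeriv ℂ f z (X z)) N := by
  obtain ⟨hf, n, hn⟩ := hf
  refine ⟨hf.lie hX, ?_⟩
  obtain ⟨C, hC, hO⟩ := isBigO_iff'.1 hn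
  obtain ⟨n', hn', δ, hδ, hU⟩ := exists_cylinder_subset (hO.and hf.eventually) n
  set K := ‖trunc n' (X a)‖ + 1 with hK
  have hK0 : 0 < K := by positivity
  have hXK : ∀ᶠ z in 𝓝 a, ‖trunc n' (X z)‖ < K :=
    ((hX _ (truncL n')).continuousAt.norm).eventually_lt continuousAt_const (by
      rw [truncL_apply, hK]; exact lt_add_one _)
  refine ⟨n', IsBigO.of_bound (C * 2 ^ (N + 1) * K) ?_⟩
  filter_upwards [hXK, cylinder_mem_nhds a n' (half_pos hδ)] with z hz1 hz2
  rw [Real.norm_of_nonneg (by positivity)]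
  -- The radius ρ / K keeps z + sX(z) at distance at most 2ρ from `a`, since K bounds the truncated
  -- field near `a`.
  have key : ∀ ρ, ‖trunc n' (z - a)‖ < ρ → ρ < δ / 2 →
      ‖lineDeriv ℂ f z (X z)‖ ≤ C * 2 ^ (N + 1) * K * ρ ^ N := by
    intro ρ h1 h2
    have hρ : 0 < ρ := (norm_nonneg _).trans_lt h1
    have h3 : ∀ s : ℂ, ‖s‖ ≤ ρ / K → ‖trunc n' (z + s • X z - a)‖ ≤ 2 * ρ := by
      intro s hs
      have : trunc n' (z + s • X z - a) = trunc n' (z - a) + s • trunc n' (X z) := by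
        simp only [← truncL_apply, ← map_smul, ← map_add]
        congr 1
        abel
      rw [this, two_mul]
      refine (norm_add_le _ _).trans (add_le_add h1.le ?_)
      rw [norm_smul]
      calc ‖s‖ * ‖trunc n' (X z)‖ ≤ ρ / K * K := by gcongr
        _ = ρ := div_mul_cancel₀ _ hK0.ne'
    have h4 : ∀ s : ℂ, ‖s‖ ≤ ρ / K → _ := fun s hs => hU _ ((h3 s hs).trans_lt (by linarith))
    have h5 : DifferentiableOn ℂ (fun s : ℂ => f (z + s • X z)) (Metric.closedBall 0 (ρ / K)) := by
      intro s hs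
      have h6 := (h4 s (by simpa using hs)).2.hasLineDerivAt (X z)
      have h7 := HasDerivAt.comp_sub_const s s
        (f := fun t : ℂ => f (z + s • X z + t • X z)) (by rw [sub_self]; exact h6)
      refine (h7.congr_of_eventuallyEq (Eventually.of_forall fun σ => ?_)).differentiableAt
        |>.differentiableWithinAt
      simp only [add_assoc, ← add_smul, add_sub_cancel]
    have h6 := Complex.norm_deriv_le_of_forall_mem_sphere_norm_le (C := C * (2 * ρ) ^ (N + 1))
      (div_pos hρ hK0) (h5.diffContOnCl_ball le_rfl) (by
        intro s hs
        rw [mem_sphere_zero_iff_norm] at hs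
        refine (h4 s hs.le).1.trans ?_
        rw [Real.norm_of_nonneg (by positivity)]
        gcongr
        exact (norm_trunc_mono hn' _).trans (h3 s hs.le))
    refine h6.trans (le_of_eq ?_)
    field_simp
    ring
  -- The distance may be zero while a disc needs a positive radius; the estimate is proved for
  -- larger ρ and passed to the limit.
  have hlim : Tendsto (fun ρ : ℝ => C * 2 ^ (N + 1) * K * ρ ^ N) (𝓝[>] ‖trunc n' (z - a)‖)
      (𝓝 (C * 2 ^ (N + 1) * K * ‖trunc n' (z - a)‖ ^ N)) := by
    refine Tendsto.mono_left (Continuous.tendsto ?_ _) nhdsWithin_le_nhds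
    fun_prop
  refine ge_of_tendsto hlim ?_
  filter_upwards [self_mem_nhdsWithin, mem_nhdsWithin_of_mem_nhds (Iio_mem_nhds hz2)] with ρ h1 h2
    using key ρ h1 h2

theorem VanishAt.apply_eq_zero {f : Jet m ℕ → E} {N : ℕ} (hf : VanishAt a f (N + 1)) : f a = 0 := by
  obtain ⟨hf, n, hn⟩ := hf
  obtain ⟨C, hC, hO⟩ := isBigO_iff'.1 hn
  have h := hO.self_of_nhds
  have h0 : trunc n (a - a) = 0 := by rw [sub_self, ← truncL_apply, map_zero]
  rw [h0] at h
  simpa using h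

theorem VanishAt.dIter [CompleteSpace E] {f : Jet m ℕ → E} {N : ℕ} (vs : List (Jet m ℕ))
    (hf : VanishAt a f (N + vs.length)) : VanishAt a (dIter vs f) N := by
  induction vs generalizing N with
  | nil => exact hf
  | cons v vs ih =>
    refine VanishAt.lie (X := fun _ => v) (ih ?_) (cylMapAt_const v a)
    rwa [List.length_cons, ← add_assoc, add_right_comm] at hf

theorem VanishAt.tcoeff_eq_zero [CompleteSpace E] {f : Jet m ℕ → E} {e : Expo m n} {N : ℕ}
    (hN : deg e < N) (hf : VanishAt a f N) : tcoeff a e f = 0 := by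
  obtain ⟨k, rfl⟩ := Nat.exists_eq_add_of_lt hN
  rw [← length_dirs] at hf
  rw [tcoeff, (VanishAt.dIter (N := k + 1) (dirs e) (by convert hf using 1; omega)).apply_eq_zero,
    smul_zero]

theorem norm_mono_le (a z : Jet m ℕ) (e : Expo m n) : ‖mono a e z‖ ≤ ‖trunc n (z - a)‖ ^ deg e := by
  rw [mono_eq_prod, norm_prod, deg, ← Finset.prod_pow_eq_pow_sum]
  refine Finset.prod_le_prod (fun _ _ => norm_nonneg _) fun c _ => ?_
  rw [norm_pow, ← co_sub, ← co_trunc]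
  gcongr
  exact norm_co_le _ _

theorem vanishAt_mono (e : Expo m n) : VanishAt a (mono a e) (deg e) := by
  refine ⟨cylAnalyticAt_mono e a, n, IsBigO.of_bound 1 (Eventually.of_forall fun z => ?_)⟩
  rw [one_mul, Real.norm_of_nonneg (by positivity)]
  exact norm_mono_le a z e

end Vanishing

/-! ### Taylor coefficients of monomials -/

section Monomials

variable {m n : ℕ} {a : Jet m ℕ}

theorem incr_injective (c : Coord m (Fin n)) : Function.Injective (incr c : Expo m n → Expo m n) :=
  fun _ _ h => expo.injective (add_right_cancel (expo.symm.injective h))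

theorem eq_incr_of_ne_zero {e : Expo m n} {c : Coord m (Fin n)} (h : expo e c ≠ 0) :
    ∃ e', e = incr c e' := by
  refine ⟨expo.symm (expo e - Pi.single c 1), expo.injective ?_⟩
  rw [expo_incr, Equiv.apply_symm_apply]
  funext c'
  by_cases hc : c' = c
  · subst hc
    simp only [Pi.add_apply, Pi.sub_apply, Pi.single_eq_same]
    omega
  · simp [Pi.single_eq_of_ne hc]

theorem deg_incr (c : Coord m (Fin n)) (e : Expo m n) : deg (incr c e) = deg e + 1 := by
  rw [deg, deg, expo_incr]
  simp [Finset.sum_add_distrib]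

theorem mono_incr (c : Coord m (Fin n)) (e : Expo m n) (z : Jet m ℕ) :
    mono a (incr c e) z = (co (up c) z - co (up c) a) * mono a e z := by
  rw [mono_eq_prod, mono_eq_prod, expo_incr]
  simp only [Pi.add_apply, pow_add, Finset.prod_mul_distrib]
  rw [mul_comm]
  congr 1
  rw [Finset.prod_eq_single c]
  · simp
  · intro c' _ hc'
    simp [Pi.single_eq_of_ne hc']
  · simp

theorem lineDeriv_mono_of_eq_zero {e : Expo m n} {c : Coord m (Fin n)} (h : expo e c = 0)
    (z : Jet m ℕ) : lineDeriv ℂ (mono a e) z (bv (up c)) = 0 := by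
  have : ∀ s : ℂ, mono a e (z + s • bv (up c)) = mono a e z := by
    intro s
    rw [mono_eq_prod, mono_eq_prod]
    refine Finset.prod_congr rfl fun c' _ => ?_
    by_cases hc : c' = c
    · rw [hc, h, pow_zero, pow_zero]
    · rw [co_add, co_smul, co_bv, if_neg fun h' => hc (up_injective h'), mul_zero, add_zero]
  simp [lineDeriv, this]

theorem lineDeriv_co (c : Coord m ℕ) (z v : Jet m ℕ) :
    lineDeriv ℂ (fun z => co c z) z v = co c v :=
  hasCylDeriv_of_clm (ContinuousLinearMap.id ℂ _) z v _ (coL c)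

theorem lineDeriv_mono_incr (c : Coord m (Fin n)) (e : Expo m n) (z : Jet m ℕ) :
    lineDeriv ℂ (mono a (incr c e)) z (bv (up c)) = ((expo e c + 1 : ℕ) : ℂ) * mono a e z := by
  have h1 : ∀ e : Expo m n, lineDeriv ℂ (mono a (incr c e)) z (bv (up c))
      = (co (up c) z - co (up c) a) * lineDeriv ℂ (mono a e) z (bv (up c)) + mono a e z := by
    intro e
    have h2 := lineDeriv_fun_smul ((cylAnalyticAt_clm (coL (up c)) z).sub
      (cylAnalyticAt_const (co (up c) a) z)) (cylAnalyticAt_mono (a := a) e z) (bv (up c))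
    rw [show mono a (incr c e) = _ from funext fun z => mono_incr c e z]
    refine h2.trans ?_
    rw [lineDeriv_fun_sub (cylAnalyticAt_clm (coL (up c)) z) (cylAnalyticAt_const _ z)]
    simp only [coL_apply]
    rw [lineDeriv_co, co_bv, if_pos rfl]
    simp [lineDeriv]
  induction hk : expo e c generalizing e with
  | zero => rw [h1, lineDeriv_mono_of_eq_zero hk]; simp
  | succ k ih =>
    obtain ⟨e', rfl⟩ := eq_incr_of_ne_zero (hk.trans_ne (Nat.succ_ne_zero k))
    rw [expo_incr, Pi.add_apply, Pi.single_eq_same] at hk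
    rw [h1, ih e' (by omega), mono_incr]
    push_cast
    ring

theorem tcoeff_of_deg_eq_zero {E : Type} [NormedAddCommGroup E] [NormedSpace ℂ E]
    {e : Expo m n} (h : deg e = 0) (f : Jet m ℕ → E) : tcoeff a e f = f a := by
  have h1 : dirs e = [] := List.eq_nil_of_length_eq_zero ((length_dirs e).trans h)
  have h2 : efact e = 1 := Finset.prod_eq_one fun c _ => by
    rw [Finset.sum_eq_zero_iff.1 h c (Finset.mem_univ c), Nat.factorial_zero]
  rw [tcoeff, h1, h2]
  simp [dIter]

/-- By induction on the degree: a nonzero entry of `e` is one derivative, which either annihilates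
the monomial or lowers both exponents by one; the integer factors cancel with the factorials. -/
theorem tcoeff_mono (e e' : Expo m n) : tcoeff a e (mono a e') = if e = e' then 1 else 0 := by
  induction hk : deg e generalizing e e' with
  | zero =>
    rw [tcoeff_of_deg_eq_zero hk, mono_eq_prod]
    have he : ∀ c, expo e c = 0 := fun c => Finset.sum_eq_zero_iff.1 hk c (Finset.mem_univ c)
    by_cases h : e = e'
    · subst h
      simp [he]
    · rw [if_neg h]
      obtain ⟨c, hc⟩ : ∃ c, expo e' c ≠ 0 := by
        by_contra! hcon
        exact h (expo.injective (funext fun c => (he c).trans (hcon c).symm))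
      exact Finset.prod_eq_zero (Finset.mem_univ c) (by rw [sub_self, zero_pow hc])
  | succ k ih =>
    obtain ⟨c, hc⟩ : ∃ c, expo e c ≠ 0 := by
      by_contra! hcon
      have := Finset.sum_eq_zero fun c (_ : c ∈ Finset.univ) => hcon c
      rw [deg, this] at hk
      omega
    obtain ⟨e, rfl⟩ := eq_incr_of_ne_zero hc
    rw [deg_incr] at hk
    have h1 := tcoeff_lineDeriv (cylAnalyticAt_mono (a := a) e' a) c e
    have h0 : ((expo e c + 1 : ℕ) : ℂ) ≠ 0 := Nat.cast_ne_zero.2 (Nat.succ_ne_zero _)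
    by_cases hc' : expo e' c = 0
    · simp only [lineDeriv_mono_of_eq_zero hc'] at h1
      rw [tcoeff_zero, eq_comm, smul_eq_zero, or_iff_right h0] at h1
      rw [h1, if_neg]
      rintro rfl
      exact hc hc'
    · obtain ⟨e', rfl⟩ := eq_incr_of_ne_zero hc'
      simp only [lineDeriv_mono_incr, ← smul_eq_mul] at h1
      have h2 := tcoeff_clm_comp (cylAnalyticAt_mono (a := a) e' a)
        (((expo e' c + 1 : ℕ) : ℂ) • ContinuousLinearMap.id ℂ ℂ) e
      simp only [smul_apply, ContinuousLinearMap.id_apply] at h2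
      rw [h2, ih e e' (by omega)] at h1
      by_cases hee : e = e'
      · subst hee
        rw [if_pos rfl]
        rw [if_pos rfl] at h1
        exact (smul_right_injective ℂ h0 h1).symm
      · rw [if_neg hee, smul_zero, eq_comm, smul_eq_zero, or_iff_right h0] at h1
        rw [h1, if_neg fun h => hee (incr_injective c h)]

end Monomials

/-! ### Power series in several variables -/

section PowerSeries

variable {ι : Type} [Fintype ι] [DecidableEq ι]

/-- The number of occurrences of the letters in a word. -/
def content (s : Σ k, Fin k → ι) (c : ι) : ℕ := (Finset.univ.filter fun i => s.2 i = c).card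

theorem sum_content (s : Σ k, Fin k → ι) : ∑ c, content s c = s.1 := by
  have := Finset.card_eq_sum_card_fiberwise (f := s.2) (s := Finset.univ) (t := Finset.univ)
    (fun _ _ => Finset.mem_coe.2 (Finset.mem_univ _))
  rw [Finset.card_fin] at this
  exact this.symm

instance finite_content_fiber (ε : ι → ℕ) : Finite {s : Σ k, Fin k → ι // content s = ε} := by
  refine Set.Finite.subset (Set.finite_range (Sigma.mk (β := fun k => Fin k → ι) (∑ c, ε c))) ?_
  rintro ⟨k, φ⟩ rfl
  have := sum_content (⟨k, φ⟩ : Σ k, Fin k → ι)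
  simp only at this
  rw [this]
  exact ⟨φ, rfl⟩

theorem prod_content (s : Σ k, Fin k → ι) (x : ι → ℂ) :
    ∏ i, x (s.2 i) = ∏ c, x c ^ content s c := by
  rw [← Finset.prod_fiberwise' Finset.univ s.2 x]
  simp [content, Finset.prod_const]

variable {Q : Type} [NormedAddCommGroup Q] [NormedSpace ℂ Q]
  {E : Type} [NormedAddCommGroup E] [NormedSpace ℂ E] [CompleteSpace E]

/-- An analytic function is the sum of a power series in the coordinates. -/
theorem exists_hasSum_monomials {f : Q → E} {p : FormalMultilinearSeries ℂ Q E} {y : Q}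
    {r : ENNReal} (hf : HasFPowerSeriesOnBall f p y r) {v : ι → Q} (hv : ∀ c, ‖v c‖ ≤ 1) :
    ∃ coef : (ι → ℕ) → E, ∀ x : ι → ℂ, ENNReal.ofReal (∑ c, ‖x c‖) < r →
      HasSum (fun ε : ι → ℕ => (∏ c, x c ^ ε c) • coef ε) (f (y + ∑ c, x c • v c)) := by
  -- Expanding p_k(∑ x_c v_c, …) by multilinearity gives one term for each word of length k in the
  -- letters c. The coefficient of a monomial collects the finitely many words with its content.
  refine ⟨fun ε => ∑' s : {s : Σ k, Fin k → ι // content s = ε}, p s.1.1 (v ∘ s.1.2),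
    fun x hx => ?_⟩
  set R : NNReal := ⟨∑ c, ‖x c‖, Finset.sum_nonneg fun _ _ => norm_nonneg _⟩ with hR
  have hRr : (R : ENNReal) < r := by
    rwa [ENNReal.ofReal_eq_coe_nnreal (Finset.sum_nonneg fun _ _ => norm_nonneg _)] at hx
  have hmem : (∑ c, x c • v c) ∈ Metric.eball (0 : Q) r := by
    rw [mem_eball_zero_iff]
    refine lt_of_le_of_lt ?_ hRr
    rw [enorm_eq_nnnorm, ENNReal.coe_le_coe, ← NNReal.coe_le_coe, coe_nnnorm]
    refine (norm_sum_le _ _).trans (Finset.sum_le_sum fun c _ => ?_)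
    rw [norm_smul]
    exact mul_le_of_le_one_right (norm_nonneg _) (hv c)
  have h1 := hf.hasSum hmem
  let t : (Σ k, Fin k → ι) → E := fun s => (∏ i, x (s.2 i)) • p s.1 (v ∘ s.2)
  have ht : ∀ s, ‖t s‖ ≤ (∏ i, ‖x (s.2 i)‖) * ‖p s.1‖ := by
    intro s
    rw [norm_smul, norm_prod]
    gcongr
    refine ((p s.1).le_opNorm _).trans (mul_le_of_le_one_right (norm_nonneg _) ?_)
    exact Finset.prod_le_one (fun _ _ => norm_nonneg _) fun i _ => hv _
  -- The terms of length k are bounded in total by (∑ ‖x_c‖)^k ‖p_k‖, whence the condition that ∑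
  -- ‖x_c‖ be less than r.
  have hsum : Summable t := by
    refine Summable.of_norm_bounded (g := fun s => (∏ i, ‖x (s.2 i)‖) * ‖p s.1‖) ?_ ht
    rw [summable_sigma_of_nonneg fun s => by positivity]
    refine ⟨fun k => Summable.of_finite, ?_⟩
    have h2 := p.summable_norm_mul_pow (hRr.trans_le hf.r_le)
    refine h2.congr fun k => ?_
    rw [tsum_fintype, mul_comm]
    change (∑ c, ‖x c‖) ^ k * ‖p k‖ = ∑ φ : Fin k → ι, (∏ i, ‖x (φ i)‖) * ‖p k‖
    rw [← Finset.sum_mul, Fintype.sum_pow (fun c => ‖x c‖)]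
  have h3 : HasSum t (f (y + ∑ c, x c • v c)) := by
    refine HasSum.sigma_of_hasSum h1 (fun k => ?_) hsum
    have h4 : p k (fun _ => ∑ c, x c • v c) = ∑ φ : Fin k → ι, t ⟨k, φ⟩ := by
      rw [(p k).map_sum]
      exact Finset.sum_congr rfl fun φ _ => (p k).map_smul_univ _ _
    rw [h4]
    exact hasSum_fintype _
  rw [← (Equiv.sigmaFiberEquiv (content (ι := ι))).hasSum_iff] at h3
  refine h3.sigma fun ε => ?_
  have h5 : HasSum (fun s : {s : Σ k, Fin k → ι // content s = ε} => p s.1.1 (v ∘ s.1.2)) _ :=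
    Summable.of_finite.hasSum
  convert h5.const_smul (∏ c, x c ^ ε c) using 1
  funext s
  change (∏ i, x (s.1.2 i)) • p s.1.1 (v ∘ s.1.2) = _
  rw [prod_content, s.2]

end PowerSeries

/-! ### Taylor expansion -/

section Taylor

variable {m n q : ℕ} {a : Jet m ℕ} {E : Type} [NormedAddCommGroup E] [NormedSpace ℂ E]
  [FiniteDimensional ℂ E]

/-- The Taylor polynomial of degree `N` with given coefficients approximates the sum of a power
series to the order `N + 1`. -/
theorem vanishAt_sub_sum {f : Jet m ℕ → E} (hf : CylAnalyticAt f a) {c : Expo m n → E}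
    (h : ∀ᶠ z in 𝓝 a, HasSum (fun e : Expo m n => mono a e z • c e) (f z)) (N : ℕ) :
    VanishAt a (fun z => f z - ∑ e ∈ (finite_deg_le m n N).toFinset, mono a e z • c e) (N + 1) := by
  refine ⟨hf.sub (CylAnalyticAt.sum _ fun e _ =>
    (cylAnalyticAt_mono e a).smul (cylAnalyticAt_const _ a)), ?_⟩
  obtain ⟨n', hn', δ, hδ, hU⟩ := exists_cylinder_subset h n
  have hδ2 : 0 < δ / 2 := half_pos hδ
  -- All coordinates of z₁ - a are δ/2, so the modulus of each monomial at z₁ is a power of δ/2.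
  -- Absolute convergence at this one point dominates the series on the smaller cylinder.
  let z₁ : Jet m ℕ := mkJet fun c => co c a + ((δ / 2 : ℝ) : ℂ)
  have hz₁ : ‖trunc n' (z₁ - a)‖ < δ := by
    refine lt_of_le_of_lt ((norm_le_iff_co hδ2.le).2 fun c => ?_) (half_lt_self hδ)
    rw [co_trunc, co_sub, co_mkJet, add_sub_cancel_left, Complex.norm_real,
      Real.norm_of_nonneg hδ2.le]
  have hm₁ : ∀ e : Expo m n, ‖mono a e z₁‖ = (δ / 2) ^ deg e := by
    intro e
    rw [mono_eq_prod, norm_prod, deg, ← Finset.prod_pow_eq_pow_sum]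
    refine Finset.prod_congr rfl fun c _ => ?_
    rw [co_mkJet, add_sub_cancel_left, norm_pow, Complex.norm_real, Real.norm_of_nonneg hδ2.le]
  have hs : Summable fun e : Expo m n => ‖mono a e z₁ • c e‖ := by
    have := FiniteDimensional.complexToReal E
    exact summable_norm_iff.2 (hU z₁ hz₁).summable
  refine ⟨n', Asymptotics.IsBigO.of_bound
    ((δ / 2)⁻¹ ^ (N + 1) * ∑' e : Expo m n, ‖mono a e z₁ • c e‖) ?_⟩
  filter_upwards [cylinder_mem_nhds a n' hδ2] with z hz
  have hz' : HasSum (fun e : Expo m n => mono a e z • c e) (f z) :=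
    hU z (hz.trans (half_lt_self hδ))
  have h1 : HasSum (fun e : Expo m n => if deg e ≤ N then mono a e z • c e else 0)
      (∑ e ∈ (finite_deg_le m n N).toFinset, mono a e z • c e) := by
    have := hasSum_sum_of_ne_finset_zero (L := SummationFilter.unconditional _) (s := (finite_deg_le m n N).toFinset)
      (f := fun e : Expo m n => if deg e ≤ N then mono a e z • c e else 0)
      (fun e he => if_neg (by simpa using he))
    rwa [Finset.sum_congr rfl fun e he => if_pos (by simpa using he)] at this
  have h2 := (hz'.sub h1).norm_le_of_bounded
    (hs.hasSum.mul_left ((‖trunc n' (z - a)‖ / (δ / 2)) ^ (N + 1))) (fun e => ?_)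
  · refine h2.trans (le_of_eq ?_)
    rw [Real.norm_of_nonneg (by positivity), div_eq_mul_inv, mul_pow]
    ring
  · split_ifs with he
    · rw [sub_self, norm_zero]
      positivity
    · rw [sub_zero, norm_smul, norm_smul, hm₁, ← mul_assoc]
      gcongr
      -- For terms of degree above N, comparison with z₁ gains at least N + 1 factors ‖trunc n' (z -
      -- a)‖ / (δ/2) ≤ 1.
      obtain ⟨k, hk⟩ := Nat.exists_eq_add_of_lt (not_le.1 he)
      calc ‖mono a e z‖ ≤ ‖trunc n' (z - a)‖ ^ deg e := (norm_mono_le a z e).trans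
            (by gcongr; exact norm_trunc_mono hn' _)
        _ = (‖trunc n' (z - a)‖ / (δ / 2)) ^ deg e * (δ / 2) ^ deg e := by
            rw [← mul_pow, div_mul_cancel₀ _ hδ2.ne']
        _ ≤ (‖trunc n' (z - a)‖ / (δ / 2)) ^ (N + 1) * (δ / 2) ^ deg e := by
            gcongr ?_ * _
            refine pow_le_pow_of_le_one (by positivity) ?_ (by omega)
            rw [div_le_one hδ2]
            exact hz.le

/-- The coefficients of a power series are the Taylor coefficients of its sum. -/
theorem tcoeff_eq_of_hasSum {f : Jet m ℕ → E} (hf : CylAnalyticAt f a) {c : Expo m n → E}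
    (h : ∀ᶠ z in 𝓝 a, HasSum (fun e : Expo m n => mono a e z • c e) (f z)) (e : Expo m n) :
    tcoeff a e f = c e := by
  have : CompleteSpace E := FiniteDimensional.complete ℂ E
  have hs : ∀ e' ∈ (finite_deg_le m n (deg e)).toFinset,
      CylAnalyticAt (fun z => mono a e' z • c e') a :=
    fun e' _ => (cylAnalyticAt_mono e' a).smul (cylAnalyticAt_const _ a)
  have h1 := (vanishAt_sub_sum hf h (deg e)).tcoeff_eq_zero (e := e) (Nat.lt_succ_self _)
  rw [tcoeff_sub hf (CylAnalyticAt.sum _ hs), tcoeff_sum _ hs, sub_eq_zero] at h1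
  rw [h1, Finset.sum_eq_single e]
  · rw [tcoeff_smul_const (cylAnalyticAt_mono e a), tcoeff_mono, if_pos rfl, one_smul]
  · intro e' _ hne
    rw [tcoeff_smul_const (cylAnalyticAt_mono e' a), tcoeff_mono, if_neg hne.symm, zero_smul]
  · intro he
    exact absurd ((finite_deg_le m n (deg e)).mem_toFinset.2 (le_refl (deg e))) he

/-- A function of the coordinates with `k < n` is the sum of its Taylor series. -/
theorem CylAnalyticAt.eventually_hasSum {f : Jet m ℕ × Fib q → E} {b : Fib q}
    (hf : CylAnalyticAt f (a, b))
    (h : ∀ᶠ y in 𝓝 (a, b), f y = f (reset (cols m n) a y.1, y.2)) :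
    ∀ᶠ y in 𝓝 (a, b), HasSum
      (fun e : Expo m n => mono a e y.1 • tcoeff a e (fun z => f (z, y.2))) (f y) := by
  have : CompleteSpace E := FiniteDimensional.complete ℂ E
  obtain ⟨f₀, hf₀, hff⟩ := hf.exists_eq_trunc h
  obtain ⟨p, r, hp⟩ := hf₀
  obtain ⟨r', hr'0, hr'⟩ := ENNReal.lt_iff_exists_nnreal_btwn.1 hp.r_pos
  have hr'0 : 0 < (r' : ℝ) := by exact_mod_cast hr'0
  let v : Coord m (Fin n) → Jet m (Fin n) × Fib q := fun c => (trunc n (bv (up c)), 0)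
  have hv : ∀ c, ‖v c‖ ≤ 1 := by
    intro c
    rw [Prod.norm_mk, norm_zero, max_eq_left (norm_nonneg _)]
    refine (norm_le_iff_co zero_le_one).2 fun c' => ?_
    rw [co_trunc, co_bv]
    split_ifs <;> simp
  have hsumv : ∀ (z : Jet m ℕ) (w : Fib q), (trunc n a, b) + (0, w - b)
      + ∑ c : Coord m (Fin n), (co (up c) z - co (up c) a) • v c = (trunc n z, w) := by
    intro z w
    have h1 : trunc n z = trunc n a + trunc n (z - a) := by
      rw [← truncL_apply, ← truncL_apply, ← truncL_apply, ← map_add, add_sub_cancel]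
    have h2 : trunc n (z - a)
        = ∑ c : Coord m (Fin n), (co (up c) z - co (up c) a) • trunc n (bv (up c)) := by
      rw [← trunc_extendL n (trunc n (z - a)), extendL_trunc_eq_sum, ← truncL_apply, map_sum]
      refine Finset.sum_congr rfl fun c _ => ?_
      rw [map_smul, truncL_apply, co_sub]
    refine Prod.ext ?_ ?_
    · rw [Prod.fst_add, Prod.fst_add, Prod.fst_sum, h1, h2]
      simp [v]
    · rw [Prod.snd_add, Prod.snd_add, Prod.snd_sum]
      simp [v]
  have hball : ∀ᶠ w in 𝓝 b, ‖w - b‖ < r' / 2 := by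
    refine (continuous_id.sub continuous_const).norm.continuousAt.eventually_lt
      continuousAt_const ?_
    simpa using hr'0
  have hz : ∀ᶠ z in 𝓝 a, ∑ c : Coord m (Fin n), ‖co (up c) z - co (up c) a‖ < r' / 2 := by
    refine ContinuousAt.eventually_lt (Continuous.continuousAt ?_) continuousAt_const ?_
    · exact continuous_finsetSum _ fun c _ => ((coL (up c)).continuous.sub continuous_const).norm
    · simpa using hr'0
  -- The series is recentred at (trunc n a, w). Splitting the radius r' in halves between w - b and
  -- z - a gives a domain in z that is the same for all these w.
  have key : ∀ w, ‖w - b‖ < r' / 2 → (∀ᶠ z in 𝓝 a, f (z, w) = f₀ (trunc n z, w)) →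
      CylAnalyticAt f (a, w) → ∀ z, ∑ c : Coord m (Fin n), ‖co (up c) z - co (up c) a‖ < r' / 2 →
        HasSum (fun e : Expo m n => mono a e z • tcoeff a e (fun z => f (z, w)))
          (f₀ (trunc n z, w)) := by
    intro w hw hfw hcw
    have hnorm : ‖((0 : Jet m (Fin n)), w - b)‖ = ‖w - b‖ := by
      rw [Prod.norm_mk, norm_zero, max_eq_right (norm_nonneg _)]
    have hlt : (‖((0 : Jet m (Fin n)), w - b)‖₊ : ENNReal) < r := by
      refine lt_trans ?_ hr'
      rw [ENNReal.coe_lt_coe, ← NNReal.coe_lt_coe, coe_nnnorm, hnorm]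
      linarith
    obtain ⟨coef, hcoef⟩ := exists_hasSum_monomials (hp.changeOrigin hlt) hv
    have h1 : ∀ z, ∑ c : Coord m (Fin n), ‖co (up c) z - co (up c) a‖ < r' / 2 →
        HasSum (fun e : Expo m n => mono a e z • coef (expo e)) (f₀ (trunc n z, w)) := by
      intro z hz
      have h2 := hcoef (fun c => co (up c) z - co (up c) a) (by
        refine lt_of_lt_of_le (b := ((r' : ENNReal) - ‖((0 : Jet m (Fin n)), w - b)‖₊)) ?_
          (tsub_le_tsub_right hr'.le _)
        rw [← ENNReal.coe_sub, ← ENNReal.ofReal_coe_nnreal, ENNReal.ofReal_lt_ofReal_iff_of_nonneg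
          (Finset.sum_nonneg fun _ _ => norm_nonneg _), NNReal.coe_sub (by
            rw [← NNReal.coe_le_coe, coe_nnnorm, hnorm]; linarith), coe_nnnorm, hnorm]
        linarith)
      rw [hsumv, ← expo.hasSum_iff] at h2
      convert h2 using 1
      funext e
      rw [mono_eq_prod]
      rfl
    intro z hz'
    have h3 : ∀ e : Expo m n, tcoeff a e (fun z => f (z, w)) = coef (expo e) := by
      intro e
      refine tcoeff_eq_of_hasSum (a := a) (f := fun z => f (z, w)) (c := fun e => coef (expo e))
        hcw.slice_left ?_ e
      filter_upwards [hfw, hz] with z h4 h5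
      rw [h4]
      exact h1 z h5
    simp only [h3]
    exact h1 z hz'
  have hff' : ∀ᶠ w in 𝓝 b, ∀ᶠ z in 𝓝 a, f (z, w) = f₀ (trunc n z, w) := by
    have h1 : Tendsto (fun w : Fib q => (a, w)) (𝓝 b) (𝓝 (a, b)) :=
      (Continuous.prodMk_right a).tendsto b
    filter_upwards [h1.eventually hff.eventually_nhds] with w hw
    exact (Continuous.prodMk_left w).continuousAt.eventually hw
  have hc' : ∀ᶠ w in 𝓝 b, CylAnalyticAt f (a, w) :=
    ((Continuous.prodMk_right a).tendsto b).eventually hf.eventually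
  filter_upwards [hff, (continuous_snd.tendsto (a, b)).eventually (hball.and (hff'.and hc')),
    (continuous_fst.tendsto (a, b)).eventually hz] with y h1 h2 h3
  rw [h1]
  exact key y.2 h2.1 h2.2.1 h2.2.2 y.1 h3

end Taylor

/-! ### Taylor coefficients of functions with parameters -/

section Parameters

variable {m n q : ℕ} {a : Jet m ℕ} {b : Fib q} {E : Type} [NormedAddCommGroup E] [NormedSpace ℂ E]

theorem dIter_slice (f : Jet m ℕ × Fib q → E) (w : Fib q) (vs : List (Jet m ℕ)) (z : Jet m ℕ) :
    dIter vs (fun z => f (z, w)) z = dIter (vs.map fun v => (v, (0 : Fib q))) f (z, w) := by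
  induction vs generalizing z with
  | nil => rfl
  | cons v vs ih =>
    rw [dIter_cons, List.map_cons, dIter_cons, show dIter vs (fun z => f (z, w)) = _ from funext ih]
    exact lineDeriv_slice (dIter (vs.map fun v => (v, (0 : Fib q))) f) (z, w) v

theorem eventually_slice {r : Jet m ℕ × Fib q → Prop} (h : ∀ᶠ y in 𝓝 (a, b), r y) :
    ∀ᶠ w in 𝓝 b, ∀ᶠ z in 𝓝 a, r (z, w) := by
  filter_upwards [((Continuous.prodMk_right a).tendsto b).eventually h.eventually_nhds] with w hw
  exact (Continuous.prodMk_left w).continuousAt.eventually hw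

theorem eventually_base {r : Jet m ℕ × Fib q → Prop} (h : ∀ᶠ y in 𝓝 (a, b), r y) :
    ∀ᶠ w in 𝓝 b, r (a, w) :=
  ((Continuous.prodMk_right a).tendsto b).eventually h

/-- Vanishing on the set where the coordinates outside `S` are those of `a`, in terms of Taylor
coefficients. -/
theorem eventually_tcoeff_eq_zero {f : Jet m ℕ × Fib q → E} {S : Set (Coord m ℕ)}
    (h : ∀ᶠ y in 𝓝 (a, b), (∀ c ∉ S, co c y.1 = co c a) → f y = 0) :
    ∀ᶠ w in 𝓝 b, ∀ e : Expo m n, (∀ c, up c ∉ S → expo e c = 0) →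
      tcoeff a e (fun z => f (z, w)) = 0 := by
  filter_upwards [eventually_slice ((tendsto_reset_prod S a b).eventually h)] with w hw e he
  have h1 : (fun z => f (reset S a z, w)) =ᶠ[𝓝 a] fun _ => 0 := by
    filter_upwards [hw] with z hz
    exact hz fun c hc => by rw [co_reset, if_neg hc]
  -- All directions of differentiation are tangent to the set where the coordinates outside `S` are
  -- fixed, so resetting these coordinates commutes with the derivatives.
  have h2 : ∀ v ∈ dirs e, ∀ c ∉ S, co c v = 0 := by
    intro v hv c hc
    rw [← Multiset.mem_coe, dirs_coe, Multiset.mem_sum] at hv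
    obtain ⟨c', -, hv⟩ := hv
    rw [Multiset.mem_replicate] at hv
    rw [hv.2, co_bv, if_neg]
    rintro rfl
    exact hv.1 (he c' hc)
  have h3 : ∀ vs : List (Jet m ℕ), (∀ v ∈ vs, ∀ c ∉ S, co c v = 0) → ∀ z,
      dIter vs (fun z => f (reset S a z, w)) z = dIter vs (fun z => f (z, w)) (reset S a z) := by
    intro vs
    induction vs with
    | nil => exact fun _ _ => rfl
    | cons v vs ih =>
      intro hvs z
      rw [dIter_cons, dIter_cons,
        show dIter vs (fun z => f (reset S a z, w)) = _ from
          funext (ih fun v hv => hvs v (List.mem_cons_of_mem _ hv))]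
      have h4 : ∀ s : ℂ, reset S a (z + s • v) = reset S a z + s • v := by
        intro s
        refine jet_ext fun c => ?_
        rw [co_reset, co_add, co_smul, co_add, co_smul, co_reset]
        split_ifs with hc
        · rfl
        · rw [hvs v List.mem_cons_self c hc, mul_zero, add_zero]
      simp only [lineDeriv, h4]
  have h4 := h3 (dirs e) h2 a
  rw [reset_self, (dIter_congr (dirs e) h1).self_of_nhds, dIter_zero] at h4
  rw [tcoeff, ← h4, smul_zero]

/-- In the Taylor series at such a point, each term has a zero coefficient or a factor from a
coordinate outside `S`, which is zero there. -/
theorem eventually_eq_zero_of_tcoeff [FiniteDimensional ℂ E] {f : Jet m ℕ × Fib q → E}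
    {S : Set (Coord m ℕ)} (hf : CylAnalyticAt f (a, b))
    (hn : ∀ᶠ y in 𝓝 (a, b), f y = f (reset (cols m n) a y.1, y.2))
    (h : ∀ᶠ w in 𝓝 b, ∀ e : Expo m n, (∀ c, up c ∉ S → expo e c = 0) →
      tcoeff a e (fun z => f (z, w)) = 0) :
    ∀ᶠ y in 𝓝 (a, b), (∀ c ∉ S, co c y.1 = co c a) → f y = 0 := by
  filter_upwards [hf.eventually_hasSum hn, (continuous_snd.tendsto (a, b)).eventually h]
    with y h1 h2 h3
  refine h1.unique ?_
  convert hasSum_zero using 1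
  funext e
  by_cases he : ∀ c, up c ∉ S → expo e c = 0
  · rw [h2 e he, smul_zero]
  · push Not at he
    obtain ⟨c, hc, hce⟩ := he
    rw [mono_eq_prod, Finset.prod_eq_zero (Finset.mem_univ c), zero_smul]
    rw [h3 _ hc, sub_self, zero_pow hce]

variable [CompleteSpace E]

theorem CylAnalyticAt.analyticAt_tcoeff {f : Jet m ℕ × Fib q → E} {w : Fib q}
    (hf : CylAnalyticAt f (a, w)) (e : Expo m n) :
    AnalyticAt ℂ (fun w => tcoeff a e fun z => f (z, w)) w := by
  simp only [tcoeff, dIter_slice]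
  exact analyticAt_const.smul (hf.dIter _).slice_right

/-- The derivative in the fiber, as a function on `ℰ × W`. -/
def fibDeriv (f : Jet m ℕ × Fib q → E) (y : Jet m ℕ × Fib q) : Fib q →L[ℂ] E :=
  fderiv ℂ (fun w => f (y.1, w)) y.2

theorem CylAnalyticAt.fibDeriv {f : Jet m ℕ × Fib q → E} {y : Jet m ℕ × Fib q}
    (hf : CylAnalyticAt f y) : CylAnalyticAt (fibDeriv f) y := by
  obtain ⟨V, _, _, L, f₀, h₀, h₁⟩ := hf
  let I : Fib q →L[ℂ] V := L.comp (ContinuousLinearMap.inr ℂ _ _)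
  have h2 : CylAnalyticAt (fun y => (ContinuousLinearMap.compL ℂ (Fib q) V E).flip I
      (fderiv ℂ f₀ (L y))) y :=
    (CylAnalyticAt.comp_analyticAt h₀.fderiv (cylAnalyticAt_clm L y)).clm_comp _
  refine h2.congr ?_
  filter_upwards [h₁.eventually_nhds, L.continuous.continuousAt.eventually h₀.eventually_analyticAt]
    with y' h3 h4
  ext1 ω
  have h5 : CylAnalyticAt f y' := ⟨V, _, _, L, f₀, h4, h3⟩
  rw [EvCov.fibDeriv, h5.fderiv_slice,
    (hasLineDerivAt_of_eventuallyEq h4.differentiableAt h3 _).lineDeriv]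
  rfl

/-- Fibre and jet derivatives commute. This allows brackets of coefficient fields to be read off
from the bracket of A and B. -/
theorem CylAnalyticAt.fderiv_tcoeff {f : Jet m ℕ × Fib q → E} {w : Fib q}
    (hf : CylAnalyticAt f (a, w)) (e : Expo m n) :
    fderiv ℂ (fun w => tcoeff a e fun z => f (z, w)) w
      = tcoeff a e fun z => EvCov.fibDeriv f (z, w) := by
  ext1 ω
  have h1 : CylAnalyticAt (fun z => EvCov.fibDeriv f (z, w)) a := hf.fibDeriv.slice_left
  have h2 := tcoeff_clm_comp h1 (ContinuousLinearMap.apply ℂ E ω) e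
  simp only [ContinuousLinearMap.apply_apply] at h2
  rw [← h2]
  have h3 : (fun z => EvCov.fibDeriv f (z, w) ω) =ᶠ[𝓝 a] fun z => lineDeriv ℂ f (z, w) (0, ω) := by
    filter_upwards [(Continuous.prodMk_left w).continuousAt.eventually hf.eventually] with z hz
      using hz.fderiv_slice ω
  rw [tcoeff_congr h3]
  simp only [tcoeff, dIter_slice]
  rw [dIter_slice (fun y => lineDeriv ℂ f y (0, ω))]
  set vs := (dirs e).map fun v => (v, (0 : Fib q)) with hvs
  have h4 := hf.dIter vs
  have h5 := h4.slice_right.differentiableAt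
  rw [fderiv_fun_const_smul h5, smul_apply, h4.fderiv_slice]
  congr 1
  have h6 : ((0, ω) :: vs).Perm (vs ++ [(0, ω)]) := (List.perm_append_singleton _ _).symm
  have h7 := (dIter_perm hf h6).self_of_nhds
  rw [dIter_append] at h7
  exact h7

end Parameters

/-! ### Taylor coefficients of derivatives and products -/

section Expansion

variable {m n n' n'' : ℕ} {a : Jet m ℕ} {E : Type} [NormedAddCommGroup E] [NormedSpace ℂ E]
  [FiniteDimensional ℂ E] {E' : Type} [NormedAddCommGroup E'] [NormedSpace ℂ E']
  [FiniteDimensional ℂ E'] {E'' : Type} [NormedAddCommGroup E''] [NormedSpace ℂ E'']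
  [CompleteSpace E'']

/-- Replacing `f` by its Taylor polynomial of degree N makes an error of order N + 1, hence of order
N after differentiation, which does not affect coefficients of degree less than N. No series is
differentiated termwise. -/
theorem tcoeff_lie_of_hasSum {f : Jet m ℕ → E} (hf : CylAnalyticAt f a) {c : Expo m n → E}
    (h : ∀ᶠ z in 𝓝 a, HasSum (fun e : Expo m n => mono a e z • c e) (f z))
    {X : Jet m ℕ → Jet m ℕ} (hX : CylMapAt X a) {e : Expo m n'} {N : ℕ} (hN : deg e < N) :
    tcoeff a e (fun z => lineDeriv ℂ f z (X z))
      = ∑ e' ∈ (finite_deg_le m n N).toFinset,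
        tcoeff a e (fun z => lineDeriv ℂ (mono a e') z (X z)) • c e' := by
  have : CompleteSpace E := FiniteDimensional.complete ℂ E
  set s := (finite_deg_le m n N).toFinset
  have hs : ∀ z, ∀ e' ∈ s, CylAnalyticAt (fun z => mono a e' z • c e') z :=
    fun z e' _ => (cylAnalyticAt_mono e' z).smul (cylAnalyticAt_const _ z)
  have h1 := ((vanishAt_sub_sum hf h N).lie hX).tcoeff_eq_zero hN
  have h2 : (fun z => lineDeriv ℂ (fun z => f z - ∑ e' ∈ s, mono a e' z • c e') z (X z))
      =ᶠ[𝓝 a] fun z => lineDeriv ℂ f z (X z)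
        - ∑ e' ∈ s, lineDeriv ℂ (mono a e') z (X z) • c e' := by
    filter_upwards [hf.eventually] with z hz
    rw [lineDeriv_fun_sub hz (CylAnalyticAt.sum s (hs z))]
    congr 1
    refine HasLineDerivAt.lineDeriv ?_
    unfold HasLineDerivAt
    exact HasDerivAt.fun_sum fun e' _ =>
      HasDerivAt.smul_const ((cylAnalyticAt_mono e' z).hasLineDerivAt (X z)) (c e')
  have h3 : ∀ e' ∈ s, CylAnalyticAt (fun z => lineDeriv ℂ (mono a e') z (X z) • c e') a :=
    fun e' _ => ((cylAnalyticAt_mono e' a).lie hX).smul (cylAnalyticAt_const _ a)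
  rw [tcoeff_congr h2, tcoeff_sub (hf.lie hX) (CylAnalyticAt.sum s h3), sub_eq_zero] at h1
  rw [h1, tcoeff_sum _ h3]
  exact Finset.sum_congr rfl fun e' _ => tcoeff_smul_const ((cylAnalyticAt_mono e' a).lie hX) _ e

/-- Each factor is replaced in turn by its Taylor polynomial of degree N. The two errors vanish to
order N + 1, since the remaining factor is at least bounded. -/
theorem tcoeff_bilin_of_hasSum {f : Jet m ℕ → E} (hf : CylAnalyticAt f a) {c : Expo m n → E}
    (h : ∀ᶠ z in 𝓝 a, HasSum (fun e : Expo m n => mono a e z • c e) (f z))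
    {f' : Jet m ℕ → E'} (hf' : CylAnalyticAt f' a) {c' : Expo m n' → E'}
    (h' : ∀ᶠ z in 𝓝 a, HasSum (fun e : Expo m n' => mono a e z • c' e) (f' z))
    (T : E →L[ℂ] E' →L[ℂ] E'') {e : Expo m n''} {N : ℕ} (hN : deg e < N + 1) :
    tcoeff a e (fun z => T (f z) (f' z))
      = ∑ s ∈ (finite_deg_le m n N).toFinset ×ˢ (finite_deg_le m n' N).toFinset,
        tcoeff a e (fun z => mono a s.1 z * mono a s.2 z) • T (c s.1) (c' s.2) := by
  set S := (finite_deg_le m n N).toFinset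
  set S' := (finite_deg_le m n' N).toFinset
  have hP : CylAnalyticAt (fun z => ∑ e ∈ S, mono a e z • c e) a :=
    CylAnalyticAt.sum S fun e _ => (cylAnalyticAt_mono e a).smul (cylAnalyticAt_const _ a)
  have h1 := (vanishAt_sub_sum hf h N).bilin hf'.vanishAt_zero T
  have h2 := hP.vanishAt_zero.bilin (vanishAt_sub_sum hf' h' N) T
  rw [add_zero] at h1
  rw [zero_add] at h2
  have hmm : ∀ s : Expo m n × Expo m n', CylAnalyticAt (fun z => mono a s.1 z * mono a s.2 z) a :=
    fun s => (cylAnalyticAt_mono s.1 a).mul (cylAnalyticAt_mono s.2 a)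
  have h3 : ∀ s ∈ S ×ˢ S', CylAnalyticAt
      (fun z => (mono a s.1 z * mono a s.2 z) • T (c s.1) (c' s.2)) a :=
    fun s _ => (hmm s).smul (cylAnalyticAt_const _ a)
  have h4 : (fun z => T (f z) (f' z)) = fun z => (T (f z - ∑ e ∈ S, mono a e z • c e) (f' z)
      + T (∑ e ∈ S, mono a e z • c e) (f' z - ∑ e ∈ S', mono a e z • c' e))
      + ∑ s ∈ S ×ˢ S', (mono a s.1 z * mono a s.2 z) • T (c s.1) (c' s.2) := by
    funext z
    have h5 : ∑ s ∈ S ×ˢ S', (mono a s.1 z * mono a s.2 z) • T (c s.1) (c' s.2)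
        = T (∑ e ∈ S, mono a e z • c e) (∑ e ∈ S', mono a e z • c' e) := by
      rw [Finset.sum_product, map_sum T, sum_apply]
      refine Finset.sum_congr rfl fun e _ => ?_
      rw [map_sum]
      refine Finset.sum_congr rfl fun e' _ => ?_
      rw [map_smul, map_smul, smul_apply, smul_smul, mul_comm]
    rw [h5, map_sub, map_sub, sub_apply]
    abel
  rw [h4, tcoeff_add (h1.add h2).1 (CylAnalyticAt.sum _ h3), (h1.add h2).tcoeff_eq_zero hN,
    zero_add, tcoeff_sum _ h3]
  exact Finset.sum_congr rfl fun s _ => tcoeff_smul_const (hmm s) _ e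

end Expansion

/-! ### Normal coverings in terms of Taylor coefficients -/

section NormalCoefficients

variable {m d q : ℕ} {a : Jet m ℕ} {b : Fib q} {A B : Jet m ℕ × Fib q → Fib q}

/-- The vanishing of those coefficients that are generators of the ideal `𝔍`. -/
structure CoeffNormal {V : Type} [Zero V] (p : ℕ) (α : Expo m (p + 1) → V)
    (β : Expo m (p + d) → V) : Prop where
  A_zero : ∀ l₁ l₂, α (l₁, l₂, 0) = 0
  B_zero : ∀ l₂, β (0, l₂, 0) = 0
  A_special : ∀ (l₁ l₂ : ℕ) (i₀ : Fin m) (k₀ : Fin (p + 1)), 1 ≤ (k₀ : ℕ) →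
    ∀ γ ∈ specialM p i₀ k₀, α (l₁, l₂, γ) = 0

theorem rank_lt_rank_u {i i' : Fin m} {k k' : ℕ} :
    rank (some (some (i, k)) : Coord m ℕ) < rank (some (some (i', k')) : Coord m ℕ) ↔
      k < k' ∨ k = k' ∧ i < i' := by
  have hi := i.2
  have hi' := i'.2
  simp only [rank, Fin.lt_def]
  rcases lt_trichotomy k k' with h | rfl | h
  · have : (k + 1) * m ≤ k' * m := Nat.mul_le_mul_right m h
    rw [Nat.succ_mul] at this
    constructor
    · exact fun _ => Or.inl h
    · intro _
      omega
  · omega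
  · have : (k' + 1) * m ≤ k * m := Nat.mul_le_mul_right m h
    rw [Nat.succ_mul] at this
    constructor
    · intro _
      omega
    · rintro (h' | h')
      · omega
      · omega

/-- The matrices in `specialM` are u^{i₀}_{k+1} times the monomials in coordinates up to u^{i₀}_k in
the order of `rank`. Hence the coefficients of A that they index are, up to integer factors, those
of ∂A/∂u^{i₀}_{k+1} on the set where the coordinates after u^{i₀}_k are those of `a`. -/
theorem incr_mem_specialM_iff {p k : ℕ} (hk : k + 1 < p + 1) (i₀ : Fin m) (e : Expo m (p + 1)) :
    (incr (some (some (i₀, ⟨k + 1, hk⟩))) e).2.2 ∈ specialM p i₀ ⟨k + 1, hk⟩ ↔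
      ∀ c, rank (some (some (i₀, k)) : Coord m ℕ) < rank (up c) → expo e c = 0 := by
  have h1 : ∀ i k', (incr (some (some (i₀, ⟨k + 1, hk⟩))) e).2.2 i k' = expo e (some (some (i, k')))
      + if i = i₀ ∧ k' = ⟨k + 1, hk⟩ then 1 else 0 := by
    intro i k'
    change expo (incr (some (some (i₀, ⟨k + 1, hk⟩))) e) (some (some (i, k'))) = _
    rw [expo_incr, Pi.add_apply, Pi.single_apply]
    simp only [Option.some.injEq, Prod.mk.injEq]
  simp only [specialM, Set.mem_ofPred_eq, h1]
  constructor
  · rintro ⟨h2, h3, h4, h5⟩ c hc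
    rcases c with _ | _ | ⟨i, k'⟩
    · simp [rank, up] at hc
    · simp [rank, up] at hc
    · have hc' : k < (k' : ℕ) ∨ k = (k' : ℕ) ∧ i₀ < i := rank_lt_rank_u.1 hc
      rcases hc' with hc' | ⟨hc', hi⟩
      · rcases Nat.lt_or_ge (k + 1) k' with hlt | hge
        · exact (Nat.add_eq_zero_iff.1 (h3 k' hlt i)).1
        · have hkk : k' = ⟨k + 1, hk⟩ := Fin.ext (le_antisymm hge hc')
          subst hkk
          by_cases hi : i = i₀
          · subst hi
            simpa using h2
          · exact (Nat.add_eq_zero_iff.1 (h4 i hi)).1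
      · exact (Nat.add_eq_zero_iff.1 (h5 i hi k' (by simp [hc']))).1
  · intro h
    have h' : ∀ (i : Fin m) (k' : Fin (p + 1)), k < (k' : ℕ) ∨ k = (k' : ℕ) ∧ i₀ < i →
        expo e (some (some (i, k'))) = 0 := fun i k' h2 => h _ (rank_lt_rank_u.2 h2)
    refine ⟨?_, fun k' hk' i => ?_, fun i hi => ?_, fun i hi k' hk' => ?_⟩
    · rw [h' i₀ ⟨k + 1, hk⟩ (Or.inl (Nat.lt_succ_self k)), if_pos (by simp)]
    · rw [h' i k' (Or.inl (lt_trans (Nat.lt_succ_self k) (Fin.lt_def.1 hk'))),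
        if_neg fun h => hk'.ne' h.2]
    · rw [h' i _ (Or.inl (Nat.lt_succ_self k)), if_neg fun h => hi h.1]
    · have hkk : k = (k' : ℕ) := by omega
      rw [h' i k' (Or.inr ⟨hkk, hi⟩), if_neg fun h => hi.ne' h.1]

theorem NormalAt.eventually_tcoeff {n : ℕ} {c : Coord m ℕ} (h : NormalAt a b A B c) :
    ∀ᶠ w in 𝓝 b, ∀ e : Expo m n, (∀ c', rank c < rank (up c') → expo e c' = 0) →
      tcoeff a e (fun z => Phi A B c (z, w)) = 0 := by
  have := eventually_tcoeff_eq_zero (n := n) (S := {c' | rank c' ≤ rank c}) (f := Phi A B c)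
    (a := a) (b := b) (by simpa only [NormalAt, Set.mem_ofPred_eq, not_le] using h)
  simpa only [Set.mem_ofPred_eq, not_le] using this

theorem eventually_coeffNormal (p : ℕ) (hA : CylAnalyticAt A (a, b))
    (hn : ∀ c, NormalAt a b A B c) :
    ∀ᶠ w in 𝓝 b, CoeffNormal (d := d) p (fun e => tcoeff a e fun z => A (z, w))
      (fun e => tcoeff a e fun z => B (z, w)) := by
  have h1 : ∀ᶠ w in 𝓝 b, ∀ (i : Fin m) (k : Fin p), ∀ e : Expo m (p + 1),
      (∀ c', rank (some (some (i, (k : ℕ)))) < rank (up c') → expo e c' = 0) →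
      tcoeff a e (fun z => Phi A B (some (some (i, (k : ℕ)))) (z, w)) = 0 :=
    eventually_all.2 fun i => eventually_all.2 fun k => (hn _).eventually_tcoeff
  filter_upwards [(hn none).eventually_tcoeff (n := p + 1),
    (hn (some none)).eventually_tcoeff (n := p + d), h1, eventually_base hA.eventually]
    with w h2 h3 h4 h5
  refine ⟨fun l₁ l₂ => h2 _ fun c hc => ?_, fun l₂ => h3 _ fun c hc => ?_,
    fun l₁ l₂ i₀ k₀ hk₀ γ hγ => ?_⟩
  · rcases c with _ | _ | ⟨i, k⟩
    · simp [rank, up] at hc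
    · simp [rank, up] at hc
    · rfl
  · rcases c with _ | _ | ⟨i, k⟩
    · rfl
    · simp [rank, up] at hc
    · rfl
  · obtain ⟨k₀, hk⟩ := k₀
    obtain ⟨k, rfl⟩ : ∃ k, k₀ = k + 1 := ⟨k₀ - 1, by simp only at hk₀; omega⟩
    obtain ⟨e, he⟩ : ∃ e, ((l₁, l₂, γ) : Expo m (p + 1)) = incr (some (some (i₀, ⟨k + 1, hk⟩))) e := by
      refine eq_incr_of_ne_zero (ne_of_eq_of_ne ?_ one_ne_zero)
      exact hγ.1
    have hγ' : (incr (some (some (i₀, ⟨k + 1, hk⟩))) e).2.2 ∈ specialM p i₀ ⟨k + 1, hk⟩ := by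
      rw [← he]
      exact hγ
    have h6 := h4 i₀ ⟨k, by omega⟩ e ((incr_mem_specialM_iff hk i₀ e).1 hγ')
    have h7 := tcoeff_lineDeriv (f := fun z => A (z, w)) h5.slice_left
      (some (some (i₀, ⟨k + 1, hk⟩))) e
    rw [← he] at h7
    have h8 : (fun z => Phi A B (some (some (i₀, k))) (z, w))
        = fun z => lineDeriv ℂ (fun z => A (z, w)) z (bv (up (some (some (i₀, ⟨k + 1, hk⟩))))) :=
      funext fun z => (lineDeriv_slice A (z, w) _).symm
    simp only at h6
    rw [h8, h7, smul_eq_zero] at h6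
    exact h6.resolve_left (Nat.cast_ne_zero.2 (Nat.succ_ne_zero _))

/-- The hypotheses on the columns ensure that the Taylor series represent A and B, so that vanishing
coefficients give vanishing functions. For u^i_k with k ≥ p the component Φ is zero outright. -/
theorem normalAt_of_coeffNormal {p : ℕ} (hA : CylAnalyticAt A (a, b)) (hB : CylAnalyticAt B (a, b))
    (hA' : ∀ᶠ y in 𝓝 (a, b), ∀ c ∉ cols m (p + 1), lineDeriv ℂ A y (bv c, 0) = 0)
    (hB' : ∀ᶠ y in 𝓝 (a, b), ∀ c ∉ cols m (p + d), lineDeriv ℂ B y (bv c, 0) = 0)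
    (h : ∀ᶠ w in 𝓝 b, CoeffNormal (d := d) p (fun e => tcoeff a e fun z => A (z, w))
      (fun e => tcoeff a e fun z => B (z, w))) (c : Coord m ℕ) : NormalAt a b A B c := by
  have key : ∀ n, (∀ᶠ y in 𝓝 (a, b), Phi A B c y = Phi A B c (reset (cols m n) a y.1, y.2)) →
      (∀ᶠ w in 𝓝 b, ∀ e : Expo m n, (∀ c', rank c < rank (up c') → expo e c' = 0) →
        tcoeff a e (fun z => Phi A B c (z, w)) = 0) → NormalAt a b A B c := by
    intro n h1 h2
    have := eventually_eq_zero_of_tcoeff (S := {c' | rank c' ≤ rank c}) (hA.phi hB c) h1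
      (by simpa only [Set.mem_ofPred_eq, not_le] using h2)
    simpa only [NormalAt, Set.mem_ofPred_eq, not_le] using this
  rcases c with _ | _ | ⟨i, k⟩
  · refine key (p + 1) (hA.eventually_eq_reset hA') ?_
    filter_upwards [h] with w hw e he
    have : e = (e.1, e.2.1, 0) := Prod.ext rfl (Prod.ext rfl (funext fun i => funext fun k =>
      he (some (some (i, k))) (by simp only [rank, up, Option.map_some]; omega)))
    rw [this]
    exact hw.A_zero _ _
  · refine key (p + d) (hB.eventually_eq_reset hB') ?_
    filter_upwards [h] with w hw e he
    have : e = (0, e.2.1, 0) := Prod.ext (he none (by simp [rank, up]))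
      (Prod.ext rfl (funext fun i => funext fun k =>
        he (some (some (i, k))) (by simp only [rank, up, Option.map_some]; omega)))
    rw [this]
    exact hw.B_zero _
  · by_cases hk : k + 1 < p + 1
    · have hA'' : ∀ᶠ y in 𝓝 (a, b), ∀ c ∉ cols m (p + 1),
          lineDeriv ℂ (Phi A B (some (some (i, k)))) y (bv c, 0) = 0 := by
        filter_upwards [hA'.eventually_nhds, hA.eventually] with y hy hAy c hc
        have h1 : (fun y => lineDeriv ℂ A y (bv c, 0)) =ᶠ[𝓝 y] fun _ => 0 :=
          hy.mono fun y' hy' => hy' c hc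
        refine (hAy.lineDeriv_comm (eu i (k + 1), 0) (bv c, 0)).trans ?_
        rw [lineDeriv_congr h1]
        exact deriv_const _ _
      refine key (p + 1) ((hA.phi hB _).eventually_eq_reset hA'') ?_
      filter_upwards [h, eventually_base hA.eventually] with w hw hAw e he
      have h7 := tcoeff_lineDeriv (f := fun z => A (z, w)) hAw.slice_left
        (some (some (i, ⟨k + 1, hk⟩))) e
      have h8 : (fun z => Phi A B (some (some (i, k))) (z, w))
          = fun z => lineDeriv ℂ (fun z => A (z, w)) z (bv (up (some (some (i, ⟨k + 1, hk⟩))))) :=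
        funext fun z => (lineDeriv_slice A (z, w) _).symm
      simp only at h7
      rw [h8, h7, hw.A_special _ _ i ⟨k + 1, hk⟩ (Nat.succ_le_succ (Nat.zero_le k)) _
        ((incr_mem_specialM_iff hk i e).2 he), smul_zero]
    · filter_upwards [hA'] with y hy _
      exact hy (some (some (i, k + 1))) fun h => hk (mem_cols_u.1 h)

end NormalCoefficients

/-! ### The action that belongs to a normal covering -/

section FormalCovering

variable {m d q : ℕ} {p : ℕ} {F : Jet m (Fin (d + 1)) → Fin m → ℂ} {a : Jet m ℕ} {b : Fib q}
  {A B : Jet m ℕ × Fib q → Fib q}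

theorem finsum_eq_sum_of_deg {n : ℕ} {M : Type*} [AddCommMonoid M] {N : ℕ} {f : Expo m n → M}
    (h : ∀ e, N < deg e → f e = 0) :
    ∑ᶠ e, f e = ∑ e ∈ (finite_deg_le m n N).toFinset, f e := by
  refine finsum_eq_sum_of_support_subset f fun e he => ?_
  rw [Set.Finite.coe_toFinset]
  exact not_lt.1 fun hlt => he (h e hlt)

/-- The value of `∑ᶠ` would be zero for infinite support. Here the support is finite: a monomial of
degree above N still vanishes to order at least N after one derivative, and N exceeds the degree of
`e`. -/
theorem elemZ_eq_sum (hF : AnalyticAt ℂ F (trunc (d + 1) a)) (e : Expo m (p + d + 1)) {N : ℕ}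
    (hN : deg e < N) :
    elemZ p F a e
      = (∑ β ∈ (finite_deg_le m (p + d) N).toFinset,
          tcoeff a e (fun z => lineDeriv ℂ (mono a β) z (xField z)) • symB p β)
        - (∑ α ∈ (finite_deg_le m (p + 1) N).toFinset,
          tcoeff a e (fun z => lineDeriv ℂ (mono a α) z (tField F z)) • symA p α)
        + ∑ s ∈ (finite_deg_le m (p + 1) N).toFinset ×ˢ (finite_deg_le m (p + d) N).toFinset,
          tcoeff a e (fun z => mono a s.1 z * mono a s.2 z) • ⁅symA (d := d) p s.1, symB p s.2⁆ := by
  have hlie : ∀ {n : ℕ} (e' : Expo m n) {X : Jet m ℕ → Jet m ℕ}, CylMapAt X a → N < deg e' →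
      tcoeff a e (fun z => lineDeriv ℂ (mono a e') z (X z)) = 0 := by
    intro n e' X hX he'
    obtain ⟨k, hk⟩ := Nat.exists_eq_add_of_lt he'
    have h1 := vanishAt_mono (a := a) e'
    rw [hk] at h1
    exact (h1.lie hX).tcoeff_eq_zero (by omega)
  rw [elemZ]
  simp only [taylorCoeff_eq]
  congr 1
  · congr 1
    · exact finsum_eq_sum_of_deg fun β hβ => by
        have := hlie β (cylMapAt_xField a) hβ
        rw [show (Dx (mono a β)) = fun z => lineDeriv ℂ (mono a β) z (xField z) from rfl, this,
          zero_smul]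
    · exact finsum_eq_sum_of_deg fun α hα => by
        have := hlie α (cylMapAt_tField hF) hα
        rw [show (Dt F (mono a α)) = fun z => lineDeriv ℂ (mono a α) z (tField F z) from rfl, this,
          zero_smul]
  · refine finsum_eq_sum_of_support_subset _ fun s hs => ?_
    rw [Finset.coe_product, Set.Finite.coe_toFinset, Set.Finite.coe_toFinset]
    by_contra hcon
    refine hs ?_
    have h1 := (vanishAt_mono (a := a) s.1).bilin (vanishAt_mono (a := a) s.2)
      (ContinuousLinearMap.mul ℂ ℂ)
    have h2 : N < deg s.1 + deg s.2 := by
      by_contra h3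
      exact hcon ⟨(Nat.le_add_right _ _).trans (not_lt.1 h3),
        (Nat.le_add_left _ _).trans (not_lt.1 h3)⟩
    have h3 : tcoeff a e (fun z => mono a s.1 z * mono a s.2 z) = 0 :=
      h1.tcoeff_eq_zero (hN.trans h2)
    simp only [h3, zero_smul]

/-- The coefficients of the equation `D_x(B) - D_t(A) + [A, B] = 0`. -/
theorem eventually_coeff_covering (hF : AnalyticAt ℂ F (trunc (d + 1) a))
    (hcov : IsCoveringAt F A B (a, b))
    (hA' : ∀ᶠ y in 𝓝 (a, b), A y = A (reset (cols m (p + 1)) a y.1, y.2))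
    (hB' : ∀ᶠ y in 𝓝 (a, b), B y = B (reset (cols m (p + d)) a y.1, y.2)) :
    ∀ᶠ w in 𝓝 b, ∀ (e : Expo m (p + d + 1)) (N : ℕ), deg e < N →
      (∑ β ∈ (finite_deg_le m (p + d) N).toFinset,
          tcoeff a e (fun z => lineDeriv ℂ (mono a β) z (xField z)) • tcoeff a β fun z => B (z, w))
        - (∑ α ∈ (finite_deg_le m (p + 1) N).toFinset,
          tcoeff a e (fun z => lineDeriv ℂ (mono a α) z (tField F z)) • tcoeff a α fun z => A (z, w))
        + ∑ s ∈ (finite_deg_le m (p + 1) N).toFinset ×ˢ (finite_deg_le m (p + d) N).toFinset,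
          tcoeff a e (fun z => mono a s.1 z * mono a s.2 z) •
            VectorField.lieBracket ℂ (fun w => tcoeff a s.1 fun z => A (z, w))
              (fun w => tcoeff a s.2 fun z => B (z, w)) w = 0 := by
  have hA : CylAnalyticAt A (a, b) := jetAnalyticAt_iff.1 hcov.1
  have hB : CylAnalyticAt B (a, b) := jetAnalyticAt_iff.1 hcov.2.1
  have hfib : ∀ {n : ℕ} {f : Jet m ℕ × Fib q → Fib q},
      (∀ᶠ y in 𝓝 (a, b), f y = f (reset (cols m n) a y.1, y.2)) →
      ∀ᶠ y in 𝓝 (a, b), fibDeriv f y = fibDeriv f (reset (cols m n) a y.1, y.2) := by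
    intro n f hf
    filter_upwards [hf.eventually_nhds] with y hy
    refine Filter.EventuallyEq.fderiv_eq ?_
    exact (Continuous.prodMk_right y.1).continuousAt.eventually hy
  filter_upwards [eventually_slice (hA.eventually_hasSum hA'),
    eventually_slice (hB.eventually_hasSum hB'),
    eventually_slice (hA.fibDeriv.eventually_hasSum (hfib hA')),
    eventually_slice (hB.fibDeriv.eventually_hasSum (hfib hB')),
    eventually_slice hcov.2.2, eventually_base hA.eventually, eventually_base hB.eventually]
    with w sA sB sA' sB' hw cA cB e N hN
  have kA : CylAnalyticAt (fun z => A (z, w)) a := cA.slice_left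
  have kB : CylAnalyticAt (fun z => B (z, w)) a := cB.slice_left
  have kA' : CylAnalyticAt (fun z => fibDeriv A (z, w)) a := cA.fibDeriv.slice_left
  have kB' : CylAnalyticAt (fun z => fibDeriv B (z, w)) a := cB.fibDeriv.slice_left
  have h1 := tcoeff_lie_of_hasSum kB sB (cylMapAt_xField a) hN
  have h2 := tcoeff_lie_of_hasSum kA sA (cylMapAt_tField hF) hN
  -- The bracket is B_w A - A_w B, two bilinear expressions in functions with known Taylor series.
  have h3 := tcoeff_bilin_of_hasSum kA sA kB' sB' (ContinuousLinearMap.apply ℂ (Fib q))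
    (hN.trans (Nat.lt_succ_self N))
  have h4 := tcoeff_bilin_of_hasSum kA' sA' kB sB
    (ContinuousLinearMap.id ℂ (Fib q →L[ℂ] Fib q)) (hN.trans (Nat.lt_succ_self N))
  have c3 : CylAnalyticAt (fun z => fibDeriv B (z, w) (A (z, w))) a :=
    (kA.vanishAt_zero.bilin kB'.vanishAt_zero (ContinuousLinearMap.apply ℂ (Fib q))).1
  have c4 : CylAnalyticAt (fun z => fibDeriv A (z, w) (B (z, w))) a :=
    (kA'.vanishAt_zero.bilin kB.vanishAt_zero
      (ContinuousLinearMap.id ℂ (Fib q →L[ℂ] Fib q))).1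
  have h5 := tcoeff_congr (g := fun _ => (0 : Fib q)) hw e
  rw [tcoeff_zero] at h5
  have c1 := kB.lie (cylMapAt_xField a)
  have c2 := kA.lie (cylMapAt_tField hF)
  have h6 := (tcoeff_add (c1.sub c2) (c3.sub c4) e).symm.trans h5
  rw [tcoeff_sub c1 c2, tcoeff_sub c3 c4, h1, h2] at h6
  rw [← h6]
  congr 1
  refine Eq.trans ?_ (congrArg₂ (· - ·) h3 h4).symm
  rw [← Finset.sum_sub_distrib]
  refine Finset.sum_congr rfl fun s _ => ?_
  rw [← smul_sub, VectorField.lieBracket, cA.fderiv_tcoeff, cB.fderiv_tcoeff]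
  rfl

/-- A homomorphism of Lie algebras that vanishes on an ideal descends to the quotient. -/
def quotientLift {L L' : Type} [LieRing L] [LieAlgebra ℂ L] [LieRing L'] [LieAlgebra ℂ L']
    (I : LieIdeal ℂ L) (f : L →ₗ⁅ℂ⁆ L') (h : I ≤ f.ker) : L ⧸ I →ₗ⁅ℂ⁆ L' where
  toLinearMap := I.toSubmodule.liftQ (f : L →ₗ[ℂ] L') fun x hx => LieHom.mem_ker.1 (h hx)
  map_lie' := by
    intro x y
    obtain ⟨x, rfl⟩ := LieSubmodule.Quotient.surjective_mk' I x
    obtain ⟨y, rfl⟩ := LieSubmodule.Quotient.surjective_mk' I y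
    exact f.map_lie x y

open Classical in
/-- The vector field on `W` whose values are the Taylor coefficients of a function on `ℰ × W`. -/
def coeffField {n : ℕ} (W : Opens (Fib q)) (f : Jet m ℕ × Fib q → Fib q)
    (hf : ∀ w ∈ W, CylAnalyticAt f (a, w)) (e : Expo m n) : VF W :=
  ⟨fun w => if w ∈ W then tcoeff a e (fun z => f (z, w)) else 0, by
    refine ⟨fun w hw => ?_, fun w hw => if_neg hw⟩
    refine ((hf w hw).analyticAt_tcoeff e).congr ?_
    filter_upwards [W.isOpen.mem_nhds hw] with y hy
    exact (if_pos hy).symm⟩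

theorem coeffField_apply {n : ℕ} {W : Opens (Fib q)} {f : Jet m ℕ × Fib q → Fib q}
    (hf : ∀ w ∈ W, CylAnalyticAt f (a, w)) (e : Expo m n) {w : Fib q} (hw : w ∈ W) :
    (coeffField W f hf e).1 w = tcoeff a e (fun z => f (z, w)) := if_pos hw

/-- The generators act by the Taylor coefficients of A and B at `a`. The relators act by zero, by
the covering equation for 𝐙 and by normality for the symbols. -/
theorem exists_action_of_normal (hF : AnalyticAt ℂ F (trunc (d + 1) a))
    (hcov : IsCoveringAt F A B (a, b)) (hord : OrderLEAt p A (a, b))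
    (hn : ∀ c, NormalAt a b A B c) :
    ∃ (W : Opens (Fib q)) (_ : b ∈ W) (ρ : LieAction (FAlg p F a) W), ArisesAt p F a ρ b A B := by
  have hA : CylAnalyticAt A (a, b) := jetAnalyticAt_iff.1 hcov.1
  have hB : CylAnalyticAt B (a, b) := jetAnalyticAt_iff.1 hcov.2.1
  have hA' : ∀ᶠ y in 𝓝 (a, b), ∀ c ∉ cols m (p + 1), lineDeriv ℂ A y (bv c, 0) = 0 := by
    filter_upwards [hord] with y hy c hc
    rcases c with _ | _ | ⟨i, k⟩
    · exact absurd ⟨none, rfl⟩ hc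
    · exact absurd ⟨some none, rfl⟩ hc
    · rw [← lineDeriv_slice]
      exact hy i k (not_lt.1 fun h => hc (mem_cols_u.2 h))
  have rA := hA.eventually_eq_reset hA'
  have rB := hB.eventually_eq_reset (eventually_lineDeriv_B_eq_zero hF hcov hord)
  -- One open set serves all of the infinitely many exponents, because the coefficient identities
  -- were proved with the exponent quantified inside the neighborhood.
  obtain ⟨V, hV, hVo, hbV⟩ := eventually_nhds_iff.1
    ((eventually_base hA.eventually).and ((eventually_base hB.eventually).and
      ((eventually_coeffNormal (d := d) p hA hn).and (eventually_coeff_covering hF hcov rA rB))))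
  let W : Opens (Fib q) := ⟨V, hVo⟩
  have kA : ∀ w ∈ W, CylAnalyticAt A (a, w) := fun w hw => (hV w hw).1
  have kB : ∀ w ∈ W, CylAnalyticAt B (a, w) := fun w hw => (hV w hw).2.1
  let φ : Gen m d p → VF W
    | Gen.A e => coeffField W A kA e
    | Gen.B e => coeffField W B kB e
  let ψ : Free m d p →ₗ⁅ℂ⁆ VF W := FreeLieAlgebra.lift ℂ φ
  have ψA : ∀ e, ψ (symA p e) = coeffField W A kA e := fun e =>
    FreeLieAlgebra.lift_of_apply (R := ℂ) φ (Gen.A e)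
  have ψB : ∀ e, ψ (symB p e) = coeffField W B kB e := fun e =>
    FreeLieAlgebra.lift_of_apply (R := ℂ) φ (Gen.B e)
  have hker : relIdeal p F a ≤ ψ.ker := by
    refine LieSubmodule.lieSpan_le.2 ?_
    rintro r (⟨e, rfl⟩ | ⟨l₁, l₂, rfl⟩ | ⟨l₂, rfl⟩ | ⟨l₁, l₂, i₀, k₀, hk₀, α, hα, rfl⟩)
    · refine LieHom.mem_ker.2 (VF.ext_on fun w hw => ?_)
      rw [elemZ_eq_sum hF e (Nat.lt_succ_self (deg e))]
      simp only [map_add, map_sub, map_sum, map_smul, LieHom.map_lie, ψA, ψB]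
      refine Eq.trans ?_ ((hV w hw).2.2.2 e (deg e + 1) (Nat.lt_succ_self (deg e)))
      simp only [Submodule.coe_add, Submodule.coe_sub, Submodule.coe_sum, Submodule.coe_smul,
        Pi.add_apply, Pi.sub_apply, Finset.sum_apply, Pi.smul_apply, coeffField_apply _ _ hw,
        VF.bracket_apply _ _ hw]
      congr 1
      refine Finset.sum_congr rfl fun s _ => ?_
      congr 1
      refine EventuallyEq.lieBracket_vectorField_eq ?_ ?_
      · filter_upwards [W.isOpen.mem_nhds hw] with y hy using coeffField_apply kA s.1 hy
      · filter_upwards [W.isOpen.mem_nhds hw] with y hy using coeffField_apply kB s.2 hy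
    · refine LieHom.mem_ker.2 ((ψA _).trans (VF.ext_on fun w hw => ?_))
      rw [coeffField_apply _ _ hw]
      exact (hV w hw).2.2.1.A_zero l₁ l₂
    · refine LieHom.mem_ker.2 ((ψB _).trans (VF.ext_on fun w hw => ?_))
      rw [coeffField_apply _ _ hw]
      exact (hV w hw).2.2.1.B_zero l₂
    · refine LieHom.mem_ker.2 ((ψA _).trans (VF.ext_on fun w hw => ?_))
      rw [coeffField_apply _ _ hw]
      exact (hV w hw).2.2.1.A_special l₁ l₂ i₀ k₀ hk₀ α hα
  let ρ : LieAction (FAlg p F a) W := quotientLift (relIdeal p F a) ψ hker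
  have ρA : ∀ e, ρ (genA p F a e) = coeffField W A kA e := ψA
  have ρB : ∀ e, ρ (genB p F a e) = coeffField W B kB e := ψB
  refine ⟨W, hbV, ρ, hcov.1, hcov.2.1, ?_⟩
  filter_upwards [hA.eventually_hasSum rA, hB.eventually_hasSum rB,
    (continuous_snd.tendsto (a, b)).eventually (W.isOpen.mem_nhds hbV)] with y h1 h2 h3
  have h4 : y.2 ∈ W := h3
  simp only [ρA, ρB, coeffField_apply _ _ h4]
  exact ⟨h1, h2⟩

end FormalCovering

/-! ### Coverings that arise from an action -/

section Arises

variable {m d q p : ℕ} {F : Jet m (Fin (d + 1)) → Fin m → ℂ} {a : Jet m ℕ} {b : Fib q}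
  {A B : Jet m ℕ × Fib q → Fib q}

theorem mono_reset {n : ℕ} (e : Expo m n) (z : Jet m ℕ) :
    mono a e (reset (cols m n) a z) = mono a e z := by
  rw [mono_eq_prod, mono_eq_prod]
  refine Finset.prod_congr rfl fun c _ => ?_
  rw [co_reset, if_pos ⟨c, rfl⟩]

theorem eventually_lineDeriv_eq_zero_of_hasSum {n : ℕ} {f : Jet m ℕ × Fib q → Fib q}
    {c : Expo m n → Fib q → Fib q}
    (h : ∀ᶠ y in 𝓝 (a, b), HasSum (fun e : Expo m n => mono a e y.1 • c e y.2) (f y)) :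
    ∀ᶠ y in 𝓝 (a, b), ∀ i ∉ cols m n, lineDeriv ℂ f y (bv i, 0) = 0 := by
  have h1 : ∀ᶠ y in 𝓝 (a, b), f y = f (reset (cols m n) a y.1, y.2) := by
    filter_upwards [h, (tendsto_reset_prod (cols m n) a b).eventually h] with y h2 h3
    simp only [mono_reset] at h3
    exact h2.unique h3
  filter_upwards [h1.eventually_nhds] with y hy i hi
  rw [lineDeriv_congr (g := fun y : Jet m ℕ × Fib q => f (reset (cols m n) a y.1, y.2)) hy]
  have h2 : ∀ s : ℂ, reset (cols m n) a (y.1 + s • bv i) = reset (cols m n) a y.1 := by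
    intro s
    refine jet_ext fun c => ?_
    rw [co_reset, co_reset]
    split_ifs with hc
    · rw [co_add, co_smul, co_bv, if_neg (by rintro rfl; exact hi hc), mul_zero, add_zero]
    · rfl
  simp only [lineDeriv, Prod.fst_add, Prod.smul_fst, h2, Prod.snd_add, Prod.smul_snd, smul_zero,
    add_zero, deriv_const]

variable {W : Opens (Fib q)} {ρ : LieAction (FAlg p F a) W}

/-- Uniqueness of power series coefficients: the action can be recovered from the covering. -/
theorem ArisesAt.eventually_tcoeff (h : ArisesAt p F a ρ b A B) :
    ∀ᶠ w in 𝓝 b, (∀ e, tcoeff a e (fun z => A (z, w)) = (ρ (genA p F a e)).1 w) ∧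
      ∀ e, tcoeff a e (fun z => B (z, w)) = (ρ (genB p F a e)).1 w := by
  obtain ⟨hA, hB, hs⟩ := h
  rw [jetAnalyticAt_iff] at hA hB
  filter_upwards [eventually_slice hs, eventually_base hA.eventually, eventually_base hB.eventually]
    with w hw cA cB
  exact ⟨tcoeff_eq_of_hasSum (f := fun z => A (z, w)) cA.slice_left (hw.mono fun z hz => hz.1),
    tcoeff_eq_of_hasSum (f := fun z => B (z, w)) cB.slice_left (hw.mono fun z hz => hz.2)⟩

theorem mk_eq_zero_of_mem_relators {r : Free m d p} (h : r ∈ relators p F a) :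
    (LieSubmodule.Quotient.mk r : FAlg p F a) = 0 :=
  LieSubmodule.Quotient.mk_eq_zero'.2 (LieSubmodule.subset_lieSpan h)

/-- The symbols divided out in 𝔽^p(ℰ, a) act by zero, so the corresponding Taylor coefficients
vanish. -/
theorem ArisesAt.normalAt (h : ArisesAt p F a ρ b A B) (c : Coord m ℕ) : NormalAt a b A B c := by
  refine normalAt_of_coeffNormal (jetAnalyticAt_iff.1 h.1) (jetAnalyticAt_iff.1 h.2.1)
    (eventually_lineDeriv_eq_zero_of_hasSum (n := p + 1) (h.2.2.mono fun y hy => hy.1))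
    (eventually_lineDeriv_eq_zero_of_hasSum (n := p + d) (h.2.2.mono fun y hy => hy.2)) ?_ c
  filter_upwards [h.eventually_tcoeff] with w hw
  have key : ∀ r ∈ relators p F a, (ρ (LieSubmodule.Quotient.mk r)).1 w = 0 := by
    intro r hr
    rw [mk_eq_zero_of_mem_relators hr, map_zero]
    rfl
  exact ⟨fun l₁ l₂ => (hw.1 _).trans (key _ (Or.inr (Or.inl ⟨l₁, l₂, rfl⟩))),
    fun l₂ => (hw.2 _).trans (key _ (Or.inr (Or.inr (Or.inl ⟨l₂, rfl⟩)))),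
    fun l₁ l₂ i₀ k₀ hk₀ γ hγ =>
      (hw.1 _).trans (key _ (Or.inr (Or.inr (Or.inr ⟨l₁, l₂, i₀, k₀, hk₀, γ, hγ, rfl⟩))))⟩

end Arises

/-! ### Related vector fields -/

section Related

variable {q : ℕ}

/-- Differentiate both relations, each along the other field. The second derivative of φ is
symmetric and drops out of the difference. -/
theorem fderiv_lieBracket_of_related {O : Set (Fib q)} (hO : IsOpen O) {φ : Fib q → Fib q}
    {X X' Y Y' : Fib q → Fib q} {w : Fib q} (hw : w ∈ O) (hφ : AnalyticAt ℂ φ w)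
    (hX : DifferentiableAt ℂ X w) (hX' : DifferentiableAt ℂ X' w)
    (hY : DifferentiableAt ℂ Y (φ w)) (hY' : DifferentiableAt ℂ Y' (φ w))
    (h : ∀ w ∈ O, fderiv ℂ φ w (X w) = Y (φ w)) (h' : ∀ w ∈ O, fderiv ℂ φ w (X' w) = Y' (φ w)) :
    fderiv ℂ φ w (VectorField.lieBracket ℂ X X' w) = VectorField.lieBracket ℂ Y Y' (φ w) := by
  have key : ∀ {Z T : Fib q → Fib q}, DifferentiableAt ℂ Z w → DifferentiableAt ℂ T (φ w) →
      (∀ w ∈ O, fderiv ℂ φ w (Z w) = T (φ w)) → ∀ v,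
      fderiv ℂ (fderiv ℂ φ) w v (Z w) + fderiv ℂ φ w (fderiv ℂ Z w v)
        = fderiv ℂ T (φ w) (fderiv ℂ φ w v) := by
    intro Z T hZ hT hZT v
    have h1 : (fun w => fderiv ℂ φ w (Z w)) =ᶠ[𝓝 w] fun w => T (φ w) := by
      filter_upwards [hO.mem_nhds hw] with y hy using hZT y hy
    have h2 := hφ.fderiv.differentiableAt.hasFDerivAt.clm_apply hZ.hasFDerivAt
    have h3 := hT.hasFDerivAt.comp w hφ.differentiableAt.hasFDerivAt
    have h4 := (h2.congr_of_eventuallyEq h1.symm).unique h3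
    have h5 := congrArg (fun M : Fib q →L[ℂ] Fib q => M v) h4
    simp only [add_apply, ContinuousLinearMap.comp_apply, ContinuousLinearMap.flip_apply] at h5
    rw [add_comm]
    exact h5
  have hs : IsSymmSndFDerivAt ℂ φ w := ContDiffAt.isSymmSndFDerivAt_of_omega hφ.contDiffAt
  have h1 := key hX hY h (X' w)
  have h2 := key hX' hY' h' (X w)
  rw [h w hw] at h2
  rw [h' w hw] at h1
  rw [VectorField.lieBracket, VectorField.lieBracket, map_sub, ← h1, ← h2, hs (X w) (X' w)]
  abel

variable {W₁ W₂ : Opens (Fib q)}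

/-- The universal property gives a homomorphism to K whose composition with the inclusion fixes the
generators, hence is the identity. -/
theorem mem_of_generators_mem {X : Type} {K : LieSubalgebra ℂ (FreeLieAlgebra ℂ X)}
    (h : ∀ x, FreeLieAlgebra.of ℂ x ∈ K) (y : FreeLieAlgebra ℂ X) : y ∈ K := by
  let f : FreeLieAlgebra ℂ X →ₗ⁅ℂ⁆ K := FreeLieAlgebra.lift ℂ fun x => ⟨FreeLieAlgebra.of ℂ x, h x⟩
  have h1 : K.incl.comp f = LieHom.id := by
    refine FreeLieAlgebra.hom_ext fun x => ?_
    simp [f, FreeLieAlgebra.lift_of_apply]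
  have h2 : K.incl (f y) = y := congrArg (fun g : FreeLieAlgebra ℂ X →ₗ⁅ℂ⁆ _ => g y) h1
  rw [← h2]
  exact (f y).2

/-- If the values of two actions of a free Lie algebra on the generators are related by a map, then
all their values are. -/
theorem related_of_generators {X : Type} (ρ₁ : LieAction (FreeLieAlgebra ℂ X) W₁)
    (ρ₂ : LieAction (FreeLieAlgebra ℂ X) W₂) {O : Set (Fib q)} (hO : IsOpen O)
    {φ : Fib q → Fib q} (hφ : ∀ w ∈ O, AnalyticAt ℂ φ w) (h₁ : ∀ w ∈ O, w ∈ W₁)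
    (h₂ : ∀ w ∈ O, φ w ∈ W₂)
    (h : ∀ x, ∀ w ∈ O, fderiv ℂ φ w ((ρ₁ (FreeLieAlgebra.of ℂ x)).1 w)
      = (ρ₂ (FreeLieAlgebra.of ℂ x)).1 (φ w)) (y : FreeLieAlgebra ℂ X) :
    ∀ w ∈ O, fderiv ℂ φ w ((ρ₁ y).1 w) = (ρ₂ y).1 (φ w) := by
  let K : LieSubalgebra ℂ (FreeLieAlgebra ℂ X) :=
    { carrier := {y | ∀ w ∈ O, fderiv ℂ φ w ((ρ₁ y).1 w) = (ρ₂ y).1 (φ w)}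
      add_mem' := by
        intro y y' hy hy' w hw
        rw [map_add, map_add, Submodule.coe_add, Submodule.coe_add, Pi.add_apply, Pi.add_apply,
          map_add, hy w hw, hy' w hw]
      zero_mem' := by
        intro w hw
        rw [map_zero, map_zero]
        exact map_zero _
      smul_mem' := by
        intro c y hy w hw
        rw [map_smul, map_smul, Submodule.coe_smul, Submodule.coe_smul, Pi.smul_apply,
          Pi.smul_apply, map_smul, hy w hw]
      lie_mem' := by
        intro y y' hy hy' w hw
        rw [LieHom.map_lie, LieHom.map_lie, VF.bracket_apply _ _ (h₁ w hw),
          VF.bracket_apply _ _ (h₂ w hw)]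
        exact fderiv_lieBracket_of_related hO hw (hφ w hw)
          (VF.differentiableAt _ (h₁ w hw)) (VF.differentiableAt _ (h₁ w hw))
          (VF.differentiableAt _ (h₂ w hw)) (VF.differentiableAt _ (h₂ w hw)) hy hy' }
  exact mem_of_generators_mem (K := K) h y

end Related

/-! ### Local isomorphism of actions with gauge equivalent coverings -/

section Uniqueness

variable {m d q p : ℕ} {F : Jet m (Fin (d + 1)) → Fin m → ℂ} {a : Jet m ℕ} {b b₁ b₂ : Fib q}
  {A B A₁ B₁ A₂ B₂ g h : Jet m ℕ × Fib q → Fib q} {W₁ W₂ : Opens (Fib q)}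

/-- The projection of the free Lie algebra to its quotient. -/
def projF (p : ℕ) (F : Jet m (Fin (d + 1)) → Fin m → ℂ) (a : Jet m ℕ) :
    Free m d p →ₗ⁅ℂ⁆ FAlg p F a where
  toLinearMap := (relIdeal p F a).toSubmodule.mkQ
  map_lie' := fun {x y} => LieSubmodule.Quotient.mk_bracket _ x y

theorem eventually_tcoeff_related {φ : Fib q → Fib q} {n : ℕ}
    {f₁ f₂ : Jet m ℕ × Fib q → Fib q} (hf₁ : CylAnalyticAt f₁ (a, b₁))
    (hh : ∀ᶠ y in 𝓝 (a, b₁), fderiv ℂ φ y.2 (f₁ y) = f₂ (y.1, φ y.2)) :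
    ∀ᶠ w in 𝓝 b₁, ∀ e : Expo m n,
      fderiv ℂ φ w (tcoeff a e fun z => f₁ (z, w)) = tcoeff a e fun z => f₂ (z, φ w) := by
  filter_upwards [eventually_slice hh, eventually_base hf₁.eventually] with w hw h1 e
  rw [← tcoeff_clm_comp (f := fun z => f₁ (z, w)) h1.slice_left]
  exact tcoeff_congr hw e

/-- Both coverings are normal, so g is a map φ of the fibre alone and the gauge equations say that φ
carries A₁, B₁ to A₂, B₂. Comparing Taylor coefficients at `a`, φ relates the generators, and then
the whole algebra. -/
theorem GaugePair.locallyIsomorphicAt (H : GaugePair F a b₂ A₂ B₂ b₁ A₁ B₁ g h)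
    (hb₁ : b₁ ∈ W₁) (hb₂ : b₂ ∈ W₂) {ρ₁ : LieAction (FAlg p F a) W₁}
    {ρ₂ : LieAction (FAlg p F a) W₂} (h₁ : ArisesAt p F a ρ₁ b₁ A₁ B₁)
    (h₂ : ArisesAt p F a ρ₂ b₂ A₂ B₂) : LocallyIsomorphicAt ρ₁ b₁ ρ₂ b₂ := by
  have hA₁ := jetAnalyticAt_iff.1 h₁.1
  have hB₁ := jetAnalyticAt_iff.1 h₁.2.1
  have hbase := H.eventually_eq_base (jetAnalyticAt_iff.1 h₂.1) hA₁ h₂.normalAt h₁.normalAt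
  set φ : Fib q → Fib q := fun w => g (a, w) with hφd
  set ψ : Fib q → Fib q := fun w => h (a, w) with hψd
  have hφb : φ b₁ = b₂ := H.map_base
  have hψb : ψ b₂ = b₁ := H.inv_map_base
  have hφ : AnalyticAt ℂ φ b₁ := H.hg.slice_right
  have hψ : AnalyticAt ℂ ψ b₂ := H.hh.slice_right
  have tφ : Tendsto φ (𝓝 b₁) (𝓝 b₂) := hφb ▸ hφ.continuousAt.tendsto
  -- The jet part of any direction is irrelevant, so the total derivatives disappear from the gauge
  -- equations.
  have hder : ∀ᶠ y in 𝓝 (a, b₁), ∀ v ω, lineDeriv ℂ g y (v, ω) = fderiv ℂ φ y.2 ω := by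
    filter_upwards [hbase.eventually_nhds,
      (continuous_snd.tendsto (a, b₁)).eventually hφ.eventually_analyticAt] with y h3 h4 v ω
    rw [lineDeriv_congr (g := fun y : Jet m ℕ × Fib q => φ y.2) h3, ← h4.differentiableAt.lineDeriv_eq_fderiv]
    rfl
  have relA : ∀ᶠ y in 𝓝 (a, b₁), fderiv ℂ φ y.2 (A₁ y) = A₂ (y.1, φ y.2) := by
    filter_upwards [hder, H.eq_x, hbase] with y h3 h4 h5
    rw [xLift, h3, h5] at h4
    exact h4
  have relB : ∀ᶠ y in 𝓝 (a, b₁), fderiv ℂ φ y.2 (B₁ y) = B₂ (y.1, φ y.2) := by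
    filter_upwards [hder, H.eq_t, hbase] with y h3 h4 h5
    rw [tLift, h3, h5] at h4
    exact h4
  have hU : ∀ᶠ w in 𝓝 b₁, AnalyticAt ℂ φ w ∧ ψ (φ w) = w ∧ w ∈ W₁ ∧ φ w ∈ W₂ ∧
      ∀ x : Gen m d p, fderiv ℂ φ w ((ρ₁ (projF p F a (FreeLieAlgebra.of ℂ x))).1 w)
        = (ρ₂ (projF p F a (FreeLieAlgebra.of ℂ x))).1 (φ w) := by
    filter_upwards [hφ.eventually_analyticAt, eventually_base H.left_inv, W₁.isOpen.mem_nhds hb₁,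
      tφ.eventually (W₂.isOpen.mem_nhds hb₂), eventually_tcoeff_related (n := p + 1) hA₁ relA,
      eventually_tcoeff_related (n := p + d) hB₁ relB, h₁.eventually_tcoeff,
      tφ.eventually h₂.eventually_tcoeff] with w k1 k2 k3 k4 k5 k6 k7 k8
    refine ⟨k1, k2, k3, k4, fun x => ?_⟩
    rcases x with e | e
    · have := k5 e
      rw [k7.1, k8.1] at this
      exact this
    · have := k6 e
      rw [k7.2, k8.2] at this
      exact this
  obtain ⟨U, hU, hUo, hbU⟩ := eventually_nhds_iff.1 hU
  obtain ⟨V, hV, hVo, hbV⟩ := eventually_nhds_iff.1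
    (hψ.eventually_analyticAt.and (eventually_base H.right_inv))
  have hcφ : ContinuousOn φ U := fun w hw => (hU w hw).1.continuousAt.continuousWithinAt
  have hcψ : ContinuousOn ψ V := fun w hw => (hV w hw).1.continuousAt.continuousWithinAt
  let Φ : OpenPartialHomeomorph (Fib q) (Fib q) :=
    { toFun := φ
      invFun := ψ
      source := U ∩ φ ⁻¹' V
      target := V ∩ ψ ⁻¹' U
      map_source' := fun w hw => ⟨hw.2, by rw [Set.mem_preimage, (hU w hw.1).2.1]; exact hw.1⟩
      map_target' := fun v hv => ⟨hv.2, by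
        have := (hV v hv.1).2
        rw [Set.mem_preimage]
        rw [show φ (ψ v) = v from this]
        exact hv.1⟩
      left_inv' := fun w hw => (hU w hw.1).2.1
      right_inv' := fun v hv => (hV v hv.1).2
      open_source := hcφ.isOpen_inter_preimage hUo hVo
      open_target := hcψ.isOpen_inter_preimage hVo hUo
      continuousOn_toFun := hcφ.mono Set.inter_subset_left
      continuousOn_invFun := hcψ.mono Set.inter_subset_left }
  refine ⟨Φ, fun w hw => (hU w hw.1).2.2.1, fun v hv => ?_, ⟨hbU, ?_⟩, hφb,
    fun w hw => (hU w hw.1).1, fun v hv => (hV v hv.1).1, fun Y w hw => ?_⟩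
  · have h3 := (hU (ψ v) hv.2).2.2.2.1
    rwa [show φ (ψ v) = v from (hV v hv.1).2] at h3
  · rw [Set.mem_preimage, hφb]
    exact hbV
  -- Both actions are pulled back to the free Lie algebra, where relatedness on generators suffices.
  · obtain ⟨y, rfl⟩ := LieSubmodule.Quotient.surjective_mk' (relIdeal p F a) Y
    exact related_of_generators (ρ₁.comp (projF p F a)) (ρ₂.comp (projF p F a)) Φ.open_source
      (fun w hw => (hU w hw.1).1) (fun w hw => (hU w hw.1).2.2.1)
      (fun w hw => (hU w hw.1).2.2.2.1) (fun x w hw => (hU w hw.1).2.2.2.2 x) y w hw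

end Uniqueness

end

end EvCov

theorem mainTheorem3 {m d q : ℕ} (p : ℕ)
    (F : EvCov.Jet m (Fin (d + 1)) → Fin m → ℂ) (a : EvCov.Jet m ℕ)
    (hF : AnalyticAt ℂ F (EvCov.trunc (d + 1) a))
    (b : EvCov.Fib q) (A B : EvCov.Jet m ℕ × EvCov.Fib q → EvCov.Fib q)
    (hcov : EvCov.IsCoveringAt F A B (a, b)) (hord : EvCov.OrderLEAt p A (a, b)) :
    (∃ (W : TopologicalSpace.Opens (EvCov.Fib q)) (_ : b ∈ W)
        (ρ : EvCov.LieAction (EvCov.FAlg p F a) W)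
        (A' B' : EvCov.Jet m ℕ × EvCov.Fib q → EvCov.Fib q),
        EvCov.ArisesAt p F a ρ b A' B' ∧
        EvCov.IsCoveringAt F A' B' (a, b) ∧ EvCov.OrderLEAt p A' (a, b) ∧
        EvCov.GaugeEquivAt F a b A B b A' B') ∧
    (∀ (W₁ W₂ : TopologicalSpace.Opens (EvCov.Fib q)) (b₁ b₂ : EvCov.Fib q),
        b₁ ∈ W₁ → b₂ ∈ W₂ →
        ∀ (ρ₁ : EvCov.LieAction (EvCov.FAlg p F a) W₁)
          (ρ₂ : EvCov.LieAction (EvCov.FAlg p F a) W₂)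
          (A₁ B₁ A₂ B₂ : EvCov.Jet m ℕ × EvCov.Fib q → EvCov.Fib q),
          EvCov.ArisesAt p F a ρ₁ b₁ A₁ B₁ → EvCov.GaugeEquivAt F a b A B b₁ A₁ B₁ →
          EvCov.ArisesAt p F a ρ₂ b₂ A₂ B₂ → EvCov.GaugeEquivAt F a b A B b₂ A₂ B₂ →
          EvCov.LocallyIsomorphicAt ρ₁ b₁ ρ₂ b₂) := by
  constructor
  · obtain ⟨A', B', h1, h2, h3, h4⟩ := EvCov.exists_normal_covering hF hcov hord
    obtain ⟨W, hW, ρ, hρ⟩ := EvCov.exists_action_of_normal hF h2 h3 h4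
    exact ⟨W, hW, ρ, A', B', hρ, h2, h3, h1⟩
  · intro W₁ W₂ b₁ b₂ hb₁ hb₂ ρ₁ ρ₂ A₁ B₁ A₂ B₂ h₁ e₁ h₂ e₂
    obtain ⟨g₁, k₁, H₁⟩ := EvCov.gaugeEquivAt_iff.1 e₁
    obtain ⟨g₂, k₂, H₂⟩ := EvCov.gaugeEquivAt_iff.1 e₂
    -- Going through (A, B), the two coverings are gauge equivalent to each other.
    exact (H₂.symm.trans H₁).locallyIsomorphicAt hb₁ hb₂ h₁ h₂
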